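/- **Setting.** A stream over $[n]$ is a finite sequence $A=(a_1,\dots,a_{|A|})$ of elements of $[n]$, and $m_i$ is the number of occurrences of $i$ in $A$. For $f:\mathbb N\to[0,\infty)$ with $f(0)=0$ put $\bar f(A)=\frac1{|A|}\sum_{i\in[n]}f(m_i)$. Choose a position $J$ of $A$ uniformly at random, let $R=|\{j\ge J: a_j=a_J\}|$ and $X=f(R)-f(R-1)$. Let $\mathcal A$ be a nonempty class of streams over $[n]$ of length at most $m$. * $\lambda_{f,\mathcal A}$ is the infimum of all $\lambda\ge1$ such that for every $A\in\mathcal A$, every $0<\epsilon\le\frac14$, every possible value of $R$ and every positive integer $\hat R$ with $|\hat R-R|\le\epsilon R$, the number $\hat X=f(\hat R)-f(\hat R-1)$ satisfies $|X-\hat X|\le\lambda\,\epsilon\,X$. * $\pi(A)$ is the minimum of $\dfrac{3(1+a/\mathbf E[X])^2(a+b)}{a+\mathbf E[X]}$ over all $a\ge0$, $b>0$ with $-a\le X\le b$ for all possible values of $X$. * $\kappa(\epsilon,\delta,\mathcal A)=\epsilon^{-2}\ln(2\delta^{-1})\cdot\sup_{A\in\mathcal A}\pi(A)$. Assume that $\bar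 f(A)>0$ for all $A\in\mathcal A$ and that at least one $\lambda$ as above exists (so that $\pi$ and $\lambda_{f,\mathcal A}$ are finite). **Model.** In the distributed monitoring model there are $k\ge1$ sites and one coordinator. The items of a global stream, fixed in advance and unknown to the algorithm, arrive one at a time, each at one site. Each site can exchange messages with the coordinator; all messages caused by an item are delivered before the next item arrives. The coordinator acts only when it receives a message, and only its communication is charged. The sites are randomized word RAMs that run a fixed program, independent of all parameters. The word length is $O(\log(n+m+k+1/\epsilon+1/\delta))$ bits, each word operation (including drawing a random word and sending a word) takes one step, and the initial memory content may depend on $n,m,k,\epsilon,\delta,f,\mathcal A$. **Statement.** For all $0<\epsilon\le1$ and $0<\delta<1$ and all $n,m,k,f,\mathcal A$ as above there is a randomized distributed monitoring algorithm with the following properties. Here the constants in $O$ are absolute, and $\tilde O$ suppresses absolute constants and factors polylogarithmic in $n,m,k,1/\epsilon,1/\delta$. 1. For every stream and every time step $t$ at which the stream $A(t)$ received so far belongs to $\mathcal A$, the value $\hat f$ reported by the coordinator is a $(1+\epsilon,\delta)$-approximation of $\bar f(A(t))$, that is, $\Pr\big[|\hat f-\bar f(A(t))|>\epsilon\bar f(A(t))\big]\le\delta$.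 2. On every stream of length at most $m$ the total communication is $$\tilde O\!\left(\Big(\frac{k}{\epsilon^2}+\frac{\sqrt k}{\epsilon^3}\Big)\cdot\lambda_{f,\mathcal A}\cdot\sup_{A\in\mathcal A}\pi(A)\right)\ \text{bits.}$$ 3. Let $\kappa=\kappa(\frac\epsilon2,\frac\delta2,\mathcal A)$. Each site uses $\tilde O(\kappa)$ bits of space, and on every stream of length at most $m$ each site spends amortized $O(\kappa)$ time per item it receives, plus amortized $O(1)$ time per message it receives. The bounds in 2 and 3 hold for every outcome of the random choices. -/

import Mathlib

open MeasureTheory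

/-! ## Streams, AMS sampling and the quantities `λ`, `π`, `κ`

A stream over the universe `[n]` is a list `A : List (Fin n)`. -/

namespace AMS

/-- `f̄(A) = (1/|A|) ∑_{i ∈ [n]} f(m_i)`, where `m_i` is the frequency of `i` in `A`. -/
noncomputable def fbar {n : ℕ} (f : ℕ → ℝ) (A : List (Fin n)) : ℝ :=
  (∑ i : Fin n, f (A.count i)) / A.length

/-- The tail frequency `R` of the item at position `j`: the number of occurrences of the element
`a_j` among the items at positions `≥ j`. -/
def tailFreq {n : ℕ} (A : List (Fin n)) (j : Fin A.length) : ℕ :=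
  (A.drop j).count (A.get j)

/-- The increment `f(r) - f(r-1)`; it is only used for `r ≥ 1`. -/
def incr (f : ℕ → ℝ) (r : ℕ) : ℝ := f r - f (r - 1)

/-- `E[X]` for `X = f(R) - f(R-1)`, where `R` is the tail frequency of a uniformly random position
of `A`. -/
noncomputable def meanX {n : ℕ} (f : ℕ → ℝ) (A : List (Fin n)) : ℝ :=
  (∑ j : Fin A.length, incr f (tailFreq A j)) / A.length

/-- All `l ≥ 1` such that, for every `A ∈ 𝒜`, every `0 < ε ≤ 1/4`, every possible value `R` of the
tail frequency of a random position of `A`, and every positive integer `R'` that is a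
`(1+ε)`-approximation of `R`, one has `|X - X'| ≤ l ε X`. -/
def lambdaSet {n : ℕ} (f : ℕ → ℝ) (𝒜 : Set (List (Fin n))) : Set ℝ :=
  {l | 1 ≤ l ∧ ∀ A ∈ 𝒜, ∀ ε : ℝ, 0 < ε → ε ≤ 1 / 4 → ∀ (j : Fin A.length) (R' : ℕ), 1 ≤ R' →
    |(R' : ℝ) - (tailFreq A j : ℝ)| ≤ ε * (tailFreq A j : ℝ) →
    |incr f (tailFreq A j) - incr f R'| ≤ l * ε * incr f (tailFreq A j)}

/-- `λ_{f,𝒜}`, the infimum of `lambdaSet f 𝒜`. -/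
noncomputable def lam {n : ℕ} (f : ℕ → ℝ) (𝒜 : Set (List (Fin n))) : ℝ :=
  sInf (lambdaSet f 𝒜)

/-- `π(A)`: the minimum of `3 (1 + a/E[X])² (a+b) / (a + E[X])` over all `a ≥ 0`, `b > 0` with
`-a ≤ X ≤ b` for every possible value of `X`. -/
noncomputable def piVal {n : ℕ} (f : ℕ → ℝ) (A : List (Fin n)) : ℝ :=
  sInf {v | ∃ a b : ℝ, 0 ≤ a ∧ 0 < b ∧
    (∀ j : Fin A.length, -a ≤ incr f (tailFreq A j) ∧ incr f (tailFreq A j) ≤ b) ∧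
    v = 3 * (1 + a / meanX f A) ^ 2 * (a + b) / (a + meanX f A)}

/-- `sup_{A ∈ 𝒜} π(A)`. -/
noncomputable def supPi {n : ℕ} (f : ℕ → ℝ) (𝒜 : Set (List (Fin n))) : ℝ :=
  sSup (piVal f '' 𝒜)

/-- `κ(ε, δ, 𝒜) = ε⁻² ln(2 δ⁻¹) sup_{A ∈ 𝒜} π(A)`. -/
noncomputable def kappa {n : ℕ} (ε δ : ℝ) (f : ℕ → ℝ) (𝒜 : Set (List (Fin n))) : ℝ :=
  (ε ^ 2)⁻¹ * Real.log (2 * δ⁻¹) * supPi f 𝒜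

/-- The logarithm whose powers the notation `Õ` suppresses:
`⌈log₂ (2 + n + m + k + ⌈1/ε⌉ + ⌈1/δ⌉)⌉`. -/
noncomputable def logParam (n m k : ℕ) (ε δ : ℝ) : ℕ :=
  Nat.clog 2 (2 + n + m + k + ⌈ε⁻¹⌉₊ + ⌈δ⁻¹⌉₊)

end AMS

/-! ## The sites: randomized word RAMs with a step count

A word has `w` bits. Arithmetic is modulo `2 ^ w`. The control structure is `if` and counted loops,
so that every program halts. -/

namespace Ram

/-- Machine words of `w` bits. -/
abbrev Word (w : ℕ) : Type := Fin (2 ^ w)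

/-- Word expressions. `inp` is the item or the message that is being handled, `load a` is the
content of the memory cell with address `a`, `lt` and `eq` return `1` or `0`. -/
inductive Expr : Type
  | const (c : ℕ)
  | inp
  | load (a : Expr)
  | add (x y : Expr)
  | sub (x y : Expr)
  | mul (x y : Expr)
  | div (x y : Expr)
  | mod (x y : Expr)
  | lt (x y : Expr)
  | eq (x y : Expr)

/-- Programs. `rand a` writes a fresh uniformly random word into cell `a`, `send v` sends the word
`v` to the coordinator, `loop x c` runs `c` as many times as the value of `x` at loop entry. -/
inductive Cmd : Type
  | skip
  | store (a v : Expr)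
  | rand (a : Expr)
  | send (v : Expr)
  | seq (c d : Cmd)
  | ite (b : Expr) (c d : Cmd)
  | loop (x : Expr) (c : Cmd)

/-- The read value of a memory cell; addresses outside the memory read as `0`. -/
def readCell {w cells : ℕ} (mem : Fin cells → Word w) (a : Word w) : Word w :=
  if h : a.val < cells then mem ⟨a.val, h⟩ else 0

/-- Writing to a memory cell; writes outside the memory have no effect. -/
def writeCell {w cells : ℕ} (mem : Fin cells → Word w) (a v : Word w) : Fin cells → Word w :=
  fun i => if i.val = a.val then v else mem i

/-- The value of an expression. -/
def Expr.val {w cells : ℕ} (mem : Fin cells → Word w) (input : Word w) : Expr → Word w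
  | .const c => Fin.ofNat (2 ^ w) c
  | .inp => input
  | .load a => readCell mem (a.val mem input)
  | .add x y => x.val mem input + y.val mem input
  | .sub x y => x.val mem input - y.val mem input
  | .mul x y => x.val mem input * y.val mem input
  | .div x y => x.val mem input / y.val mem input
  | .mod x y => x.val mem input % y.val mem input
  | .lt x y => if x.val mem input < y.val mem input then Fin.ofNat (2 ^ w) 1 else 0
  | .eq x y => if x.val mem input = y.val mem input then Fin.ofNat (2 ^ w) 1 else 0

/-- The number of steps needed to evaluate an expression: one for each operation. -/
def Expr.cost : Expr → ℕ
  | .const _ => 1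
  | .inp => 1
  | .load a => a.cost + 1
  | .add x y => x.cost + y.cost + 1
  | .sub x y => x.cost + y.cost + 1
  | .mul x y => x.cost + y.cost + 1
  | .div x y => x.cost + y.cost + 1
  | .mod x y => x.cost + y.cost + 1
  | .lt x y => x.cost + y.cost + 1
  | .eq x y => x.cost + y.cost + 1

/-- The state of a running program: memory, number of random words already consumed in the whole
system, words sent so far (in order), steps made so far. -/
structure Local (w cells : ℕ) where
  mem : Fin cells → Word w
  cursor : ℕ
  sent : List (Word w)
  steps : ℕ

/-- Charge `t` steps. -/
def Local.tick {w cells : ℕ} (t : ℕ) (s : Local w cells) : Local w cells :=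
  { s with steps := s.steps + t }

/-- Run a program. `ω` is the sequence of random words. -/
def Cmd.exec {w cells : ℕ} (ω : ℕ → Word w) (input : Word w) :
    Cmd → Local w cells → Local w cells
  | .skip, s => s.tick 1
  | .store a v, s =>
      { s with
        mem := writeCell s.mem (a.val s.mem input) (v.val s.mem input)
        steps := s.steps + (a.cost + v.cost + 1) }
  | .rand a, s =>
      { s with
        mem := writeCell s.mem (a.val s.mem input) (ω s.cursor)
        cursor := s.cursor + 1
        steps := s.steps + (a.cost + 1) }
  | .send v, s =>
      { s with
        sent := s.sent ++ [v.val s.mem input]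
        steps := s.steps + (v.cost + 1) }
  | .seq c d, s => d.exec ω input (c.exec ω input s)
  | .ite b c d, s =>
      if b.val s.mem input ≠ 0 then c.exec ω input (s.tick (b.cost + 1))
      else d.exec ω input (s.tick (b.cost + 1))
  | .loop x c, s =>
      (fun s' => c.exec ω input (s'.tick 1))^[(x.val s.mem input).val] (s.tick (x.cost + 1))

end Ram

/-! ## Distributed monitoring with `k` sites and one coordinator -/

namespace Monitor

open Ram

/-- The code run at every site: one handler for arriving items, one for messages received from the
coordinator. -/
structure SiteCode where
  onItem : Cmd
  onMsg : Cmd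

/-- The coordinator: it is activated only by an incoming message (one word, from a known site) and
may then send words to sites. `out` is the value it reports. Its own computation is free. -/
structure Coordinator (w k : ℕ) where
  State : Type
  init : State
  recv : State → Fin k → Word w → State × List (Fin k × Word w)
  out : State → ℝ

/-- Messages in transit: from site `i` to the coordinator, or from the coordinator to site `i`. -/
inductive Msg (w k : ℕ) : Type
  | up (i : Fin k) (x : Word w)
  | down (i : Fin k) (x : Word w)

/-- A global configuration, with the counters that measure the cost of the run: the number of
delivered messages (one word each) and, for each site, the number of items received, the number of
messages received, and the steps spent on handling items and on handling messages. -/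
structure Config {w k : ℕ} (cells : ℕ) (co : Coordinator w k) where
  mem : Fin k → Fin cells → Word w
  coord : co.State
  cursor : ℕ
  pending : List (Msg w k)
  delivered : ℕ
  items : Fin k → ℕ
  msgs : Fin k → ℕ
  itemSteps : Fin k → ℕ
  msgSteps : Fin k → ℕ

section
variable {w k cells : ℕ} {co : Coordinator w k}

/-- The initial configuration: every site starts with the memory content `mem₀`. -/
def start (co : Coordinator w k) (mem₀ : Fin cells → Word w) : Config cells co where
  mem := fun _ => mem₀
  coord := co.init
  cursor := 0
  pending := []
  delivered := 0
  items := fun _ => 0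
  msgs := fun _ => 0
  itemSteps := fun _ => 0
  msgSteps := fun _ => 0

/-- Deliver the oldest pending message, if any; its recipient handles it at once. -/
def step (P : SiteCode) (ω : ℕ → Word w) (s : Config cells co) : Config cells co :=
  match s.pending with
  | [] => s
  | .up i x :: q =>
      { s with
        coord := (co.recv s.coord i x).1
        pending := q ++ (co.recv s.coord i x).2.map fun p => Msg.down p.1 p.2
        delivered := s.delivered + 1 }
  | .down i x :: q =>
      let r := P.onMsg.exec ω x ⟨s.mem i, s.cursor, [], 0⟩
      { s with
        mem := Function.update s.mem i r.mem
        cursor := r.cursor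
        pending := q ++ r.sent.map (Msg.up i)
        delivered := s.delivered + 1
        msgs := Function.update s.msgs i (s.msgs i + 1)
        msgSteps := Function.update s.msgSteps i (s.msgSteps i + r.steps) }

open Classical in
/-- Deliver messages until none is pending (if this never happens, the configuration is left as it
is, with pending messages). -/
noncomputable def settle (P : SiteCode) (ω : ℕ → Word w) (s : Config cells co) :
    Config cells co :=
  if h : ∃ N : ℕ, ((step P ω)^[N] s).pending = [] then (step P ω)^[Nat.find h] s else s

/-- The item `a` arrives at site `i`: the site handles it, then all resulting messages are exchanged
before the next item arrives. -/
noncomputable def arrive {n : ℕ} (P : SiteCode) (ω : ℕ → Word w) (s : Config cells co)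
    (p : Fin k × Fin n) : Config cells co :=
  let r := P.onItem.exec ω (Fin.ofNat (2 ^ w) p.2.val) ⟨s.mem p.1, s.cursor, [], 0⟩
  settle P ω
    { s with
      mem := Function.update s.mem p.1 r.mem
      cursor := r.cursor
      pending := s.pending ++ r.sent.map (Msg.up p.1)
      items := Function.update s.items p.1 (s.items p.1 + 1)
      itemSteps := Function.update s.itemSteps p.1 (s.itemSteps p.1 + r.steps) }

/-- The configuration after the items of a distributed stream have arrived. A distributed stream is
the global sequence of items, each with the site that observes it. -/
noncomputable def run {n : ℕ} (P : SiteCode) (co : Coordinator w k) (mem₀ : Fin cells → Word w)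
    (ω : ℕ → Word w) (stream : List (Fin k × Fin n)) : Config cells co :=
  stream.foldl (arrive P ω) (start co mem₀)

end

/-- The law of the random words: independent and uniform. -/
noncomputable def coins (w : ℕ) : Measure (ℕ → Word w) :=
  Measure.infinitePi fun _ : ℕ => ProbabilityTheory.uniformOn (Set.univ : Set (Word w))

/-- Sanity check: the coins form a probability space. -/
theorem coins_univ (w : ℕ) : coins w Set.univ = 1 := by
  have h : ∀ _ : ℕ, IsProbabilityMeasure
      (ProbabilityTheory.uniformOn (Set.univ : Set (Word w))) := fun _ =>
    ProbabilityTheory.isProbabilityMeasure_uniformOn Set.finite_univ Set.univ_nonempty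
  unfold coins
  exact measure_univ

end Monitor

/-! ## Overflow-free execution of RAM programs on natural numbers -/

namespace Ram

/-- The content of the memory cell with address `a`, as a natural number. -/
def cellVal {w cells : ℕ} (mem : Fin cells → Word w) (a : ℕ) : ℕ :=
  if h : a < cells then (mem ⟨a, h⟩).val else 0

theorem readCell_val {w cells : ℕ} (mem : Fin cells → Word w) (a : Word w) :
    (readCell mem a).val = cellVal mem a.val := by
  unfold readCell cellVal
  split <;> simp

theorem cellVal_writeCell {w cells : ℕ} (mem : Fin cells → Word w) (a v : Word w)
    (ha : a.val < cells) :
    cellVal (writeCell mem a v) = Function.update (cellVal mem) a.val v.val := by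
  funext b
  by_cases hb : b = a.val
  · subst hb
    simp [cellVal, writeCell, ha]
  · simp [cellVal, writeCell, hb]

/-- The value of an expression over the natural numbers. -/
def Expr.nat (M : ℕ → ℕ) (input : ℕ) : Expr → ℕ
  | .const c => c
  | .inp => input
  | .load a => M (a.nat M input)
  | .add x y => x.nat M input + y.nat M input
  | .sub x y => x.nat M input - y.nat M input
  | .mul x y => x.nat M input * y.nat M input
  | .div x y => x.nat M input / y.nat M input
  | .mod x y => x.nat M input % y.nat M input
  | .lt x y => if x.nat M input < y.nat M input then 1 else 0
  | .eq x y => if x.nat M input = y.nat M input then 1 else 0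

/-- No overflow occurs in the evaluation of an expression with words below `W`. -/
def Expr.Fits (W : ℕ) (M : ℕ → ℕ) (input : ℕ) : Expr → Prop
  | .const c => c < W
  | .inp => True
  | .load a => a.Fits W M input
  | .add x y => x.Fits W M input ∧ y.Fits W M input ∧ x.nat M input + y.nat M input < W
  | .sub x y => x.Fits W M input ∧ y.Fits W M input ∧ y.nat M input ≤ x.nat M input
  | .mul x y => x.Fits W M input ∧ y.Fits W M input ∧ x.nat M input * y.nat M input < W
  | .div x y => x.Fits W M input ∧ y.Fits W M input
  | .mod x y => x.Fits W M input ∧ y.Fits W M input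
  | .lt x y => x.Fits W M input ∧ y.Fits W M input
  | .eq x y => x.Fits W M input ∧ y.Fits W M input

theorem Expr.val_eq_nat {w cells : ℕ} (hw : 1 ≤ w) (mem : Fin cells → Word w) (input : Word w)
    (e : Expr) (h : e.Fits (2 ^ w) (cellVal mem) input.val) :
    (e.val mem input).val = e.nat (cellVal mem) input.val := by
  have hW : 1 < 2 ^ w := Nat.one_lt_two_pow (by omega)
  induction e with
  | const c => simpa [Expr.val, Expr.nat, Expr.Fits, Fin.ofNat, Nat.mod_eq_of_lt] using
      Nat.mod_eq_of_lt h
  | inp => rfl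
  | load a ih => simp only [Expr.val, Expr.nat, readCell_val, ih h]
  | add x y ihx ihy =>
    obtain ⟨hx, hy, hxy⟩ := h
    simp only [Expr.val, Expr.nat, Fin.val_add, ihx hx, ihy hy, Nat.mod_eq_of_lt hxy]
  | sub x y ihx ihy =>
    obtain ⟨hx, hy, hxy⟩ := h
    have : y.val mem input ≤ x.val mem input := by
      rw [Fin.le_def, ihx hx, ihy hy]; exact hxy
    simp only [Expr.val, Expr.nat, Fin.sub_val_of_le this, ihx hx, ihy hy]
  | mul x y ihx ihy =>
    obtain ⟨hx, hy, hxy⟩ := h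
    simp only [Expr.val, Expr.nat, Fin.val_mul, ihx hx, ihy hy, Nat.mod_eq_of_lt hxy]
  | div x y ihx ihy => simp only [Expr.val, Expr.nat, Fin.div_val, ihx h.1, ihy h.2]
  | mod x y ihx ihy => simp only [Expr.val, Expr.nat, Fin.mod_val, ihx h.1, ihy h.2]
  | lt x y ihx ihy =>
    simp only [Expr.val, Expr.nat, Fin.lt_def, ihx h.1, ihy h.2]
    split <;> simp [Fin.ofNat, Nat.mod_eq_of_lt hW]
  | eq x y ihx ihy =>
    simp only [Expr.val, Expr.nat, Fin.ext_iff, ihx h.1, ihy h.2]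
    split <;> simp [Fin.ofNat, Nat.mod_eq_of_lt hW]

/-- The state of a program run over the natural numbers. -/
structure NState where
  mem : ℕ → ℕ
  cursor : ℕ
  sent : List ℕ

/-- Running a program over the natural numbers. -/
def Cmd.nat (ρ : ℕ → ℕ) (input : ℕ) : Cmd → NState → NState
  | .skip, s => s
  | .store a v, s =>
      { s with mem := Function.update s.mem (a.nat s.mem input) (v.nat s.mem input) }
  | .rand a, s =>
      { s with
        mem := Function.update s.mem (a.nat s.mem input) (ρ s.cursor)
        cursor := s.cursor + 1 }
  | .send v, s => { s with sent := s.sent ++ [v.nat s.mem input] }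
  | .seq c d, s => d.nat ρ input (c.nat ρ input s)
  | .ite b c d, s => if b.nat s.mem input ≠ 0 then c.nat ρ input s else d.nat ρ input s
  | .loop x c, s => (c.nat ρ input)^[x.nat s.mem input] s

/-- No overflow and no access outside the memory occurs in a program run. -/
def Cmd.Fits (W cells : ℕ) (ρ : ℕ → ℕ) (input : ℕ) : Cmd → NState → Prop
  | .skip, _ => True
  | .store a v, s => a.Fits W s.mem input ∧ v.Fits W s.mem input ∧ a.nat s.mem input < cells
  | .rand a, s => a.Fits W s.mem input ∧ a.nat s.mem input < cells
  | .send v, s => v.Fits W s.mem input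
  | .seq c d, s => c.Fits W cells ρ input s ∧ d.Fits W cells ρ input (c.nat ρ input s)
  | .ite b c d, s => b.Fits W s.mem input ∧
      (b.nat s.mem input ≠ 0 → c.Fits W cells ρ input s) ∧
      (b.nat s.mem input = 0 → d.Fits W cells ρ input s)
  | .loop x c, s => x.Fits W s.mem input ∧
      ∀ r < x.nat s.mem input, c.Fits W cells ρ input ((c.nat ρ input)^[r] s)

/-- A machine state represents a state over the natural numbers. -/
structure Represents {w cells : ℕ} (s : Local w cells) (N : NState) : Prop where
  mem : cellVal s.mem = N.mem
  cursor : s.cursor = N.cursor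
  sent : s.sent.map Fin.val = N.sent

theorem Represents.tick {w cells : ℕ} {s : Local w cells} {N : NState} (h : Represents s N)
    (t : ℕ) : Represents (s.tick t) N := ⟨h.mem, h.cursor, h.sent⟩

theorem Cmd.exec_represents {w cells : ℕ} (hw : 1 ≤ w) (ω : ℕ → Word w) (input : Word w) (c : Cmd)
    (s : Local w cells) (N : NState) (h : Represents s N)
    (hc : c.Fits (2 ^ w) cells (fun i => (ω i).val) input.val N) :
    Represents (c.exec ω input s) (c.nat (fun i => (ω i).val) input.val N) := by
  induction c generalizing s N with
  | skip => exact h.tick 1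
  | store a v =>
    obtain ⟨ha, hv, hlt⟩ := hc
    have h1 := h.mem
    rw [← h1] at ha hv hlt
    have ea := Expr.val_eq_nat hw _ _ _ ha
    have ev := Expr.val_eq_nat hw _ _ _ hv
    refine ⟨?_, h.cursor, h.sent⟩
    simp only [Cmd.exec, Cmd.nat]
    rw [cellVal_writeCell _ _ _ (by rw [ea]; exact hlt), ea, ev, h1]
  | rand a =>
    obtain ⟨ha, hlt⟩ := hc
    have h1 := h.mem
    rw [← h1] at ha hlt
    have ea := Expr.val_eq_nat hw _ _ _ ha
    refine ⟨?_, by simp [Cmd.exec, Cmd.nat, h.cursor], h.sent⟩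
    simp only [Cmd.exec, Cmd.nat]
    rw [cellVal_writeCell _ _ _ (by rw [ea]; exact hlt), ea, h1, h.cursor]
  | send v =>
    have h1 := h.mem
    simp only [Cmd.Fits] at hc
    rw [← h1] at hc
    have ev := Expr.val_eq_nat hw _ _ _ hc
    refine ⟨h.mem, h.cursor, ?_⟩
    simp [Cmd.exec, Cmd.nat, h.sent, ev, h1]
  | seq c d ihc ihd => exact ihd _ _ (ihc _ _ h hc.1) hc.2
  | ite b c d ihc ihd =>
    obtain ⟨hb, h1, h2⟩ := hc
    have hm := h.mem
    have hb' := hb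
    rw [← hm] at hb'
    have eb := Expr.val_eq_nat hw _ _ _ hb'
    rw [hm] at eb
    simp only [Cmd.exec, Cmd.nat]
    by_cases hz : b.nat N.mem input.val = 0
    · have : b.val s.mem input = 0 := by
        apply Fin.ext; rw [eb, hz]; simp
      simp only [this, hz, ne_eq, not_true_eq_false, if_false]
      exact ihd _ _ (h.tick _) (h2 hz)
    · have : b.val s.mem input ≠ 0 := by
        intro h0; apply hz; rw [← eb, h0]; simp
      simp only [this, hz, ne_eq, not_false_eq_true, if_true]
      exact ihc _ _ (h.tick _) (h1 hz)
  | loop x c ih =>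
    obtain ⟨hx, hr⟩ := hc
    have hm := h.mem
    rw [← hm] at hx
    have ex := Expr.val_eq_nat hw _ _ _ hx
    rw [hm] at ex
    simp only [Cmd.exec, Cmd.nat]
    rw [ex]
    have key : ∀ r ≤ x.nat N.mem input.val,
        Represents ((fun s' => c.exec ω input (s'.tick 1))^[r] (s.tick (x.cost + 1)))
          ((c.nat (fun i => (ω i).val) input.val)^[r] N) := by
      intro r
      induction r with
      | zero => intro _; exact h.tick _
      | succ r ihr =>
        intro hlt
        rw [Function.iterate_succ_apply', Function.iterate_succ_apply']
        exact ih _ _ ((ihr (by omega)).tick 1) (hr r (by omega))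
    exact key _ le_rfl

/-- Programs without loops. -/
def Cmd.LoopFree : Cmd → Prop
  | .skip | .store _ _ | .rand _ | .send _ => True
  | .seq c d => c.LoopFree ∧ d.LoopFree
  | .ite _ c d => c.LoopFree ∧ d.LoopFree
  | .loop _ _ => False

/-- A bound on the number of steps of a program without loops. -/
def Cmd.flatCost : Cmd → ℕ
  | .skip => 1
  | .store a v => a.cost + v.cost + 1
  | .rand a => a.cost + 1
  | .send v => v.cost + 1
  | .seq c d => c.flatCost + d.flatCost
  | .ite b c d => b.cost + 1 + (c.flatCost + d.flatCost)
  | .loop _ _ => 0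

theorem Cmd.LoopFree.steps_le {w cells : ℕ} (ω : ℕ → Word w) (input : Word w) {c : Cmd}
    (hc : c.LoopFree) (s : Local w cells) :
    (c.exec ω input s).steps ≤ s.steps + c.flatCost := by
  induction c generalizing s with
  | skip => exact le_rfl
  | store a v => exact le_rfl
  | rand a => exact le_rfl
  | send v => exact le_rfl
  | seq c d ihc ihd =>
    have h1 := ihc hc.1 s
    have h2 := ihd hc.2 (c.exec ω input s)
    simp only [Cmd.exec, Cmd.flatCost]
    omega
  | ite b c d ihc ihd =>
    have h1 := ihc hc.1 (s.tick (b.cost + 1))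
    have h2 := ihd hc.2 (s.tick (b.cost + 1))
    simp only [Cmd.exec, Cmd.flatCost, Local.tick] at *
    split <;> omega
  | loop x c => exact hc.elim

theorem Cmd.LoopFree.loop_steps_le {w cells : ℕ} (ω : ℕ → Word w) (input : Word w) {c : Cmd}
    (hc : c.LoopFree) (x : Expr) (s : Local w cells) :
    ((Cmd.loop x c).exec ω input s).steps ≤
      s.steps + (x.cost + 1) + (x.val s.mem input).val * (c.flatCost + 1) := by
  simp only [Cmd.exec]
  generalize (x.val s.mem input).val = r
  induction r with
  | zero => simp [Local.tick]
  | succ r ih =>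
    rw [Function.iterate_succ_apply']
    have := hc.steps_le ω input
      (((fun s' => c.exec ω input (s'.tick 1))^[r] (s.tick (x.cost + 1))).tick 1)
    simp only [Local.tick] at *
    rw [Nat.succ_mul]
    omega

end Ram

/-! ## The code of the sites -/

namespace Sampling

open Ram Monitor

/-- Packing of four numbers below `D` into one word. -/
def pack (D ty j p x : ℕ) : ℕ := ty + D * (j + D * (p + D * x))

theorem pack_bounds {D ty j p x : ℕ} (ht : ty < D) (hj : j < D) (hp : p < D) (hx : x < D) :
    D * x < D ^ 4 ∧ p + D * x < D ^ 4 ∧ D * (p + D * x) < D ^ 4 ∧ j + D * (p + D * x) < D ^ 4 ∧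
      D * (j + D * (p + D * x)) < D ^ 4 ∧ pack D ty j p x < D ^ 4 := by
  have hD : 1 ≤ D := by omega
  have step : ∀ {a y b : ℕ}, a < D → y < D ^ b → a + D * y < D ^ (b + 1) := by
    intro a y b ha hy
    calc a + D * y < D + D * y := by omega
      _ = D * (y + 1) := by ring
      _ ≤ D * D ^ b := Nat.mul_le_mul_left _ hy
      _ = D ^ (b + 1) := by ring
  have h1 : x < D ^ 1 := by simpa using hx
  have h2 := step hp h1
  have h3 := step hj h2
  have h4 := step ht h3
  have m2 : D ^ (1 + 1) ≤ D ^ 4 := Nat.pow_le_pow_right hD (by norm_num)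
  have m3 : D ^ (1 + 1 + 1) ≤ D ^ 4 := Nat.pow_le_pow_right hD (by norm_num)
  have m4 : D ^ (1 + 1 + 1 + 1) = D ^ 4 := rfl
  unfold pack
  refine ⟨?_, ?_, ?_, ?_, ?_, ?_⟩ <;> omega

theorem pack_type {D ty j p x : ℕ} (ht : ty < D) : pack D ty j p x % D = ty := by
  simp [pack, Nat.mod_eq_of_lt ht]

theorem pack_div {D ty j p x : ℕ} (ht : ty < D) : pack D ty j p x / D = j + D * (p + D * x) := by
  unfold pack
  rw [Nat.add_mul_div_left _ _ (by omega), Nat.div_eq_of_lt ht, zero_add]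

theorem pack_index {D ty j p x : ℕ} (ht : ty < D) (hj : j < D) :
    pack D ty j p x / D % D = j := by
  rw [pack_div ht]; simp [Nat.mod_eq_of_lt hj]

theorem pack_div_div {D ty j p x : ℕ} (ht : ty < D) (hj : j < D) :
    pack D ty j p x / D / D = p + D * x := by
  rw [pack_div ht, Nat.add_mul_div_left _ _ (by omega), Nat.div_eq_of_lt hj, zero_add]

theorem pack_fst {D ty j p x : ℕ} (ht : ty < D) (hj : j < D) (hp : p < D) :
    pack D ty j p x / D / D % D = p := by
  rw [pack_div_div ht hj]; simp [Nat.mod_eq_of_lt hp]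

theorem pack_snd {D ty j p x : ℕ} (ht : ty < D) (hj : j < D) (hp : p < D) :
    pack D ty j p x / D / D / D = x := by
  rw [pack_div_div ht hj, Nat.add_mul_div_left _ _ (by omega), Nat.div_eq_of_lt hp, zero_add]

/-- The constant `D`, kept in cell `0`. -/
def base : Expr := .load (.const 0)

/-- Address of field `i` of the current sampler. -/
def field (i : ℕ) : Expr := .add (.const (4 + i)) (.mul (.const 5) (.load (.const 2)))

/-- Address of field `i` of the sampler to which the received message refers. -/
def msgField (i : ℕ) : Expr :=
  .add (.const (4 + i)) (.mul (.const 5) (.mod (.div .inp base) base))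

/-- Packing on the machine. -/
def packExpr (ty : ℕ) (p x : Expr) : Expr :=
  .add (.const ty) (.mul base (.add (.load (.const 2)) (.mul base (.add p (.mul base x)))))

/-- Handling of an item by the current sampler: draw a tag; a tag below the threshold makes the item
the new sample, and another occurrence of the sampled element is counted, and reported when the
shifted counter passes a multiple of the current granularity. -/
def samplerItem : Cmd :=
  .seq (.rand (.const 3)) <|
  .seq (.store (.const 3) (.mod (.load (.const 3)) base)) <|
  .seq (.ite (.eq (.load (field 4)) base) (.store (field 4) (.load (.const 3))) .skip) <|
  .seq
    (.ite (.lt (.load (.const 3)) (.load (field 0)))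
      (.send (packExpr 0 (.load (.const 3)) .inp))
      (.ite (.eq (.load (field 1)) .inp)
        (.seq (.store (field 2) (.add (.load (field 2)) (.const 1)))
          (.ite (.mod (.add (.load (field 2)) (.load (field 4))) (.load (field 3)))
            .skip
            (.send (packExpr 1 (.load (field 2)) (.load (field 4))))))
        .skip))
    (.store (.const 2) (.add (.load (.const 2)) (.const 1)))

/-- Handling of a message: either a new sample for a sampler, or a doubling of its granularity. -/
def siteMsg : Cmd :=
  .ite (.mod .inp base)
    (.store (msgField 3) (.add (.load (msgField 3)) (.load (msgField 3))))
    (.seq (.store (msgField 0) (.mod (.div (.div .inp base) base) base))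
      (.seq (.store (msgField 1) (.div (.div (.div .inp base) base) base))
        (.seq (.store (msgField 2) (.const 0)) (.store (msgField 3) (.const 1)))))

/-- The code of the sites. -/
def code : SiteCode where
  onItem := .seq (.store (.const 2) (.const 0)) (.loop (.load (.const 1)) samplerItem)
  onMsg := siteMsg

/-- The data that a site keeps for one sampler: threshold for the tags, sampled element, number of
later occurrences at this site, granularity of the reports, random offset (`D` if not yet drawn). -/
structure Cell where
  thr : ℕ
  elt : ℕ
  cnt : ℕ
  gran : ℕ
  off : ℕ

/-- The offset after an item with tag `r`. -/
def newOff (D r u : ℕ) : ℕ := if u = D then r else u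

/-- The effect of item `x` with tag `r`. -/
def Cell.item (D x r : ℕ) (s : Cell) : Cell :=
  { s with
    off := newOff D r s.off
    cnt := if r < s.thr then s.cnt else if s.elt = x then s.cnt + 1 else s.cnt }

/-- The messages caused by item `x` with tag `r` at sampler `j`. -/
def Cell.report (D j x r : ℕ) (s : Cell) : List ℕ :=
  if r < s.thr then [pack D 0 j r x]
  else if s.elt = x then
    if (s.cnt + 1 + newOff D r s.off) % s.gran = 0
      then [pack D 1 j (s.cnt + 1) (newOff D r s.off)] else []
  else []

/-- The effect of a new sample. -/
def Cell.reset (thr elt : ℕ) (s : Cell) : Cell :=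
  { s with thr := thr, elt := elt, cnt := 0, gran := 1 }

/-- The effect of a doubling of the granularity. -/
def Cell.double (s : Cell) : Cell := { s with gran := s.gran + s.gran }

/-- The memory `M` holds the parameters `D`, `S` and the data `g j` of each sampler `j < S`. -/
structure Layout (D S : ℕ) (M : ℕ → ℕ) (g : ℕ → Cell) : Prop where
  base : M 0 = D
  num : M 1 = S
  thr : ∀ j < S, M (4 + 5 * j) = (g j).thr
  elt : ∀ j < S, M (5 + 5 * j) = (g j).elt
  cnt : ∀ j < S, M (6 + 5 * j) = (g j).cnt
  gran : ∀ j < S, M (7 + 5 * j) = (g j).gran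
  off : ∀ j < S, M (8 + 5 * j) = (g j).off

/-- Two memories that differ only in the scratch cells and in the cells of sampler `j`. -/
theorem Layout.update {D S j : ℕ} {M M' : ℕ → ℕ} {g : ℕ → Cell} {c : Cell} (h : Layout D S M g)
    (hM : ∀ a, a ≠ 2 → a ≠ 3 → (∀ i < 5, a ≠ 4 + i + 5 * j) → M' a = M a)
    (h0 : M' (4 + 5 * j) = c.thr) (h1 : M' (5 + 5 * j) = c.elt) (h2 : M' (6 + 5 * j) = c.cnt)
    (h3 : M' (7 + 5 * j) = c.gran) (h4 : M' (8 + 5 * j) = c.off) :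
    Layout D S M' (Function.update g j c) := by
  have key : ∀ i < 5, ∀ j', j' ≠ j → M' (4 + i + 5 * j') = M (4 + i + 5 * j') := by
    intro i hi j' hj'
    apply hM <;> intros <;> omega
  refine ⟨?_, ?_, ?_, ?_, ?_, ?_, ?_⟩
  · rw [hM 0 (by omega) (by omega) (by intros; omega)]; exact h.base
  · rw [hM 1 (by omega) (by omega) (by intros; omega)]; exact h.num
  all_goals
    intro j' hj'
    by_cases e : j' = j
    · subst e; simpa
    rw [Function.update_of_ne e]
  · rw [← h.thr j' hj']; exact key 0 (by omega) j' e
  · rw [← h.elt j' hj']; exact key 1 (by omega) j' e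
  · rw [← h.cnt j' hj']; exact key 2 (by omega) j' e
  · rw [← h.gran j' hj']; exact key 3 (by omega) j' e
  · rw [← h.off j' hj']; exact key 4 (by omega) j' e

theorem samplerItem_spec {D S j x : ℕ} {ρ : ℕ → ℕ} {N : NState} {g : ℕ → Cell}
    (h : Layout D S N.mem g) (hj : j < S) (h2 : N.mem 2 = j) :
    Layout D S (samplerItem.nat ρ x N).mem
      (Function.update g j ((g j).item D x (ρ N.cursor % D))) ∧
    (samplerItem.nat ρ x N).mem 2 = j + 1 ∧
    (samplerItem.nat ρ x N).cursor = N.cursor + 1 ∧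
    (samplerItem.nat ρ x N).sent = N.sent ++ (g j).report D j x (ρ N.cursor % D) := by
  have hb := h.base
  have f0 := h.thr j hj
  have f1 := h.elt j hj
  have f2 := h.cnt j hj
  have f3 := h.gran j hj
  have f4 := h.off j hj
  have ne : ∀ i < 4, ∀ e ≥ 4, i ≠ e + 5 * j := by intros; omega
  have ne' : ∀ i < 4, ∀ e ≥ 4, e + 5 * j ≠ i := by intros; omega
  generalize hr : ρ N.cursor % D = r
  by_cases c1 : (g j).off = D <;> by_cases c2 : r < (g j).thr <;> by_cases c3 : (g j).elt = x
  all_goals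
    by_cases c4 : ((g j).cnt + 1 + newOff D r (g j).off) % (g j).gran = 0
  all_goals
    have c4' := c4
    simp only [newOff, c1, if_true, if_false] at c4'
    have E : samplerItem.nat ρ x N = samplerItem.nat ρ x N := rfl
    conv_rhs at E =>
      simp [samplerItem, Cmd.nat, Expr.nat, field, base, packExpr, Function.update_apply, ne, ne',
        hb, h2, f0, f1, f2, f3, f4, hr, c1, c2, c3, c4']
    rw [E]
    refine ⟨h.update ?_ ?_ ?_ ?_ ?_ ?_, ?_, ?_, ?_⟩
    · intro a a2 a3 ha
      have b0 := ha 0 (by omega)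
      have b2 := ha 2 (by omega)
      have b4 := ha 4 (by omega)
      simp at b0 b2 b4
      simp [a2, a3, b2, b4]
    all_goals
      simp [ne', Cell.item, Cell.report, newOff, pack, f0, f1, f2, f3, f4,
        c1, c2, c3, c4']

theorem siteMsg_reset {D S j th x c : ℕ} {ρ : ℕ → ℕ} {N : NState} {g : ℕ → Cell}
    (h : Layout D S N.mem g) (hj : j < S) (hD : 4 + 5 * S + 5 ≤ D) (hth : th < D)
    (hS : 4 + 5 * S ≤ c) :
    siteMsg.Fits (D ^ 4) c ρ (pack D 0 j th x) N ∧
    Layout D S (siteMsg.nat ρ (pack D 0 j th x) N).mem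
      (Function.update g j ((g j).reset th x)) := by
  have d0 : (0:ℕ) < D := by omega
  have hjD : j < D := by omega
  have e0 := pack_type (j := j) (p := th) (x := x) d0
  have e1 := pack_index (p := th) (x := x) d0 hjD
  have e2 := pack_fst (x := x) d0 hjD hth
  have e3 := pack_snd (x := x) d0 hjD hth
  have hb := h.base
  have hDW : D * 1 ≤ D ^ 4 := by
    have : 1 ≤ D ^ 3 := Nat.one_le_pow _ _ d0
    calc D * 1 ≤ D * D ^ 3 := Nat.mul_le_mul_left _ this
      _ = D ^ 4 := by ring
  have ne : ∀ i < 4, ∀ e ≥ 4, i ≠ e + 5 * j := by intros; omega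
  constructor
  · simp [siteMsg, Cmd.Fits, Cmd.nat, Expr.Fits, Expr.nat, msgField, base, hb, e0, e1, e2, e3, ne]
    omega
  · apply h.update
    · intro a _ _ ha
      have a0 := ha 0 (by omega)
      have a1 := ha 1 (by omega)
      have a2 := ha 2 (by omega)
      have a3 := ha 3 (by omega)
      simp at a0 a1 a2 a3
      simp [siteMsg, Cmd.nat, Expr.nat, msgField, base, hb, e0, e1, e2, e3,
        ne, a0, a1, a2, a3]
    all_goals
      simp [siteMsg, Cmd.nat, Expr.nat, msgField, base, hb, e0, e1, e2, e3,
        Cell.reset, ne]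
    exact h.off j hj

theorem siteMsg_double {D S j c : ℕ} {ρ : ℕ → ℕ} {N : NState} {g : ℕ → Cell}
    (h : Layout D S N.mem g) (hj : j < S) (hD : 4 + 5 * S + 5 ≤ D) (hT : (g j).gran ≤ D)
    (hS : 4 + 5 * S ≤ c) :
    siteMsg.Fits (D ^ 4) c ρ (pack D 1 j 0 0) N ∧
    Layout D S (siteMsg.nat ρ (pack D 1 j 0 0) N).mem (Function.update g j (g j).double) := by
  have d0 : (1:ℕ) < D := by omega
  have hjD : j < D := by omega
  have e0 := pack_type (j := j) (p := 0) (x := 0) d0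
  have e1 := pack_index (p := 0) (x := 0) d0 hjD
  have hb := h.base
  have hDW : D * 8 ≤ D ^ 4 := by
    have : 2 ^ 3 ≤ D ^ 3 := Nat.pow_le_pow_left d0 _
    calc D * 8 ≤ D * D ^ 3 := Nat.mul_le_mul_left _ this
      _ = D ^ 4 := by ring
  have g3 := h.gran j hj
  constructor
  · simp [siteMsg, Cmd.Fits, Cmd.nat, Expr.Fits, Expr.nat, msgField, base, hb, e0, e1, g3]
    omega
  · apply h.update
    · intro a _ _ ha
      have a3 := ha 3 (by omega)
      simp [siteMsg, Cmd.nat, Expr.nat, msgField, base, hb, e0, e1]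
      simp [a3]
    all_goals
      simp [siteMsg, Cmd.nat, Expr.nat, msgField, base, hb, e0, e1,
        Cell.double, g3]
    · exact h.thr j hj
    · exact h.elt j hj
    · exact h.cnt j hj
    · exact h.off j hj

theorem samplerItem_fits {D S j x cells : ℕ} {ρ : ℕ → ℕ} {N : NState} {g : ℕ → Cell}
    (h : Layout D S N.mem g) (hj : j < S) (h2 : N.mem 2 = j) (hx : x < D)
    (hS : 4 + 5 * S ≤ cells) (hD : 4 + 5 * S + 5 ≤ D) (hc : (g j).cnt + 1 < D)
    (ho : (g j).off ≤ D) :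
    samplerItem.Fits (D ^ 4) cells ρ x N := by
  have hb := h.base
  have f0 := h.thr j hj
  have f1 := h.elt j hj
  have f2 := h.cnt j hj
  have f3 := h.gran j hj
  have f4 := h.off j hj
  have ne : ∀ i < 4, ∀ e ≥ 4, i ≠ e + 5 * j := by intros; omega
  have ne' : ∀ i < 4, ∀ e ≥ 4, e + 5 * j ≠ i := by intros; omega
  have d0 : 0 < D := by omega
  have hr := Nat.mod_lt (ρ N.cursor) d0
  generalize hr' : ρ N.cursor % D = r at hr
  have hDW : D * 8 ≤ D ^ 4 := by
    have : 2 ^ 3 ≤ D ^ 3 := Nat.pow_le_pow_left (by omega) _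
    calc D * 8 ≤ D * D ^ 3 := Nat.mul_le_mul_left _ this
      _ = D ^ 4 := by ring
  have hjD : j < D := by omega
  by_cases c1 : (g j).off = D <;> by_cases c2 : r < (g j).thr <;> by_cases c3 : (g j).elt = x
  all_goals
    by_cases c4 : ((g j).cnt + 1 + (if (g j).off = D then r else (g j).off)) % (g j).gran = 0
  all_goals
    simp only [c1, if_true, if_false] at c4
    have p0 := pack_bounds d0 hjD hr hx
    have p1 := pack_bounds (show 1 < D by omega) hjD hc hr
    have p2 := pack_bounds (D := D) (ty := 1) (x := if (g j).off = D then r else (g j).off)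
      (by omega) hjD hc (by split_ifs <;> omega)
    simp only [pack, c1, if_true, if_false] at p0 p1 p2
    simp [samplerItem, Cmd.nat, Expr.nat, Cmd.Fits, Expr.Fits, field, base, packExpr,
      ne, ne', hb, h2, f0, f1, f2, f3, f4, hr', c1, c2, c3, c4, p0, p1, p2]
    omega

end Sampling

namespace Sampling

open Ram Monitor

theorem Layout.congr {D S : ℕ} {M : ℕ → ℕ} {g g' : ℕ → Cell} (h : Layout D S M g)
    (e : ∀ j < S, g j = g' j) : Layout D S M g' :=
  ⟨h.base, h.num, fun j hj => e j hj ▸ h.thr j hj, fun j hj => e j hj ▸ h.elt j hj,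
    fun j hj => e j hj ▸ h.cnt j hj, fun j hj => e j hj ▸ h.gran j hj,
    fun j hj => e j hj ▸ h.off j hj⟩

theorem samplerItem_iterate {D S x cells : ℕ} {ρ : ℕ → ℕ} {N : NState} {g : ℕ → Cell}
    (h : Layout D S N.mem g) (h2 : N.mem 2 = 0) (hx : x < D) (hs : N.sent = [])
    (hS : 4 + 5 * S ≤ cells) (hD : 4 + 5 * S + 5 ≤ D) (hc : ∀ j < S, (g j).cnt + 1 < D)
    (ho : ∀ j < S, (g j).off ≤ D) (r : ℕ) (hr : r ≤ S) :
    Layout D S ((samplerItem.nat ρ x)^[r] N).mem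
      (fun j => if j < r then (g j).item D x (ρ (N.cursor + j) % D) else g j) ∧
    ((samplerItem.nat ρ x)^[r] N).mem 2 = r ∧
    ((samplerItem.nat ρ x)^[r] N).cursor = N.cursor + r ∧
    ((samplerItem.nat ρ x)^[r] N).sent =
      (List.range r).flatMap (fun j => (g j).report D j x (ρ (N.cursor + j) % D)) ∧
    (r < S → samplerItem.Fits (D ^ 4) cells ρ x ((samplerItem.nat ρ x)^[r] N)) := by
  induction r with
  | zero =>
    exact ⟨h.congr (by simp), h2, rfl, hs,
      fun h0 => samplerItem_fits h h0 h2 hx hS hD (hc 0 h0) (ho 0 h0)⟩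
  | succ r ih =>
    obtain ⟨i1, i2, i3, i4, -⟩ := ih (by omega)
    obtain ⟨s1, s2, s3, s4⟩ := samplerItem_spec (x := x) (ρ := ρ) i1 (by omega : r < S) i2
    rw [i3] at s1 s3 s4
    simp only [lt_irrefl, if_false] at s1 s4
    rw [Function.iterate_succ_apply']
    have L : Layout D S (samplerItem.nat ρ x ((samplerItem.nat ρ x)^[r] N)).mem
        (fun j => if j < r + 1 then (g j).item D x (ρ (N.cursor + j) % D) else g j) := by
      refine s1.congr fun j _ => ?_
      by_cases e : j = r
      · subst e; simp
      · rw [Function.update_of_ne e]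
        have : j < r ↔ j < r + 1 := by omega
        simp only [this]
    refine ⟨L, s2, s3, ?_, fun h0 => ?_⟩
    · rw [s4, i4, List.range_succ]; simp
    · refine samplerItem_fits L h0 s2 hx hS hD ?_ ?_ <;> simp [hc _ h0, ho _ h0]

/-- A bound on the number of steps spent on one sampler or one message. -/
def unitCost : ℕ := samplerItem.flatCost + siteMsg.flatCost + 7

theorem code_onItem {w cells D S : ℕ} (hw : 1 ≤ w) (hW : 2 ^ w = D ^ 4) (ω : ℕ → Word w)
    (x : Word w) (mem : Fin cells → Word w) (cur : ℕ) {g : ℕ → Cell}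
    (h : Layout D S (cellVal mem) g) (hx : x.val < D)
    (hS : 4 + 5 * S ≤ cells) (hD : 4 + 5 * S + 5 ≤ D) (hc : ∀ j < S, (g j).cnt + 1 < D)
    (ho : ∀ j < S, (g j).off ≤ D) :
    Layout D S (cellVal (code.onItem.exec ω x ⟨mem, cur, [], 0⟩).mem)
      (fun j => (g j).item D x ((ω (cur + j)).val % D)) ∧
    (code.onItem.exec ω x ⟨mem, cur, [], 0⟩).cursor = cur + S ∧
    (code.onItem.exec ω x ⟨mem, cur, [], 0⟩).sent.map Fin.val =
      (List.range S).flatMap (fun j => (g j).report D j x ((ω (cur + j)).val % D)) ∧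
    (code.onItem.exec ω x ⟨mem, cur, [], 0⟩).steps ≤ unitCost * (S + 1) := by
  have d0 : 1 ≤ D := by omega
  have hDW : D * 1 ≤ D ^ 4 := by
    have : 1 ≤ D ^ 3 := Nat.one_le_pow _ _ d0
    calc D * 1 ≤ D * D ^ 3 := Nat.mul_le_mul_left _ this
      _ = D ^ 4 := by ring
  set s : Local w cells := ⟨mem, cur, [], 0⟩
  set N : NState := ⟨cellVal mem, cur, []⟩
  set ρ : ℕ → ℕ := fun i => (ω i).val
  have hrep : Represents s N := ⟨rfl, rfl, rfl⟩
  set N0 : NState := { N with mem := Function.update N.mem 2 0 }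
  have L0 : Layout D S N0.mem g := by
    have key : ∀ a, a ≠ 2 → N0.mem a = N.mem a := fun a ha => Function.update_of_ne ha _ _
    exact ⟨(key _ (by omega)).trans h.base, (key _ (by omega)).trans h.num,
      fun j hj => (key _ (by omega)).trans (h.thr j hj),
      fun j hj => (key _ (by omega)).trans (h.elt j hj),
      fun j hj => (key _ (by omega)).trans (h.cnt j hj),
      fun j hj => (key _ (by omega)).trans (h.gran j hj),
      fun j hj => (key _ (by omega)).trans (h.off j hj)⟩
  have hit := samplerItem_iterate (ρ := ρ) (x := x.val) L0 (by simp [N0]) hx rfl hS hD hc ho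
  have e0 : (Cmd.store (.const 2) (.const 0)).nat ρ x.val N = N0 := rfl
  have e1 : code.onItem.nat ρ x.val N = (samplerItem.nat ρ x.val)^[S] N0 := by
    change (samplerItem.nat ρ x.val)^[N0.mem 1] N0 = _
    rw [L0.num]
  have hfits : code.onItem.Fits (2 ^ w) cells ρ x.val N := by
    have aux : ∀ W, W = D ^ 4 → code.onItem.Fits W cells ρ x.val N := by
      rintro W rfl
      refine ⟨⟨?_, ?_, ?_⟩, ?_, ?_⟩
      · simp only [Expr.Fits]; omega
      · simp only [Expr.Fits]; omega
      · simp only [Expr.nat]; omega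
      · simp only [Expr.Fits]; omega
      · intro r hr
        have hr' : r < S := by
          have : r < N0.mem 1 := hr
          rwa [L0.num] at this
        exact (hit r hr'.le).2.2.2.2 hr'
    exact aux _ hW
  have hout := Cmd.exec_represents hw ω x code.onItem s N hrep hfits
  rw [e1] at hout
  obtain ⟨i1, -, i3, i4, -⟩ := hit S le_rfl
  refine ⟨?_, ?_, ?_, ?_⟩
  · rw [hout.mem]
    exact i1.congr fun j hj => by simp [hj, ρ, N0, N]
  · rw [hout.cursor, i3]
  · rw [hout.sent, i4]
  · have lf : samplerItem.LoopFree := by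
      simp [samplerItem, Cmd.LoopFree]
    have hstore : ((Cmd.store (.const 2) (.const 0)).Fits (2 ^ w) cells ρ x.val N) := hfits.1
    have hr0 := Cmd.exec_represents hw ω x _ s N hrep hstore
    have := lf.loop_steps_le ω x (.load (.const 1))
      ((Cmd.store (.const 2) (.const 0)).exec ω x s)
    have ev : ((Expr.load (.const 1)).val
        ((Cmd.store (.const 2) (.const 0)).exec ω x s).mem x).val = S := by
      rw [Expr.val_eq_nat hw]
      · rw [hr0.mem]; exact L0.num
      · simp only [Expr.Fits]; rw [hW]; omega
    rw [ev] at this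
    refine this.trans ?_
    have e3 : ((Cmd.store (.const 2) (.const 0)).exec ω x s).steps = 3 := rfl
    rw [e3]
    simp only [Expr.cost, unitCost]
    nlinarith [Nat.zero_le (siteMsg.flatCost * S), Nat.zero_le samplerItem.flatCost]

/-- The memory after the handling of a message. -/
def handle {w cells : ℕ} (mem : Fin cells → Word w) (v : Word w) : Fin cells → Word w :=
  (code.onMsg.exec (fun _ => 0) v ⟨mem, 0, [], 0⟩).mem

theorem code_onMsg {w cells : ℕ} (ω : ℕ → Word w) (v : Word w) (mem : Fin cells → Word w)
    (cur : ℕ) :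
    (code.onMsg.exec ω v ⟨mem, cur, [], 0⟩).mem = handle mem v ∧
    (code.onMsg.exec ω v ⟨mem, cur, [], 0⟩).cursor = cur ∧
    (code.onMsg.exec ω v ⟨mem, cur, [], 0⟩).sent = [] ∧
    (code.onMsg.exec ω v ⟨mem, cur, [], 0⟩).steps ≤ unitCost := by
  refine ⟨?_, ?_, ?_, ?_⟩
  · simp only [handle, code, siteMsg, Cmd.exec, Local.tick]; split <;> rfl
  · simp only [code, siteMsg, Cmd.exec, Local.tick]; split <;> rfl
  · simp only [code, siteMsg, Cmd.exec, Local.tick]; split <;> rfl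
  · have lf : siteMsg.LoopFree := by simp [siteMsg, Cmd.LoopFree]
    have := lf.steps_le ω v (⟨mem, cur, [], 0⟩ : Local w cells)
    refine this.trans ?_
    simp only [unitCost]; omega

theorem layout_handle {w cells D S : ℕ} (hw : 1 ≤ w) (mem : Fin cells → Word w) (v : Word w)
    {g : ℕ → Cell} (hf : siteMsg.Fits (2 ^ w) cells (fun _ => 0) v.val ⟨cellVal mem, 0, []⟩)
    (h : Layout D S (siteMsg.nat (fun _ => 0) v.val ⟨cellVal mem, 0, []⟩).mem g) :
    Layout D S (cellVal (handle mem v)) g := by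
  have hr : Represents (⟨mem, 0, [], 0⟩ : Local w cells) ⟨cellVal mem, 0, []⟩ := ⟨rfl, rfl, rfl⟩
  have := (Cmd.exec_represents hw (fun _ => 0) v siteMsg _ _ hr (by simpa using hf)).mem
  rw [handle, show code.onMsg = siteMsg from rfl, this]
  simpa using h

theorem layout_handle_reset {w cells D S j th x : ℕ} (hw : 1 ≤ w) (hW : 2 ^ w = D ^ 4)
    (mem : Fin cells → Word w) {g : ℕ → Cell} (h : Layout D S (cellVal mem) g)
    (hS : 4 + 5 * S ≤ cells) (hD : 4 + 5 * S + 5 ≤ D) (hj : j < S) (hth : th < D) (hx : x < D) :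
    Layout D S (cellVal (handle mem (Fin.ofNat (2 ^ w) (pack D 0 j th x))))
      (Function.update g j ((g j).reset th x)) := by
  have hp := (pack_bounds (show 0 < D by omega) (show j < D by omega) hth hx).2.2.2.2.2
  have e : (Fin.ofNat (2 ^ w) (pack D 0 j th x)).val = pack D 0 j th x := by
    simp only [Fin.ofNat]; exact Nat.mod_eq_of_lt (hW ▸ hp)
  obtain ⟨a, b⟩ := siteMsg_reset (ρ := fun _ => 0) (N := ⟨cellVal mem, 0, []⟩) (x := x) h hj hD
    hth hS
  exact layout_handle hw _ _ (by rw [e, hW]; exact a) (by rw [e]; exact b)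

theorem layout_handle_double {w cells D S j : ℕ} (hw : 1 ≤ w) (hW : 2 ^ w = D ^ 4)
    (mem : Fin cells → Word w) {g : ℕ → Cell} (h : Layout D S (cellVal mem) g)
    (hS : 4 + 5 * S ≤ cells) (hD : 4 + 5 * S + 5 ≤ D) (hj : j < S) (hT : (g j).gran ≤ D) :
    Layout D S (cellVal (handle mem (Fin.ofNat (2 ^ w) (pack D 1 j 0 0))))
      (Function.update g j (g j).double) := by
  have hp := (pack_bounds (show 1 < D by omega) (show j < D by omega) (show 0 < D by omega)
    (show 0 < D by omega)).2.2.2.2.2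
  have e : (Fin.ofNat (2 ^ w) (pack D 1 j 0 0)).val = pack D 1 j 0 0 := by
    simp only [Fin.ofNat]; exact Nat.mod_eq_of_lt (hW ▸ hp)
  obtain ⟨a, b⟩ := siteMsg_double (ρ := fun _ => 0) (N := ⟨cellVal mem, 0, []⟩) h hj hD hT hS
  exact layout_handle hw _ _ (by rw [e, hW]; exact a) (by rw [e]; exact b)

/-! ## Delivery of messages -/

section delivery
variable {w k cells : ℕ} {co : Coordinator w k}

theorem settle_eq (P : SiteCode) (ω : ℕ → Word w) (s : Config cells co) (N : ℕ)
    (h : ((step P ω)^[N] s).pending = []) : settle P ω s = (step P ω)^[N] s := by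
  have hex : ∃ N : ℕ, ((step P ω)^[N] s).pending = [] := ⟨N, h⟩
  classical
  rw [settle, dif_pos hex]
  have fix : ∀ (t : Config cells co), t.pending = [] → ∀ M, (step P ω)^[M] t = t := by
    intro t ht M
    induction M with
    | zero => rfl
    | succ M ih => rw [Function.iterate_succ_apply', ih, step, ht]
  obtain ⟨M, hM⟩ : ∃ M, N = M + Nat.find hex :=
    ⟨N - Nat.find hex, by have := Nat.find_min' hex h; omega⟩
  conv_rhs => rw [hM, Function.iterate_add_apply, fix _ (Nat.find_spec hex)]

/-- The effect of a list of messages from site `i` on the coordinator. -/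
def recvAll (co : Coordinator w k) (i : Fin k) :
    co.State → List (Word w) → co.State × List (Fin k × Word w)
  | st, [] => (st, [])
  | st, x :: xs =>
    ((recvAll co i (co.recv st i x).1 xs).1,
      (co.recv st i x).2 ++ (recvAll co i (co.recv st i x).1 xs).2)

theorem recvAll_append (i : Fin k) (st : co.State) (xs ys : List (Word w)) :
    recvAll co i st (xs ++ ys) =
      ((recvAll co i (recvAll co i st xs).1 ys).1,
        (recvAll co i st xs).2 ++ (recvAll co i (recvAll co i st xs).1 ys).2) := by
  induction xs generalizing st with
  | nil => simp [recvAll]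
  | cons x xs ih => simp [recvAll, ih]

theorem deliver_up (P : SiteCode) (ω : ℕ → Word w) (i : Fin k) (ws : List (Word w))
    (s : Config cells co) (rest : List (Msg w k))
    (h : s.pending = ws.map (Msg.up i) ++ rest) :
    (step P ω)^[ws.length] s =
      { s with
        coord := (recvAll co i s.coord ws).1
        pending := rest ++ (recvAll co i s.coord ws).2.map fun p => Msg.down p.1 p.2
        delivered := s.delivered + ws.length } := by
  induction ws generalizing s rest with
  | nil =>
    simp only [List.map_nil, List.nil_append] at h
    simp [recvAll, ← h]
  | cons x xs ih =>
    rw [List.length_cons, Function.iterate_succ_apply]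
    have e : step P ω s = { s with
        coord := (co.recv s.coord i x).1
        pending := xs.map (Msg.up i) ++
          (rest ++ (co.recv s.coord i x).2.map fun p => Msg.down p.1 p.2)
        delivered := s.delivered + 1 } := by
      rw [step, h]; simp
    rw [e, ih _ _ rfl]
    simp [recvAll]
    omega

theorem deliver_down (ω : ℕ → Word w) (ds : List (Fin k × Word w)) (s : Config cells co)
    (h : s.pending = ds.map fun p => Msg.down p.1 p.2)
    (hm : ∀ i, s.msgSteps i ≤ unitCost * s.msgs i) :
    ((step code ω)^[ds.length] s).mem =
      ds.foldl (fun mem p => Function.update mem p.1 (handle (mem p.1) p.2)) s.mem ∧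
    ((step code ω)^[ds.length] s).coord = s.coord ∧
    ((step code ω)^[ds.length] s).cursor = s.cursor ∧
    ((step code ω)^[ds.length] s).pending = [] ∧
    ((step code ω)^[ds.length] s).delivered = s.delivered + ds.length ∧
    ((step code ω)^[ds.length] s).items = s.items ∧
    ((step code ω)^[ds.length] s).itemSteps = s.itemSteps ∧
    ∀ i, ((step code ω)^[ds.length] s).msgSteps i ≤
      unitCost * ((step code ω)^[ds.length] s).msgs i := by
  induction ds generalizing s with
  | nil => exact ⟨rfl, rfl, rfl, by simpa using h, rfl, rfl, rfl, hm⟩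
  | cons p ds ih =>
    obtain ⟨o1, o2, o3, o4⟩ := code_onMsg ω p.2 (s.mem p.1) s.cursor
    rw [List.length_cons, Function.iterate_succ_apply]
    have e : step code ω s = { s with
        mem := Function.update s.mem p.1 (handle (s.mem p.1) p.2)
        pending := ds.map fun p => Msg.down p.1 p.2
        delivered := s.delivered + 1
        msgs := Function.update s.msgs p.1 (s.msgs p.1 + 1)
        msgSteps := Function.update s.msgSteps p.1 (s.msgSteps p.1 +
          (code.onMsg.exec ω p.2 ⟨s.mem p.1, s.cursor, [], 0⟩).steps) } := by
      rw [step, h]; simp [o1, o2, o3]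
    have := ih (step code ω s) (by rw [e]) (by
      intro i
      rw [e]
      by_cases hi : i = p.1
      · subst hi; simp only [Function.update_self]
        have := hm p.1
        rw [Nat.mul_succ]; omega
      · simpa [Function.update_of_ne hi] using hm i)
    obtain ⟨a1, a2, a3, a4, a5, a6, a7, a8⟩ := this
    refine ⟨?_, ?_, ?_, a4, ?_, ?_, ?_, a8⟩
    · rw [a1, e]; rfl
    · rw [a2, e]
    · rw [a3, e]
    · rw [a5, e]; simp only; omega
    · rw [a6, e]
    · rw [a7, e]

/-- The messages by which a word is sent to every site. -/
def broadcast (k : ℕ) (v : Word w) : List (Fin k × Word w) := (List.finRange k).map fun i => (i, v)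

theorem foldl_broadcast (mem : Fin k → Fin cells → Word w) (vs : List (Word w)) :
    (vs.flatMap (broadcast k)).foldl
      (fun mem p => Function.update mem p.1 (handle (mem p.1) p.2)) mem =
      fun i => vs.foldl handle (mem i) := by
  induction vs generalizing mem with
  | nil => rfl
  | cons v vs ih =>
    rw [List.flatMap_cons, List.foldl_append, ih]
    have key : ∀ (l : List (Fin k)) (mem : Fin k → Fin cells → Word w), l.Nodup →
        (l.map fun i => (i, v)).foldl
          (fun mem p => Function.update mem p.1 (handle (mem p.1) p.2)) mem =
          fun i => if i ∈ l then handle (mem i) v else mem i := by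
      intro l
      induction l with
      | nil => intro mem _; simp
      | cons a l ihl =>
        intro mem hnd
        rw [List.nodup_cons] at hnd
        rw [List.map_cons, List.foldl_cons, ihl _ hnd.2]
        funext i
        by_cases hi : i = a
        · subst hi; simp [hnd.1]
        · simp [hi]
    rw [broadcast, key _ _ (List.nodup_finRange k)]
    simp

end delivery

end Sampling

/-! ## The coordinator -/

namespace Sampling

open Ram Monitor

/-- The data that the coordinator keeps for one sampler: the number of samples so far, the logarithm
of the granularity, and for each site the last reported counter and offset. -/
structure Ledger (k : ℕ) where
  epoch : ℕ
  level : ℕ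
  cnt : Fin k → ℕ
  off : Fin k → ℕ

/-- The number of multiples of `T` in `(u, c + u]`. -/
def crossings (T c u : ℕ) : ℕ := (c + u) / T - u / T

/-- The number of multiples of the granularity that the shifted counters have passed. -/
def Ledger.total {k : ℕ} (s : Ledger k) : ℕ := ∑ i, crossings (2 ^ s.level) (s.cnt i) (s.off i)

/-- A new sample. -/
def Ledger.fresh {k : ℕ} (s : Ledger k) : Ledger k where
  epoch := s.epoch + 1
  level := 0
  cnt := fun _ => 0
  off := fun _ => 0

/-- A report. -/
def Ledger.record {k : ℕ} (s : Ledger k) (i : Fin k) (c u : ℕ) : Ledger k :=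
  { s with cnt := Function.update s.cnt i c, off := Function.update s.off i u }

/-- A doubling of the granularity. -/
def Ledger.raise {k : ℕ} (s : Ledger k) : Ledger k := { s with level := s.level + 1 }

/-- The estimate of the tail frequency of the sample. -/
def Ledger.estimate {k : ℕ} (s : Ledger k) : ℕ := 1 + 2 ^ s.level * s.total

/-- The reaction of the coordinator to a word from site `i`: new state, and words to broadcast. -/
def react {k : ℕ} (D Q B : ℕ) (st : ℕ → Ledger k) (i : Fin k) (v : ℕ) :
    (ℕ → Ledger k) × List ℕ :=
  if v % D = 0 then
    (Function.update st (v / D % D) (st (v / D % D)).fresh,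
      [pack D 0 (v / D % D) (if (st (v / D % D)).epoch + 1 < Q then v / D / D % D else 0)
        (v / D / D / D)])
  else if B < ((st (v / D % D)).record i (v / D / D % D) (v / D / D / D)).total then
    (Function.update st (v / D % D)
      ((st (v / D % D)).record i (v / D / D % D) (v / D / D / D)).raise, [pack D 1 (v / D % D) 0 0])
  else
    (Function.update st (v / D % D)
      ((st (v / D % D)).record i (v / D / D % D) (v / D / D / D)), [])

/-- The coordinator of `S` samplers. -/
noncomputable def coordinator (w k D Q B S : ℕ) (f : ℕ → ℝ) : Coordinator w k where
  State := ℕ → Ledger k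
  init := fun _ => ⟨0, 0, fun _ => 0, fun _ => 0⟩
  recv st i v := ((react D Q B st i v.val).1,
    ((react D Q B st i v.val).2.map (Fin.ofNat (2 ^ w))).flatMap (broadcast k))
  out st := (∑ j ∈ Finset.range S, AMS.incr f (st j).estimate) / S

/-! ## A single sampler -/

/-- The state of one sampler in the whole system, between the arrivals of two items: threshold,
sampled element, counters and offsets of the sites, data of the coordinator, number of messages. -/
structure Sampler (k : ℕ) where
  thr : ℕ
  elt : ℕ
  cnt : Fin k → ℕ
  off : Fin k → ℕ
  led : Ledger k
  cost : ℕ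

/-- The initial state of a sampler. -/
def Sampler.init (k D : ℕ) : Sampler k where
  thr := D
  elt := 0
  cnt := fun _ => 0
  off := fun _ => D
  led := ⟨0, 0, fun _ => 0, fun _ => 0⟩
  cost := 0

/-- The data kept by site `i`. -/
def Sampler.cell {k : ℕ} (s : Sampler k) (i : Fin k) : Cell :=
  ⟨s.thr, s.elt, s.cnt i, 2 ^ s.led.level, s.off i⟩

/-- The offset of the site that receives an item is drawn, if this is its first item. -/
def Sampler.draw {k : ℕ} (D : ℕ) (s : Sampler k) (i : Fin k) (r : ℕ) : Fin k → ℕ :=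
  Function.update s.off i (newOff D r (s.off i))

/-- The effect of an item `x` with tag `r` at site `i`. -/
def Sampler.step {k : ℕ} (D Q B : ℕ) (s : Sampler k) (e : Fin k × ℕ × ℕ) : Sampler k :=
  if e.2.2 < s.thr then
    { thr := if s.led.epoch + 1 < Q then e.2.2 else 0
      elt := e.2.1
      cnt := fun _ => 0
      off := s.draw D e.1 e.2.2
      led := s.led.fresh
      cost := s.cost + 1 + k }
  else if s.elt = e.2.1 then
    if (s.cnt e.1 + 1 + newOff D e.2.2 (s.off e.1)) % 2 ^ s.led.level = 0 then
      if B < (s.led.record e.1 (s.cnt e.1 + 1) (newOff D e.2.2 (s.off e.1))).total then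
        { s with
          cnt := Function.update s.cnt e.1 (s.cnt e.1 + 1)
          off := s.draw D e.1 e.2.2
          led := (s.led.record e.1 (s.cnt e.1 + 1) (newOff D e.2.2 (s.off e.1))).raise
          cost := s.cost + 1 + k }
      else
        { s with
          cnt := Function.update s.cnt e.1 (s.cnt e.1 + 1)
          off := s.draw D e.1 e.2.2
          led := s.led.record e.1 (s.cnt e.1 + 1) (newOff D e.2.2 (s.off e.1))
          cost := s.cost + 1 }
    else
      { s with
        cnt := Function.update s.cnt e.1 (s.cnt e.1 + 1)
        off := s.draw D e.1 e.2.2 }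
  else { s with off := s.draw D e.1 e.2.2 }

/-- The data of site `i'` after the item has been handled, before messages are delivered. -/
def Sampler.mid {k : ℕ} (D : ℕ) (s : Sampler k) (e : Fin k × ℕ × ℕ) (i' : Fin k) : Cell :=
  if i' = e.1 then (s.cell i').item D e.2.1 e.2.2 else s.cell i'

/-- The messages to the coordinator caused by an item. -/
def Sampler.ups {k : ℕ} (D j : ℕ) (s : Sampler k) (e : Fin k × ℕ × ℕ) : List ℕ :=
  (s.cell e.1).report D j e.2.1 e.2.2

/-- The words broadcast by the coordinator because of an item. -/
def Sampler.downs {k : ℕ} (D Q B j : ℕ) (s : Sampler k) (e : Fin k × ℕ × ℕ) : List ℕ :=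
  if e.2.2 < s.thr then [pack D 0 j (if s.led.epoch + 1 < Q then e.2.2 else 0) e.2.1]
  else if s.elt = e.2.1 then
    if (s.cnt e.1 + 1 + newOff D e.2.2 (s.off e.1)) % 2 ^ s.led.level = 0 then
      if B < (s.led.record e.1 (s.cnt e.1 + 1) (newOff D e.2.2 (s.off e.1))).total then
        [pack D 1 j 0 0]
      else []
    else []
  else []

theorem Sampler.step_cost {k : ℕ} (D Q B j : ℕ) (s : Sampler k) (e : Fin k × ℕ × ℕ) :
    (s.step D Q B e).cost =
      s.cost + ((s.ups D j e).length + (s.downs D Q B j e).length * k) := by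
  simp only [Sampler.step, Sampler.ups, Sampler.downs, Cell.report, Sampler.cell]
  by_cases c1 : e.2.2 < s.thr <;> by_cases c2 : s.elt = e.2.1 <;>
    by_cases c3 : (s.cnt e.1 + 1 + newOff D e.2.2 (s.off e.1)) % 2 ^ s.led.level = 0 <;>
    by_cases c4 : B < (s.led.record e.1 (s.cnt e.1 + 1) (newOff D e.2.2 (s.off e.1))).total <;>
    simp only [c1, c2, c3, c4, if_true, if_false, List.length_cons, List.length_nil] <;> ring

/-- The bounds under which no overflow occurs. -/
structure Sampler.InRange {k : ℕ} (D : ℕ) (s : Sampler k) : Prop where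
  cnt : ∀ i, s.cnt i + 1 < D
  off : ∀ i, s.off i ≤ D
  gran : 2 ^ s.led.level ≤ D

theorem newOff_lt {D r u : ℕ} (hr : r < D) (hu : u ≤ D) : newOff D r u < D := by
  unfold newOff; split_ifs <;> omega

theorem recvAll_ups {w k D Q B S j : ℕ} (f : ℕ → ℝ) (hW : 2 ^ w = D ^ 4)
    (hD : 4 + 5 * S + 5 ≤ D) (hj : j < S) (s : Sampler k) (hs : s.InRange D)
    (e : Fin k × ℕ × ℕ) (hx : e.2.1 < D) (hr : e.2.2 < D)
    (st : ℕ → Ledger k) (hst : st j = s.led) :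
    recvAll (coordinator w k D Q B S f) e.1 st ((s.ups D j e).map (Fin.ofNat (2 ^ w))) =
      (Function.update st j (s.step D Q B e).led,
        ((s.downs D Q B j e).map (Fin.ofNat (2 ^ w))).flatMap (broadcast k)) := by
  have d0 : 0 < D := by omega
  have d1 : 1 < D := by omega
  have hjD : j < D := by omega
  have ho := newOff_lt hr (hs.off e.1)
  have b0 := (pack_bounds d0 hjD hr hx).2.2.2.2.2
  have b1 := (pack_bounds d1 hjD (hs.cnt e.1) ho).2.2.2.2.2
  rw [← hW] at b0 b1
  have upd : Function.update st j s.led = st := by rw [← hst, Function.update_eq_self]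
  clear hW
  simp only [Sampler.step, Sampler.ups, Sampler.downs, Cell.report, Sampler.cell]
  by_cases c1 : e.2.2 < s.thr <;> by_cases c2 : s.elt = e.2.1 <;>
    by_cases c3 : (s.cnt e.1 + 1 + newOff D e.2.2 (s.off e.1)) % 2 ^ s.led.level = 0 <;>
    by_cases c4 : B < (s.led.record e.1 (s.cnt e.1 + 1) (newOff D e.2.2 (s.off e.1))).total
  all_goals
    simp [recvAll, coordinator, react, Fin.ofNat, Nat.mod_eq_of_lt b0, Nat.mod_eq_of_lt b1,
      pack_type, pack_index, pack_fst, pack_snd, d0, d1, hjD, hr, hs.cnt e.1, hst, upd, c1, c2, c3,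
      c4]

theorem layout_downs {w k cells D Q B S j : ℕ} (hw : 1 ≤ w) (hW : 2 ^ w = D ^ 4)
    (hS : 4 + 5 * S ≤ cells)
    (hD : 4 + 5 * S + 5 ≤ D) (hj : j < S) (s : Sampler k) (hs : s.InRange D)
    (e : Fin k × ℕ × ℕ) (hx : e.2.1 < D) (hr : e.2.2 < D) (i' : Fin k)
    (mem : Fin cells → Word w) {g : ℕ → Cell} (h : Layout D S (cellVal mem) g)
    (hg : g j = s.mid D e i') :
    Layout D S (cellVal (((s.downs D Q B j e).map (Fin.ofNat (2 ^ w))).foldl handle mem))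
      (Function.update g j ((s.step D Q B e).cell i')) := by
  have upd : ∀ c, g j = c → Layout D S (cellVal mem) (Function.update g j c) := by
    intro c hc; rwa [← hc, Function.update_eq_self]
  have hgr : (g j).gran ≤ D := by
    rw [hg, Sampler.mid]
    split_ifs <;> exact hs.gran
  simp only [Sampler.mid, Cell.item, Sampler.cell] at hg
  simp only [Sampler.step, Sampler.downs]
  by_cases c1 : e.2.2 < s.thr
  · simp only [c1, if_true, List.map_cons, List.map_nil, List.foldl_cons, List.foldl_nil]
    have := layout_handle_reset hw hW mem h hS hD hj
      (th := if s.led.epoch + 1 < Q then e.2.2 else 0) (x := e.2.1) (by split_ifs <;> omega) hx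
    convert this using 2
    rw [hg]
    by_cases c : i' = e.1 <;>
      simp [Sampler.cell, Cell.reset, Ledger.fresh, Sampler.draw, c]
  by_cases c2 : s.elt = e.2.1
  swap
  · simp only [c1, c2, if_false, List.map_nil, List.foldl_nil]
    apply upd
    rw [hg]
    by_cases c : i' = e.1 <;> simp [Sampler.cell, Sampler.draw, c, c1, c2]
  by_cases c3 : (s.cnt e.1 + 1 + newOff D e.2.2 (s.off e.1)) % 2 ^ s.led.level = 0
  swap
  · simp only [c1, c2, c3, if_true, if_false, List.map_nil, List.foldl_nil]
    apply upd
    rw [hg]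
    by_cases c : i' = e.1 <;> simp [Sampler.cell, Sampler.draw, c, c1, c2]
  by_cases c4 : B < (s.led.record e.1 (s.cnt e.1 + 1) (newOff D e.2.2 (s.off e.1))).total
  swap
  · simp only [c1, c2, c3, c4, if_true, if_false, List.map_nil, List.foldl_nil]
    apply upd
    rw [hg]
    by_cases c : i' = e.1 <;> simp [Sampler.cell, Sampler.draw, c, c1, c2, Ledger.record]
  · simp only [c1, c2, c3, c4, if_true, if_false, List.map_cons, List.map_nil, List.foldl_cons,
      List.foldl_nil]
    have := layout_handle_double hw hW mem h hS hD hj hgr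
    convert this using 2
    rw [hg]
    by_cases c : i' = e.1 <;>
      simp [Sampler.cell, Sampler.draw, c, c1, c2, Ledger.record, Ledger.raise, Cell.double,
        pow_succ, mul_two]

/-! ## The system as a family of independent samplers -/

/-- A configuration of the whole system represents the states `σ j` of its samplers. -/
structure Simulates {w k cells : ℕ} (D Q B S : ℕ) (f : ℕ → ℝ) (len : ℕ)
    (s : Config cells (coordinator w k D Q B S f)) (σ : ℕ → Sampler k) : Prop where
  mem : ∀ i, Layout D S (cellVal (s.mem i)) fun j => (σ j).cell i
  coord : ∀ j < S, (show ℕ → Ledger k from s.coord) j = (σ j).led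
  cursor : s.cursor = len * S
  pending : s.pending = []
  delivered : s.delivered = ∑ j ∈ Finset.range S, (σ j).cost
  itemSteps : ∀ i, s.itemSteps i ≤ unitCost * (S + 1) * s.items i
  msgSteps : ∀ i, s.msgSteps i ≤ unitCost * s.msgs i

theorem simulates_arrive {w k n cells D Q B S len : ℕ} {f : ℕ → ℝ} (hw : 1 ≤ w)
    (hW : 2 ^ w = D ^ 4) (hS : 4 + 5 * S ≤ cells) (hD : 4 + 5 * S + 5 ≤ D) (hn : n ≤ D)
    (ω : ℕ → Word w) {s : Config cells (coordinator w k D Q B S f)} {σ : ℕ → Sampler k}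
    (h : Simulates D Q B S f len s σ) (hσ : ∀ j < S, (σ j).InRange D) (p : Fin k × Fin n) :
    Simulates D Q B S f (len + 1) (arrive code ω s p)
      fun j => (σ j).step D Q B (p.1, p.2.val, (ω (len * S + j)).val % D) := by
  have d0 : 0 < D := by omega
  have hDW : D * 1 ≤ D ^ 4 := by
    have : 1 ≤ D ^ 3 := Nat.one_le_pow _ _ d0
    calc D * 1 ≤ D * D ^ 3 := Nat.mul_le_mul_left _ this
      _ = D ^ 4 := by ring
  set e : ℕ → Fin k × ℕ × ℕ := fun j => (p.1, p.2.val, (ω (len * S + j)).val % D) with he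
  have hxv : (Fin.ofNat (2 ^ w) p.2.val).val = p.2.val := by
    simp only [Fin.ofNat]
    exact Nat.mod_eq_of_lt (by have := p.2.isLt; omega)
  have hxD : p.2.val < D := lt_of_lt_of_le p.2.isLt hn
  have hrD : ∀ j, (ω (len * S + j)).val % D < D := fun j => Nat.mod_lt _ d0
  obtain ⟨o1, o2, o3, o4⟩ := code_onItem hw hW ω (Fin.ofNat (2 ^ w) p.2.val) (s.mem p.1) s.cursor
    (h.mem p.1) (by rw [hxv]; exact hxD) hS hD (fun j hj => (hσ j hj).cnt p.1)
    (fun j hj => (hσ j hj).off p.1)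
  rw [hxv, h.cursor] at o1 o3
  set r := code.onItem.exec ω (Fin.ofNat (2 ^ w) p.2.val) ⟨s.mem p.1, s.cursor, [], 0⟩ with hr
  have hsent : r.sent = ((List.range S).flatMap fun j => (σ j).ups D j (e j)).map
      (Fin.ofNat (2 ^ w)) := by
    have : r.sent = (r.sent.map Fin.val).map (Fin.ofNat (2 ^ w)) := by
      rw [List.map_map]
      conv_lhs => rw [← List.map_id r.sent]
      refine List.map_congr_left fun a _ => ?_
      simp [Fin.ofNat, Nat.mod_eq_of_lt a.isLt]
    rw [this, hr, h.cursor, o3]; rfl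
  set s1 : Config cells (coordinator w k D Q B S f) :=
    { s with
      mem := Function.update s.mem p.1 r.mem
      cursor := r.cursor
      pending := s.pending ++ r.sent.map (Msg.up p.1)
      items := Function.update s.items p.1 (s.items p.1 + 1)
      itemSteps := Function.update s.itemSteps p.1 (s.itemSteps p.1 + r.steps) } with hs1
  have harr : arrive code ω s p = settle code ω s1 := rfl
  set outs : ℕ → List ℕ := fun J => (List.range J).flatMap fun j => (σ j).downs D Q B j (e j)
    with houts
  -- the coordinator
  have hco : ∀ J ≤ S, ∃ st' : ℕ → Ledger k,
      recvAll (coordinator w k D Q B S f) p.1 s.coord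
        (((List.range J).flatMap fun j => (σ j).ups D j (e j)).map (Fin.ofNat (2 ^ w))) =
        (st', ((outs J).map (Fin.ofNat (2 ^ w))).flatMap (broadcast k)) ∧
      (∀ j < J, st' j = ((σ j).step D Q B (e j)).led) ∧
      ∀ j < S, J ≤ j → st' j = (σ j).led := by
    intro J
    induction J with
    | zero => exact fun _ => ⟨s.coord, by simp [recvAll, houts]; rfl, by simp, fun j hj _ => h.coord j hj⟩
    | succ J ih =>
      intro hJ
      obtain ⟨st', e1, e2, e3⟩ := ih (by omega)
      refine ⟨Function.update st' J ((σ J).step D Q B (e J)).led, ?_, ?_, ?_⟩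
      · rw [List.range_succ, List.flatMap_append, List.map_append, recvAll_append, e1]
        simp only [List.flatMap_cons, List.flatMap_nil, List.append_nil]
        rw [show p.1 = (e J).1 from rfl,
          recvAll_ups f hW hD (by omega) (σ J) (hσ J (by omega)) (e J) hxD (hrD J) st'
          (e3 J (by omega) le_rfl)]
        simp [houts, List.range_succ]
        rfl
      · intro j hj
        by_cases c : j = J
        · subst c; simp
        · rw [Function.update_of_ne c]; exact e2 j (by omega)
      · intro j hj hJj
        rw [Function.update_of_ne (by omega)]; exact e3 j hj (by omega)
  obtain ⟨st', c1, c2, -⟩ := hco S le_rfl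
  -- the sites
  have hmem : ∀ i', ∀ J ≤ S, Layout D S
      (cellVal (((outs J).map (Fin.ofNat (2 ^ w))).foldl handle (s1.mem i')))
      fun j => if j < J then ((σ j).step D Q B (e j)).cell i' else (σ j).mid D (e j) i' := by
    intro i' J
    induction J with
    | zero =>
      intro _
      simp only [houts, List.range_zero, List.flatMap_nil, List.map_nil, List.foldl_nil,
        Nat.not_lt_zero, if_false]
      by_cases c : i' = p.1
      · subst c
        simp only [hs1, Function.update_self]
        rw [hr, h.cursor]
        refine o1.congr fun j _ => ?_
        simp [Sampler.mid, he]
      · simp only [hs1, Function.update_of_ne c]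
        refine (h.mem i').congr fun j _ => ?_
        simp [Sampler.mid, he, c]
    | succ J ih =>
      intro hJ
      have := layout_downs (Q := Q) (B := B) hw hW hS hD (by omega : J < S) (σ J) (hσ J (by omega))
        (e J) hxD (hrD J) i' _ (ih (by omega)) (by simp)
      have ho : outs (J + 1) = outs J ++ (σ J).downs D Q B J (e J) := by
        simp [houts, List.range_succ]
      rw [ho, List.map_append, List.foldl_append]
      refine this.congr fun j _ => ?_
      by_cases c : j = J
      · subst c; simp
      · rw [Function.update_of_ne c]
        have : j < J ↔ j < J + 1 := by omega
        simp only [this]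
  -- delivery
  have hp1 : s1.pending = r.sent.map (Msg.up p.1) ++ [] := by simp [hs1, h.pending]
  have du := deliver_up code ω p.1 r.sent s1 [] hp1
  have hc1 : recvAll (coordinator w k D Q B S f) p.1 s1.coord r.sent =
      (st', ((outs S).map (Fin.ofNat (2 ^ w))).flatMap (broadcast k)) := by
    rw [hsent]; exact c1
  rw [hc1, List.nil_append] at du
  set ds := ((outs S).map (Fin.ofNat (2 ^ w))).flatMap (broadcast k) with hds
  obtain ⟨d1, d2, d3, d4, d5, d6, d7, d8⟩ := deliver_down ω ds
    ((step code ω)^[r.sent.length] s1) (by rw [du]) (by rw [du]; exact h.msgSteps)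
  rw [← Function.iterate_add_apply] at d1 d2 d3 d4 d5 d6 d7 d8
  rw [harr, settle_eq code ω s1 _ d4]
  rw [du] at d1 d2 d3 d5 d6 d7
  refine ⟨?_, ?_, ?_, d4, ?_, ?_, d8⟩
  · intro i'
    rw [d1, hds, foldl_broadcast]
    exact (hmem i' S le_rfl).congr fun j hj => by simp [hj, he]
  · intro j hj
    rw [d2]
    exact c2 j hj
  · rw [d3]
    change r.cursor = _
    rw [o2, h.cursor]; ring
  · rw [d5]
    have hl1 : r.sent.length = ∑ j ∈ Finset.range S, ((σ j).ups D j (e j)).length := by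
      rw [hsent, List.length_map, List.length_flatMap, Finset.sum_range, ← List.sum_ofFn]
      congr 1
      rw [List.ofFn_eq_map, ← List.map_coe_finRange_eq_range, List.map_map]
      rfl
    have hl2 : ds.length = ∑ j ∈ Finset.range S, ((σ j).downs D Q B j (e j)).length * k := by
      have hb : ∀ l : List (Word w), (l.flatMap (broadcast k)).length = l.length * k := by
        intro l
        induction l with
        | nil => simp
        | cons a l ih =>
          rw [List.flatMap_cons, List.length_append, ih]
          simp [broadcast]; ring
      rw [hds, hb, List.length_map, ← Finset.sum_mul]
      congr 1
      rw [houts, List.length_flatMap, Finset.sum_range, ← List.sum_ofFn]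
      congr 1
      rw [List.ofFn_eq_map, ← List.map_coe_finRange_eq_range, List.map_map]
      rfl
    change s.delivered + r.sent.length + ds.length = _
    rw [hl1, hl2, h.delivered, ← Finset.sum_add_distrib, ← Finset.sum_add_distrib]
    refine Finset.sum_congr rfl fun j _ => ?_
    rw [Sampler.step_cost D Q B j]; ring
  · intro i
    rw [d6, d7]
    change Function.update s.itemSteps p.1 (s.itemSteps p.1 + r.steps) i ≤
      _ * Function.update s.items p.1 (s.items p.1 + 1) i
    by_cases c : i = p.1
    · subst c
      simp only [Function.update_self]
      rw [Nat.mul_succ]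
      exact Nat.add_le_add (h.itemSteps _) o4
    · simpa only [Function.update_of_ne c] using h.itemSteps i

/-- The items seen by sampler `j`, with their tags. -/
def tagged {w k n : ℕ} (D S : ℕ) (ω : ℕ → Word w) (l : List (Fin k × Fin n)) (j : ℕ) :
    List (Fin k × ℕ × ℕ) :=
  l.mapIdx fun t p => (p.1, p.2.val, (ω (t * S + j)).val % D)

/-- The state of a sampler after the items of a list. -/
def Sampler.after {k : ℕ} (D Q B : ℕ) (l : List (Fin k × ℕ × ℕ)) : Sampler k :=
  l.foldl (Sampler.step D Q B) (Sampler.init k D)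

/-- The initial memory of a site. -/
def initMem (w cells D S : ℕ) : Fin cells → Word w := fun a =>
  if a.val = 0 then Fin.ofNat (2 ^ w) D
  else if a.val = 1 then Fin.ofNat (2 ^ w) S
  else if a.val < 4 then 0
  else if a.val % 5 = 4 then Fin.ofNat (2 ^ w) D
  else if a.val % 5 = 2 then Fin.ofNat (2 ^ w) 1
  else if a.val % 5 = 3 then Fin.ofNat (2 ^ w) D
  else 0

theorem simulates_start {w k D Q B S : ℕ} {f : ℕ → ℝ} (hW : 2 ^ w = D ^ 4)
    (hD : 4 + 5 * S + 5 ≤ D) :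
    Simulates D Q B S f 0 (start (coordinator w k D Q B S f) (initMem w (4 + 5 * S) D S))
      fun _ => Sampler.init k D := by
  have d0 : 0 < D := by omega
  have hDW : D * 8 ≤ D ^ 4 := by
    have : 2 ^ 3 ≤ D ^ 3 := Nat.pow_le_pow_left (by omega) _
    calc D * 8 ≤ D * D ^ 3 := Nat.mul_le_mul_left _ this
      _ = D ^ 4 := by ring
  have m1 : D % 2 ^ w = D := Nat.mod_eq_of_lt (by omega)
  have m2 : S % 2 ^ w = S := Nat.mod_eq_of_lt (by omega)
  have m3 : 1 % 2 ^ w = 1 := Nat.mod_eq_of_lt (by omega)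
  refine ⟨?_, fun j _ => rfl, by simp [start], rfl, by simp [start, Sampler.init], by simp [start],
    by simp [start]⟩
  intro i
  refine ⟨?_, ?_, ?_, ?_, ?_, ?_, ?_⟩
  · simp [start, cellVal, initMem, Fin.ofNat, m1]
  · simp [start, cellVal, initMem, Fin.ofNat, m2]; omega
  all_goals
    intro j hj
    simp only [start, cellVal, Sampler.cell, Sampler.init, initMem, Fin.ofNat]
    rw [dif_pos (by omega)]
  · rw [if_neg (by omega), if_neg (by omega), if_neg (by omega), if_pos (by omega)]; exact m1
  · rw [if_neg (by omega), if_neg (by omega), if_neg (by omega), if_neg (by omega),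
      if_neg (by omega), if_neg (by omega)]; rfl
  · rw [if_neg (by omega), if_neg (by omega), if_neg (by omega), if_neg (by omega),
      if_neg (by omega), if_neg (by omega)]; rfl
  · rw [if_neg (by omega), if_neg (by omega), if_neg (by omega), if_neg (by omega),
      if_pos (by omega)]; exact m3
  · rw [if_neg (by omega), if_neg (by omega), if_neg (by omega), if_neg (by omega),
      if_neg (by omega), if_pos (by omega)]; exact m1

theorem simulates_run {w k n D Q B S m : ℕ} {f : ℕ → ℝ} (hw : 1 ≤ w)
    (hW : 2 ^ w = D ^ 4) (hD : 4 + 5 * S + 5 ≤ D) (hn : n ≤ D)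
    (hrange : ∀ l : List (Fin k × ℕ × ℕ), l.length ≤ m → (∀ e ∈ l, e.2.2 < D) →
      (Sampler.after D Q B l).InRange D)
    (ω : ℕ → Word w) (l : List (Fin k × Fin n)) (hl : l.length ≤ m) :
    Simulates D Q B S f l.length
      (run code (coordinator w k D Q B S f) (initMem w (4 + 5 * S) D S) ω l)
      fun j => Sampler.after D Q B (tagged D S ω l j) := by
  induction l using List.reverseRecOn with
  | nil => exact simulates_start hW hD
  | append_singleton l p ih =>
    rw [List.length_append, List.length_singleton] at hl ⊢
    have hs := ih (by omega)
    rw [run, List.foldl_append, List.foldl_cons, List.foldl_nil, ← run]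
    have := simulates_arrive hw hW le_rfl hD hn ω hs (fun j _ => hrange _ (by simp [tagged]; omega) (by
      intro e he
      simp only [tagged, List.mem_mapIdx] at he
      obtain ⟨t, ht, rfl⟩ := he
      exact Nat.mod_lt _ (by omega))) p
    convert this using 2
    simp [tagged, Sampler.after, List.mapIdx_append]

end Sampling

/-! ## Invariants of a single sampler -/

namespace Sampling

theorem crossings_zero (T u : ℕ) : crossings T 0 u = 0 := by simp [crossings]

theorem crossings_one (c u : ℕ) : crossings 1 c u = c := by simp [crossings]

theorem crossings_double (T c u : ℕ) : 2 * crossings (T * 2) c u ≤ crossings T c u + 1 := by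
  unfold crossings
  rw [← Nat.div_div_eq_div_mul, ← Nat.div_div_eq_div_mul]
  have : u / T ≤ (c + u) / T := Nat.div_le_div_right (by omega)
  omega

theorem crossings_le_one {T c u : ℕ} (h : c < T) : crossings T c u ≤ 1 := by
  unfold crossings
  have : (c + u) / T ≤ u / T + 1 := by
    rw [← Nat.add_div_right _ (by omega)]
    exact Nat.div_le_div_right (by omega)
  omega

theorem succ_div_of_not_dvd {T a : ℕ} (h : (a + 1) % T ≠ 0) : (a + 1) / T = a / T := by
  rw [Nat.succ_div, if_neg]; simp
  rwa [Nat.dvd_iff_mod_eq_zero]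

theorem succ_div_of_dvd {T a : ℕ} (h : (a + 1) % T = 0) : (a + 1) / T = a / T + 1 := by
  rw [Nat.succ_div, if_pos (Nat.dvd_of_mod_eq_zero h)]

/-- The communication budget for one sample of a sampler. -/
def epochCost (k B b : ℕ) : ℕ := 1 + k + b * (B + 1 + k) + B

/-- The invariants of a sampler after `len` items. -/
structure Sampler.Inv {k : ℕ} (D Q B b len : ℕ) (s : Sampler k) : Prop where
  off_le : ∀ i, s.off i ≤ D
  unset : ∀ i, s.off i = D → s.cnt i = 0
  cnt_le : ∀ i, s.cnt i ≤ len
  led_le : ∀ i, s.led.cnt i ≤ s.cnt i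
  cons : ∀ i, (s.led.off i = s.off i ∧
      (s.led.cnt i + s.off i) / 2 ^ s.led.level = (s.cnt i + s.off i) / 2 ^ s.led.level) ∨
    (s.led.cnt i = 0 ∧ (s.cnt i + s.off i) / 2 ^ s.led.level = s.off i / 2 ^ s.led.level)
  total_le : s.led.total ≤ B
  level : s.led.level = 0 ∨ 2 ^ s.led.level ≤ 2 * len
  epoch : s.led.epoch ≤ Q
  epoch_lt : 0 < s.thr → s.led.epoch < Q
  cost : s.cost ≤ s.led.epoch * epochCost k B b + s.led.level * (B + 1 + k) + s.led.total

theorem Sampler.Inv.total_eq {k D Q B b len : ℕ} {s : Sampler k} (h : s.Inv D Q B b len) :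
    s.led.total = ∑ i, crossings (2 ^ s.led.level) (s.cnt i) (s.off i) := by
  refine Finset.sum_congr rfl fun i _ => ?_
  rcases h.cons i with ⟨a, c⟩ | ⟨a, c⟩
  · simp only [crossings, a, c]
  · simp only [crossings, a, c, zero_add]; simp

/-- The state after the offset has been drawn. -/
def Sampler.drawn {k : ℕ} (D : ℕ) (s : Sampler k) (i : Fin k) (r : ℕ) : Sampler k :=
  { s with off := s.draw D i r }

theorem Sampler.drawn_off {k D : ℕ} (s : Sampler k) (i : Fin k) (r : ℕ) :
    newOff D r (s.off i) = (s.drawn D i r).off i := by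
  simp [Sampler.drawn, Sampler.draw]

theorem Sampler.Inv.drawn {k D Q B b len : ℕ} {s : Sampler k} (h : s.Inv D Q B b len)
    (i : Fin k) {r : ℕ} (hr : r < D) :
    (s.drawn D i r).Inv D Q B b len ∧ (s.drawn D i r).off i < D := by
  have hlt : newOff D r (s.off i) < D := newOff_lt hr (h.off_le i)
  refine ⟨⟨?_, ?_, h.cnt_le, h.led_le, ?_, h.total_le, h.level, h.epoch, h.epoch_lt, h.cost⟩, ?_⟩
  · intro i'
    by_cases c : i' = i
    · subst c; rw [← Sampler.drawn_off]; exact hlt.le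
    · simpa [Sampler.drawn, Sampler.draw, c] using h.off_le i'
  · intro i'
    by_cases c : i' = i
    · subst c; rw [← Sampler.drawn_off]; intro e; omega
    · simpa [Sampler.drawn, Sampler.draw, c] using h.unset i'
  · intro i'
    by_cases c : i' = i
    · subst c
      by_cases c' : s.off i' = D
      · right
        have h0 : s.cnt i' = 0 := h.unset i' c'
        have h1 := h.led_le i'
        simp only [Sampler.drawn, h0]
        exact ⟨by omega, by simp⟩
      · have : (s.drawn D i' r).off i' = s.off i' := by
          rw [← Sampler.drawn_off, newOff, if_neg c']
        rw [this]
        exact h.cons i'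
    · have : (s.drawn D i r).off i' = s.off i' := by simp [Sampler.drawn, Sampler.draw, c]
      rw [this]
      exact h.cons i'
  · rw [← Sampler.drawn_off]; exact hlt

/-- A new sample. -/
def Sampler.restart {k : ℕ} (Q : ℕ) (s : Sampler k) (x r : ℕ) : Sampler k :=
  { thr := if s.led.epoch + 1 < Q then r else 0
    elt := x
    cnt := fun _ => 0
    off := s.off
    led := s.led.fresh
    cost := s.cost + 1 + k }

/-- An occurrence of the sampled element at site `i` that is not reported. -/
def Sampler.count {k : ℕ} (s : Sampler k) (i : Fin k) : Sampler k :=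
  { s with cnt := Function.update s.cnt i (s.cnt i + 1) }

/-- An occurrence of the sampled element at site `i` that is reported. -/
def Sampler.report {k : ℕ} (s : Sampler k) (i : Fin k) : Sampler k :=
  { s with
    cnt := Function.update s.cnt i (s.cnt i + 1)
    led := s.led.record i (s.cnt i + 1) (s.off i)
    cost := s.cost + 1 }

/-- A doubling of the granularity. -/
def Sampler.raise {k : ℕ} (s : Sampler k) : Sampler k :=
  { s with led := s.led.raise, cost := s.cost + k }

theorem Sampler.step_eq {k D Q B : ℕ} (s : Sampler k) (e : Fin k × ℕ × ℕ) :
    s.step D Q B e =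
      if e.2.2 < s.thr then (s.drawn D e.1 e.2.2).restart Q e.2.1 e.2.2
      else if s.elt = e.2.1 then
        if (s.cnt e.1 + 1 + (s.drawn D e.1 e.2.2).off e.1) % 2 ^ s.led.level = 0 then
          if B < ((s.drawn D e.1 e.2.2).report e.1).led.total then
            ((s.drawn D e.1 e.2.2).report e.1).raise
          else (s.drawn D e.1 e.2.2).report e.1
        else (s.drawn D e.1 e.2.2).count e.1
      else s.drawn D e.1 e.2.2 := by
  have h := Sampler.drawn_off (D := D) s e.1 e.2.2
  simp only [Sampler.step, Sampler.restart, Sampler.report, Sampler.raise, Sampler.count,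
    ← h]
  rfl

theorem Sampler.Inv.mono {k D Q B b len : ℕ} {s : Sampler k} (h : s.Inv D Q B b len) :
    s.Inv D Q B b (len + 1) :=
  { h with
    cnt_le := fun i => (h.cnt_le i).trans (by omega)
    level := h.level.imp id fun h => h.trans (by omega) }

theorem Sampler.Inv.level_le {k D Q B b len : ℕ} {s : Sampler k} (h : s.Inv D Q B b len)
    (hb : 2 * len ≤ 2 ^ b) : s.led.level ≤ b := by
  rcases h.level with h | h
  · omega
  · exact (Nat.pow_le_pow_iff_right (by norm_num)).1 (h.trans hb)

theorem Sampler.Inv.restart {k D Q B b len : ℕ} {s : Sampler k} (h : s.Inv D Q B b len)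
    (hb : 2 * len ≤ 2 ^ b) (x : ℕ) {r : ℕ} (hr : r < s.thr) :
    (s.restart Q x r).Inv D Q B b (len + 1) := by
  have hlt : s.led.epoch < Q := h.epoch_lt (by omega)
  have htot : (s.restart Q x r).led.total = 0 := by
    simp [Sampler.restart, Ledger.fresh, Ledger.total, crossings]
  refine ⟨h.off_le, fun _ _ => rfl, fun _ => Nat.zero_le _, fun _ => le_rfl, fun i => ?_, ?_,
    Or.inl rfl, ?_, ?_, ?_⟩
  · right; simp [Sampler.restart, Ledger.fresh]
  · rw [htot]; omega
  · exact hlt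
  · simp only [Sampler.restart, Ledger.fresh]; split_ifs <;> omega
  · have hl := h.level_le hb
    have h1 := h.cost
    have h2 := h.total_le
    have h3 : s.led.level * (B + 1 + k) ≤ b * (B + 1 + k) := Nat.mul_le_mul_right _ hl
    rw [htot]
    simp only [Sampler.restart, Ledger.fresh]
    rw [Nat.succ_mul]
    have : epochCost k B b = 1 + k + b * (B + 1 + k) + B := rfl
    omega

theorem Sampler.Inv.count {k D Q B b len : ℕ} {s : Sampler k} (h : s.Inv D Q B b len) {i : Fin k}
    (ho : s.off i < D) (hi : (s.cnt i + 1 + s.off i) % 2 ^ s.led.level ≠ 0) :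
    (s.count i).Inv D Q B b (len + 1) := by
  have e : s.cnt i + 1 + s.off i = s.cnt i + s.off i + 1 := by omega
  have hdiv : (s.cnt i + 1 + s.off i) / 2 ^ s.led.level = (s.cnt i + s.off i) / 2 ^ s.led.level := by
    rw [e] at hi ⊢; exact succ_div_of_not_dvd hi
  refine ⟨h.off_le, ?_, ?_, ?_, ?_, h.total_le, h.mono.level, h.epoch, h.epoch_lt, h.cost⟩
  all_goals
    intro i'
    by_cases c : i' = i
  · subst c; intro h0; simp only [Sampler.count] at h0; omega
  · simpa [Sampler.count, c] using h.unset i'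
  · subst c; simpa [Sampler.count] using h.cnt_le i'
  · simpa [Sampler.count, c] using h.mono.cnt_le i'
  · subst c; simpa [Sampler.count] using (h.led_le i').trans (by omega)
  · simpa [Sampler.count, c] using h.led_le i'
  · subst c; simpa [Sampler.count, hdiv] using h.cons i'
  · simpa [Sampler.count, c] using h.cons i'

theorem Sampler.Inv.report_total {k D Q B b len : ℕ} {s : Sampler k} (h : s.Inv D Q B b len)
    {i : Fin k} (hi : (s.cnt i + 1 + s.off i) % 2 ^ s.led.level = 0) :
    (s.report i).led.total = s.led.total + 1 := by
  rw [h.total_eq]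
  have e : s.cnt i + 1 + s.off i = s.cnt i + s.off i + 1 := by omega
  simp only [Sampler.report, Ledger.total, Ledger.record]
  rw [← Finset.add_sum_erase _ _ (Finset.mem_univ i),
    ← Finset.add_sum_erase Finset.univ (fun i => crossings _ (s.cnt i) (s.off i))
      (Finset.mem_univ i)]
  have h1 : crossings (2 ^ s.led.level) (s.cnt i + 1) (s.off i) =
      crossings (2 ^ s.led.level) (s.cnt i) (s.off i) + 1 := by
    unfold crossings
    rw [e, succ_div_of_dvd (by rw [← e]; exact hi)]
    have : s.off i / 2 ^ s.led.level ≤ (s.cnt i + s.off i) / 2 ^ s.led.level :=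
      Nat.div_le_div_right (by omega)
    omega
  have h2 : ∀ i' ∈ Finset.univ.erase i,
      crossings (2 ^ s.led.level) (Function.update s.led.cnt i (s.cnt i + 1) i')
        (Function.update s.led.off i (s.off i) i') =
      crossings (2 ^ s.led.level) (s.cnt i') (s.off i') := by
    intro i' hi'
    have c : i' ≠ i := Finset.ne_of_mem_erase hi'
    simp only [Function.update_of_ne c]
    rcases h.cons i' with ⟨a, c⟩ | ⟨a, c⟩
    · simp only [crossings, a, c]
    · simp only [crossings, a, c, zero_add]; simp
  rw [Finset.sum_congr rfl h2]
  simp only [Function.update_self, h1]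
  ring

/-- The invariants after a report, except for the bound on the total. -/
theorem Sampler.Inv.report {k D Q B b len : ℕ} {s : Sampler k} (h : s.Inv D Q B b len)
    {i : Fin k} (ho : s.off i < D) (hi : (s.cnt i + 1 + s.off i) % 2 ^ s.led.level = 0) :
    (s.report i).Inv D Q (B + 1) b (len + 1) ∧
      (s.report i).cost ≤ (s.report i).led.epoch * epochCost k B b +
        (s.report i).led.level * (B + 1 + k) + (s.report i).led.total := by
  have htot := h.report_total hi
  have hcost : (s.report i).cost ≤ (s.report i).led.epoch * epochCost k B b +
      (s.report i).led.level * (B + 1 + k) + (s.report i).led.total := by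
    rw [htot]
    have := h.cost
    simp only [Sampler.report, Ledger.record]
    omega
  refine ⟨⟨h.off_le, ?_, ?_, ?_, ?_, ?_, h.mono.level, h.epoch, h.epoch_lt, ?_⟩, hcost⟩
  rotate_left 4
  · rw [htot]; have := h.total_le; omega
  · refine hcost.trans ?_
    gcongr
    · unfold epochCost; gcongr <;> omega
    · omega
  all_goals
    intro i'
    by_cases c : i' = i
  · subst c; intro h0; simp only [Sampler.report] at h0; omega
  · simpa [Sampler.report, c] using h.unset i'
  · subst c; simpa [Sampler.report] using h.cnt_le i'
  · simpa [Sampler.report, c] using h.mono.cnt_le i'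
  · subst c; simp [Sampler.report, Ledger.record]
  · simpa [Sampler.report, Ledger.record, c] using h.led_le i'
  · subst c; left; simp [Sampler.report, Ledger.record]
  · simpa [Sampler.report, Ledger.record, c] using h.cons i'

theorem Sampler.Inv.step {k D Q B b len : ℕ} {s : Sampler k} (h : s.Inv D Q B b len)
    (hb : 2 * len ≤ 2 ^ b) (hB : k + 1 ≤ B) (e : Fin k × ℕ × ℕ) (hr : e.2.2 < D) :
    (s.step D Q B e).Inv D Q B b (len + 1) := by
  rw [Sampler.step_eq]
  obtain ⟨h', ho⟩ := h.drawn e.1 hr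
  by_cases c1 : e.2.2 < s.thr
  · rw [if_pos c1]
    exact h'.restart hb _ c1
  rw [if_neg c1]
  by_cases c2 : s.elt = e.2.1
  swap
  · rw [if_neg c2]; exact h'.mono
  rw [if_pos c2]
  by_cases c3 : (s.cnt e.1 + 1 + (s.drawn D e.1 e.2.2).off e.1) % 2 ^ s.led.level = 0
  swap
  · rw [if_neg c3]; exact h'.count ho c3
  rw [if_pos c3]
  have htot := h'.report_total (i := e.1) c3
  obtain ⟨h1, h2⟩ := h'.report (i := e.1) ho c3
  have hcost := h'.cost
  have hle := h'.total_le
  generalize s.drawn D e.1 e.2.2 = s' at *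
  by_cases c4 : B < (s'.report e.1).led.total
  swap
  · rw [if_neg c4]
    exact { h1 with total_le := by omega, cost := h2 }
  rw [if_pos c4]
  generalize ht : s'.report e.1 = t at *
  have hT := h1.total_eq
  have hcons : ∀ i, (t.raise.led.off i = t.raise.off i ∧
      (t.raise.led.cnt i + t.raise.off i) / 2 ^ t.raise.led.level =
        (t.raise.cnt i + t.raise.off i) / 2 ^ t.raise.led.level) ∨
      (t.raise.led.cnt i = 0 ∧ (t.raise.cnt i + t.raise.off i) / 2 ^ t.raise.led.level =
        t.raise.off i / 2 ^ t.raise.led.level) := by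
    intro i
    simp only [Sampler.raise, Ledger.raise, pow_succ, ← Nat.div_div_eq_div_mul]
    rcases h1.cons i with ⟨a, c⟩ | ⟨a, c⟩
    · left; exact ⟨a, by rw [c]⟩
    · right; exact ⟨a, by rw [c]⟩
  have htr : 2 * t.raise.led.total ≤ t.led.total + k := by
    simp only [Ledger.total, Sampler.raise, Ledger.raise, pow_succ]
    rw [Finset.mul_sum]
    calc _ ≤ ∑ i : Fin k, (crossings (2 ^ t.led.level) (t.led.cnt i) (t.led.off i) + 1) :=
          Finset.sum_le_sum fun i _ => crossings_double _ _ _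
      _ = _ := by simp [Finset.sum_add_distrib]
  have hlev : 2 ^ t.led.level ≤ len + 1 := by
    by_contra hlt
    have : t.led.total ≤ ∑ i : Fin k, 1 := by
      rw [hT]
      refine Finset.sum_le_sum fun i _ => crossings_le_one ?_
      have := h1.cnt_le i
      omega
    simp at this
    omega
  refine ⟨h1.off_le, h1.unset, h1.cnt_le, h1.led_le, hcons, by omega, Or.inr ?_, h1.epoch,
    h1.epoch_lt, ?_⟩
  · simp only [Sampler.raise, Ledger.raise, pow_succ]; omega
  · have e1 : t.cost = s'.cost + 1 := by rw [← ht]; rfl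
    have e2 : t.led.epoch = s'.led.epoch := by rw [← ht]; rfl
    have e3 : t.led.level = s'.led.level := by rw [← ht]; rfl
    simp only [Sampler.raise, Ledger.raise, Nat.succ_mul]
    rw [e1, e2, e3]
    omega

theorem Sampler.inv_init {k D Q B b : ℕ} (hQ : 1 ≤ Q) :
    (Sampler.init k D).Inv D Q B b 0 := by
  have ht : (Sampler.init k D).led.total = 0 := by
    simp [Sampler.init, Ledger.total, crossings]
  refine ⟨fun _ => le_rfl, fun _ _ => rfl, fun _ => le_rfl, fun _ => le_rfl, fun i => ?_, ?_,
    Or.inl rfl, Nat.zero_le _, fun _ => hQ, ?_⟩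
  · right; simp [Sampler.init]
  · rw [ht]; omega
  · rw [ht]; simp [Sampler.init]

theorem Sampler.after_append {k D Q B : ℕ} (l : List (Fin k × ℕ × ℕ)) (e : Fin k × ℕ × ℕ) :
    Sampler.after D Q B (l ++ [e]) = (Sampler.after D Q B l).step D Q B e := by
  simp [Sampler.after]

theorem Sampler.inv_after {k D Q B b m : ℕ} (hQ : 1 ≤ Q) (hb : 2 * m ≤ 2 ^ b) (hB : k + 1 ≤ B)
    (l : List (Fin k × ℕ × ℕ)) (hl : l.length ≤ m) (hr : ∀ e ∈ l, e.2.2 < D) :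
    (Sampler.after D Q B l).Inv D Q B b l.length := by
  induction l using List.reverseRecOn with
  | nil => exact Sampler.inv_init hQ
  | append_singleton l e ih =>
    rw [List.length_append, List.length_singleton] at hl ⊢
    rw [Sampler.after_append]
    refine (ih (by omega) fun a ha => hr a (by simp [ha])).step ?_ hB e (hr e (by simp))
    omega

theorem Sampler.inRange_after {k D Q B b m : ℕ} (hQ : 1 ≤ Q) (hD : D = 2 ^ b)
    (hm : 2 * m + 2 ≤ D) (hB : k + 1 ≤ B)
    (l : List (Fin k × ℕ × ℕ)) (hl : l.length ≤ m) (hr : ∀ e ∈ l, e.2.2 < D) :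
    (Sampler.after D Q B l).InRange D := by
  have h := Sampler.inv_after (D := D) (Q := Q) (b := b) hQ (by omega) hB l hl hr
  refine ⟨fun i => ?_, h.off_le, ?_⟩
  · have := h.cnt_le i; omega
  · rcases h.level with h | h
    · rw [h]; simp; omega
    · omega

theorem Sampler.cost_after_le {k D Q B b m : ℕ} (hQ : 1 ≤ Q) (hb : 2 * m ≤ 2 ^ b)
    (hB : k + 1 ≤ B) (l : List (Fin k × ℕ × ℕ)) (hl : l.length ≤ m) (hr : ∀ e ∈ l, e.2.2 < D) :
    (Sampler.after D Q B l).cost ≤ (Q + 1) * epochCost k B b := by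
  have h := Sampler.inv_after (Q := Q) (b := b) hQ hb hB l hl hr
  have h1 := h.cost
  have h2 := h.total_le
  have h3 := h.level_le (by omega)
  have h4 : (Sampler.after D Q B l).led.level * (B + 1 + k) ≤ b * (B + 1 + k) :=
    Nat.mul_le_mul_right _ h3
  have h5 : (Sampler.after D Q B l).led.epoch * epochCost k B b ≤ Q * epochCost k B b :=
    Nat.mul_le_mul_right _ h.epoch
  rw [Nat.succ_mul]
  have : epochCost k B b = 1 + k + b * (B + 1 + k) + B := rfl
  omega

end Sampling

/-! ## The sample and the accuracy of the estimate -/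

namespace Sampling

/-- One step of the computation of a running minimum and of the number of its changes. -/
def recordStep (s : ℕ × ℕ) (r : ℕ) : ℕ × ℕ := if r < s.1 then (r, s.2 + 1) else s

/-- The number of occurrences of `x` at site `i`. -/
def occ {k : ℕ} (l : List (Fin k × ℕ × ℕ)) (x : ℕ) (i : Fin k) : ℕ :=
  l.countP fun a => a.1 = i ∧ a.2.1 = x

/-- The tag of the first item at site `i`, or `D` if there is none. -/
def firstTag {k : ℕ} (D : ℕ) (l : List (Fin k × ℕ × ℕ)) (i : Fin k) : ℕ :=
  ((l.find? fun a => a.1 = i).map fun a => a.2.2).getD D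

theorem firstTag_append {k D : ℕ} (l l' : List (Fin k × ℕ × ℕ)) (i : Fin k) :
    firstTag D (l ++ l') i = if ∃ a ∈ l, a.1 = i then firstTag D l i else firstTag D l' i := by
  unfold firstTag
  rw [List.find?_append]
  split_ifs with h
  · obtain ⟨a, ha, hi⟩ := h
    cases hf : l.find? (fun a => a.1 = i) with
    | none => rw [List.find?_eq_none] at hf; exact absurd hi (by simpa using hf a ha)
    | some b => simp
  · have : l.find? (fun a => a.1 = i) = none := by
      rw [List.find?_eq_none]; intro a ha hi; exact h ⟨a, ha, by simpa using hi⟩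
    simp [this]

theorem firstTag_of_not_mem {k D : ℕ} {l : List (Fin k × ℕ × ℕ)} {i : Fin k}
    (h : ¬ ∃ a ∈ l, a.1 = i) : firstTag D l i = D := by
  unfold firstTag
  have : l.find? (fun a => a.1 = i) = none := by
    rw [List.find?_eq_none]; intro a ha hi; exact h ⟨a, ha, by simpa using hi⟩
  simp [this]

theorem firstTag_lt {k D : ℕ} {l : List (Fin k × ℕ × ℕ)} {i : Fin k}
    (hr : ∀ a ∈ l, a.2.2 < D) (h : ∃ a ∈ l, a.1 = i) : firstTag D l i < D := by
  unfold firstTag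
  cases hf : l.find? (fun a => a.1 = i) with
  | none =>
    obtain ⟨a, ha, hi⟩ := h
    rw [List.find?_eq_none] at hf; exact absurd hi (by simpa using hf a ha)
  | some b => exact hr b (List.mem_of_find?_eq_some hf)

theorem Sampler.step_off {k D Q B : ℕ} (s : Sampler k) (e : Fin k × ℕ × ℕ) :
    (s.step D Q B e).off = s.draw D e.1 e.2.2 := by
  simp only [Sampler.step]; split_ifs <;> rfl

theorem Sampler.off_after {k D Q B : ℕ} (l : List (Fin k × ℕ × ℕ)) (hr : ∀ e ∈ l, e.2.2 < D)
    (i : Fin k) : (Sampler.after D Q B l).off i = firstTag D l i := by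
  induction l using List.reverseRecOn with
  | nil => rfl
  | append_singleton l e ih =>
    have hr' : ∀ a ∈ l, a.2.2 < D := fun a ha => hr a (by simp [ha])
    specialize ih hr'
    rw [Sampler.after_append, Sampler.step_off, firstTag_append, Sampler.draw]
    by_cases c : i = e.1
    · subst c
      rw [Function.update_self, ih]
      split_ifs with h
      · have := firstTag_lt hr' h
        rw [newOff, if_neg (by omega)]
      · rw [newOff, if_pos (firstTag_of_not_mem h)]
        simp [firstTag]
    · rw [Function.update_of_ne c, ih]
      split_ifs with h
      · rfl
      · rw [firstTag_of_not_mem h, firstTag_of_not_mem]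
        simpa using fun h => c h.symm

/-- `l₁ ++ e :: l₂` is a decomposition of a list at its first item with minimal tag. -/
structure IsSample {k : ℕ} (l l₁ : List (Fin k × ℕ × ℕ)) (e : Fin k × ℕ × ℕ)
    (l₂ : List (Fin k × ℕ × ℕ)) : Prop where
  eq : l = l₁ ++ e :: l₂
  before : ∀ a ∈ l₁, e.2.2 < a.2.2
  after : ∀ a ∈ l₂, e.2.2 ≤ a.2.2

/-- The deviation of the estimate at granularity `T` with offsets `u` from the number of occurrences
of `x`. -/
noncomputable def deviation {k : ℕ} (T : ℕ) (l : List (Fin k × ℕ × ℕ)) (x : ℕ) (u : Fin k → ℕ) :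
    ℝ :=
  ∑ i, ((T : ℝ) * crossings T (occ l x i) (u i) - occ l x i)

/-- All estimates with the offsets determined by `l` have deviations at most `E` times the
granularity. -/
def Accurate {k : ℕ} (D b : ℕ) (E : ℝ) (l : List (Fin k × ℕ × ℕ)) : Prop :=
  ∀ l₁ e l₂ l₃, l = l₁ ++ e :: (l₂ ++ l₃) → ∀ v ≤ b,
    |deviation (2 ^ v) l₂ e.2.1 (firstTag D l)| ≤ E * (2 ^ v : ℕ)

theorem deviation_congr {k T x : ℕ} {l : List (Fin k × ℕ × ℕ)} {u u' : Fin k → ℕ}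
    (h : ∀ i, occ l x i ≠ 0 → u i = u' i) : deviation T l x u = deviation T l x u' := by
  refine Finset.sum_congr rfl fun i _ => ?_
  by_cases c : occ l x i = 0
  · simp [c, crossings_zero]
  · rw [h i c]

theorem exists_of_occ_ne_zero {k x : ℕ} {l : List (Fin k × ℕ × ℕ)} {i : Fin k}
    (h : occ l x i ≠ 0) : ∃ a ∈ l, a.1 = i := by
  have := List.countP_pos_iff.1 (Nat.pos_of_ne_zero h)
  obtain ⟨a, ha, hi⟩ := this
  exact ⟨a, ha, by simp at hi; exact hi.1⟩

theorem Accurate.of_append {k D b : ℕ} {E : ℝ} {l l' : List (Fin k × ℕ × ℕ)}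
    (h : Accurate D b E (l ++ l')) : Accurate D b E l := by
  intro l₁ e l₂ l₃ hl v hv
  rw [deviation_congr (u' := firstTag D (l ++ l'))]
  · exact h l₁ e l₂ (l₃ ++ l') (by rw [hl]; simp) v hv
  · intro i hi
    obtain ⟨a, ha, hai⟩ := exists_of_occ_ne_zero hi
    rw [firstTag_append, if_pos ⟨a, by rw [hl]; simp [ha], hai⟩]

theorem sum_occ {k x : ℕ} (l : List (Fin k × ℕ × ℕ)) :
    ∑ i, occ l x i = l.countP fun a => a.2.1 = x := by
  induction l with
  | nil => simp [occ]
  | cons a l ih =>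
    simp only [occ, List.countP_cons] at ih ⊢
    rw [Finset.sum_add_distrib, ih]
    congr 1
    by_cases c : a.2.1 = x <;> simp [c]

theorem occ_append_singleton {k x : ℕ} (l : List (Fin k × ℕ × ℕ)) (e : Fin k × ℕ × ℕ) (i : Fin k) :
    occ (l ++ [e]) x i = occ l x i + if e.1 = i ∧ e.2.1 = x then 1 else 0 := by
  simp [occ, List.countP_append, List.countP_cons]

/-- The state of a sampler that has not been stopped. -/
structure Sampler.Tracks {k : ℕ} (E ε : ℝ) (s : Sampler k)
    (l l₁ : List (Fin k × ℕ × ℕ)) (e : Fin k × ℕ × ℕ) (l₂ : List (Fin k × ℕ × ℕ)) : Prop where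
  sample : IsSample l l₁ e l₂
  thr : s.thr = e.2.2
  elt : s.elt = e.2.1
  cnt : ∀ i, s.cnt i = occ l₂ e.2.1 i
  level : s.led.level = 0 ∨ E * (2 ^ s.led.level : ℕ) ≤ ε * ∑ i, (s.cnt i : ℝ)

/-- The deviation in terms of the state of the sampler. -/
theorem Sampler.Tracks.total {k D Q B b len : ℕ} {E ε : ℝ} {s : Sampler k}
    {l l₁ l₂ : List (Fin k × ℕ × ℕ)} {e : Fin k × ℕ × ℕ} (h : s.Tracks E ε l l₁ e l₂)
    (hinv : s.Inv D Q B b len) (hoff : ∀ i, s.off i = firstTag D l i)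
    (hb : 2 * len ≤ 2 ^ b) (hacc : Accurate D b E l) :
    |(2 ^ s.led.level : ℕ) * (s.led.total : ℝ) - ∑ i, (s.cnt i : ℝ)| ≤
      E * (2 ^ s.led.level : ℕ) := by
  have := hacc l₁ e l₂ [] (by simpa using h.sample.eq) _ (hinv.level_le hb)
  convert this using 2
  rw [hinv.total_eq, deviation]
  push_cast
  rw [Finset.mul_sum, ← Finset.sum_sub_distrib]
  exact Finset.sum_congr rfl fun i _ => by rw [h.cnt, hoff]

theorem Sampler.tracks_after {k D Q B b m : ℕ} {E ε : ℝ} (hQ : 1 ≤ Q) (hb : 2 * m ≤ 2 ^ b)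
    (hB : k + 1 ≤ B) (hε : 0 < ε) (hBE : E * (1 + 2 / ε) ≤ B)
    (l : List (Fin k × ℕ × ℕ)) (hl : l.length ≤ m) (hr : ∀ e ∈ l, e.2.2 < D)
    (hacc : Accurate D b E l) (hrec : ((l.map fun a => a.2.2).foldl recordStep (D, 0)).2 < Q) :
    (l.map fun a => a.2.2).foldl recordStep (D, 0) =
      ((Sampler.after D Q B l).thr, (Sampler.after D Q B l).led.epoch) ∧
    (l ≠ [] → ∃ l₁ e l₂, (Sampler.after D Q B l).Tracks E ε l l₁ e l₂) := by
  induction l using List.reverseRecOn with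
  | nil => exact ⟨rfl, fun h => absurd rfl h⟩
  | append_singleton l e ih =>
    have hr' : ∀ a ∈ l, a.2.2 < D := fun a ha => hr a (by simp [ha])
    have hre : e.2.2 < D := hr e (by simp)
    rw [List.length_append, List.length_singleton] at hl
    have hfold : ((l ++ [e]).map fun a => a.2.2).foldl recordStep (D, 0) =
        recordStep ((l.map fun a => a.2.2).foldl recordStep (D, 0)) e.2.2 := by simp
    rw [hfold] at hrec ⊢
    have hrec' : ((l.map fun a => a.2.2).foldl recordStep (D, 0)).2 < Q := by
      refine lt_of_le_of_lt ?_ hrec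
      unfold recordStep; split_ifs <;> simp
    obtain ⟨i1, i2⟩ := ih (by omega) hr' hacc.of_append hrec'
    have hinv := Sampler.inv_after (D := D) (Q := Q) (b := b) hQ hb hB l (by omega) hr'
    have hinv' := Sampler.inv_after (D := D) (Q := Q) (b := b) hQ hb hB (l ++ [e])
      (by simpa using hl) hr
    have hoff' := Sampler.off_after (Q := Q) (B := B) (l ++ [e]) hr
    rw [i1] at hrec ⊢
    rw [Sampler.after_append] at hinv' hoff' ⊢
    obtain ⟨hdr, hdro⟩ := hinv.drawn e.1 hre
    have hlD : l = [] → (Sampler.after D Q B l).thr = D := by rintro rfl; rfl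
    generalize hs : Sampler.after D Q B l = s at *
    have hoffd : (s.step D Q B e).off = (s.drawn D e.1 e.2.2).off := Sampler.step_off s e
    rw [Sampler.step_eq] at hinv' hoff' hoffd ⊢
    by_cases c1 : e.2.2 < s.thr
    · simp only [recordStep, c1, if_true] at hrec ⊢
      refine ⟨?_, fun _ => ⟨l, e, [], ⟨⟨rfl, ?_, by simp⟩, ?_, rfl, ?_, Or.inl rfl⟩⟩⟩
      · simp [Sampler.restart, Ledger.fresh, Sampler.drawn, hrec]
      · intro a ha
        have hne : l ≠ [] := List.ne_nil_of_mem ha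
        obtain ⟨l₁, e', l₂, h⟩ := i2 hne
        have := h.thr
        have hle : e'.2.2 ≤ a.2.2 := by
          rw [h.sample.eq, List.mem_append, List.mem_cons] at ha
          rcases ha with ha | rfl | ha
          · exact (h.sample.before a ha).le
          · exact le_rfl
          · exact h.sample.after a ha
        omega
      · simp [Sampler.restart, Sampler.drawn, hrec]
      · intro i; simp [Sampler.restart, occ]
    · simp only [c1, if_false] at hinv' hoff' hoffd ⊢
      have hne : l ≠ [] := fun h => c1 (by rw [hlD h]; exact hre)
      obtain ⟨l₁, e', l₂, h⟩ := i2 hne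
      have hsample : IsSample (l ++ [e]) l₁ e' (l₂ ++ [e]) := by
        refine ⟨by rw [h.sample.eq]; simp, h.sample.before, ?_⟩
        intro a ha
        rw [List.mem_append, List.mem_singleton] at ha
        rcases ha with ha | rfl
        · exact h.sample.after a ha
        · rw [← h.thr]; omega
      have hrs : recordStep (s.thr, s.led.epoch) e.2.2 = (s.thr, s.led.epoch) := by
        simp [recordStep, c1]
      rw [hrs]
      by_cases c2 : s.elt = e.2.1
      swap
      · simp only [c2, if_false]
        refine ⟨rfl, fun _ => ⟨l₁, e', l₂ ++ [e], hsample, h.thr, h.elt, ?_, h.level⟩⟩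
        intro i
        rw [occ_append_singleton, if_neg, add_zero]
        · exact h.cnt i
        · rw [← h.elt]; exact fun h => c2 h.2.symm
      simp only [c2, if_true] at hinv' hoff' hoffd ⊢
      have hcnt : ∀ i, Function.update s.cnt e.1 (s.cnt e.1 + 1) i = occ (l₂ ++ [e]) e'.2.1 i := by
        intro i
        rw [occ_append_singleton, ← h.cnt, ← h.elt]
        by_cases c : i = e.1
        · subst c; simp [c2]
        · have c' : ¬ e.1 = i := fun h => c h.symm
          simp [c, c']
      have hmono : ∀ i, (s.cnt i : ℝ) ≤ (Function.update s.cnt e.1 (s.cnt e.1 + 1) i : ℕ) := by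
        intro i
        by_cases c : i = e.1
        · subst c; simp
        · simp [c]
      have hlevel : s.led.level = 0 ∨ E * (2 ^ s.led.level : ℕ) ≤
          ε * ∑ i, ((Function.update s.cnt e.1 (s.cnt e.1 + 1) i : ℕ) : ℝ) := by
        refine h.level.imp id fun h => h.trans ?_
        exact mul_le_mul_of_nonneg_left (Finset.sum_le_sum fun i _ => hmono i) hε.le
      by_cases c3 : (s.cnt e.1 + 1 + (s.drawn D e.1 e.2.2).off e.1) % 2 ^ s.led.level = 0
      swap
      · simp only [c3, if_false]
        exact ⟨rfl, fun _ => ⟨l₁, e', l₂ ++ [e], hsample, h.thr, h.elt, hcnt, hlevel⟩⟩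
      simp only [c3, if_true] at hinv' hoff' hoffd ⊢
      by_cases c4 : B < ((s.drawn D e.1 e.2.2).report e.1).led.total
      swap
      · simp only [c4, if_false]
        exact ⟨rfl, fun _ => ⟨l₁, e', l₂ ++ [e], hsample, h.thr, h.elt, hcnt, hlevel⟩⟩
      simp only [c4, if_true] at hinv' hoff' hoffd ⊢
      refine ⟨rfl, fun _ => ⟨l₁, e', l₂ ++ [e], hsample, h.thr, h.elt, hcnt, Or.inr ?_⟩⟩
      -- the state before the granularity is doubled
      have ht : ((s.drawn D e.1 e.2.2).report e.1).Tracks E ε (l ++ [e]) l₁ e' (l₂ ++ [e]) :=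
        ⟨hsample, h.thr, h.elt, hcnt, hlevel⟩
      have htinv := (hdr.report (i := e.1) hdro c3).1
      have hdev := ht.total htinv hoff' (by omega) hacc
      change E * ((2 ^ (s.led.level + 1) : ℕ) : ℝ) ≤
        ε * ∑ i, ((((s.drawn D e.1 e.2.2).report e.1).cnt i : ℕ) : ℝ)
      have hlev : ((s.drawn D e.1 e.2.2).report e.1).led.level = s.led.level := rfl
      rw [hlev] at hdev
      generalize (s.drawn D e.1 e.2.2).report e.1 = t at *
      generalize ∑ i, (t.cnt i : ℝ) = C at *
      have hT : (0 : ℝ) < (2 ^ s.led.level : ℕ) := by positivity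
      have hp : ((2 ^ (s.led.level + 1) : ℕ) : ℝ) = 2 * (2 ^ s.led.level : ℕ) := by
        push_cast; ring
      rw [hp]
      generalize ((2 ^ s.led.level : ℕ) : ℝ) = T at *
      have h1 : (B : ℝ) ≤ t.led.total := by exact_mod_cast c4.le
      have h2 := (abs_le.1 hdev).2
      have h3 : E * (1 + 2 / ε) * T ≤ T * t.led.total := by
        rw [mul_comm T]; exact mul_le_mul_of_nonneg_right (hBE.trans h1) hT.le
      have h4 : E * 2 / ε * T ≤ C := by
        have : E * (1 + 2 / ε) * T = E * T + E * 2 / ε * T := by ring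
        linarith
      calc E * (2 * T) = ε * (E * 2 / ε * T) := by field_simp
        _ ≤ ε * C := mul_le_mul_of_nonneg_left h4 hε.le

/-- If the sampler is not stopped and the offsets are good, it holds the first item with minimal tag
and a good approximation of its tail frequency. -/
theorem Sampler.exists_sample {k D Q B b m : ℕ} {E ε : ℝ} (hQ : 1 ≤ Q) (hb : 2 * m ≤ 2 ^ b)
    (hB : k + 1 ≤ B) (hε : 0 < ε) (hBE : E * (1 + 2 / ε) ≤ B)
    (l : List (Fin k × ℕ × ℕ)) (hl : l.length ≤ m) (hr : ∀ e ∈ l, e.2.2 < D)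
    (hacc : Accurate D b E l) (hrec : ((l.map fun a => a.2.2).foldl recordStep (D, 0)).2 < Q)
    (hne : l ≠ []) :
    ∃ l₁ e l₂, IsSample l l₁ e l₂ ∧
      |((Sampler.after D Q B l).led.estimate : ℝ) - (1 + l₂.countP fun a => a.2.1 = e.2.1 : ℕ)| ≤
        ε * (1 + l₂.countP fun a => a.2.1 = e.2.1 : ℕ) := by
  obtain ⟨l₁, e, l₂, h⟩ :=
    (Sampler.tracks_after hQ hb hB hε hBE l hl hr hacc hrec).2 hne
  have hinv := Sampler.inv_after (D := D) (Q := Q) (b := b) hQ hb hB l hl hr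
  have hdev := h.total hinv (Sampler.off_after l hr) (by omega) hacc
  refine ⟨l₁, e, l₂, h.sample, ?_⟩
  have hsum : ∑ i, ((Sampler.after D Q B l).cnt i : ℝ) = (l₂.countP fun a => a.2.1 = e.2.1 : ℕ) := by
    rw [← sum_occ, Nat.cast_sum]
    exact Finset.sum_congr rfl fun i _ => by rw [h.cnt]
  have hlev := h.level
  have htot := hinv.total_eq
  rw [hsum] at hdev hlev
  have e1 : ((Sampler.after D Q B l).led.estimate : ℝ) -
      (1 + l₂.countP fun a => a.2.1 = e.2.1 : ℕ) =
      (2 ^ (Sampler.after D Q B l).led.level : ℕ) * ((Sampler.after D Q B l).led.total : ℝ) -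
        (l₂.countP fun a => a.2.1 = e.2.1 : ℕ) := by
    simp only [Ledger.estimate]; push_cast; ring
  rw [e1]
  have hC : (0 : ℝ) ≤ (l₂.countP fun a => a.2.1 = e.2.1 : ℕ) := Nat.cast_nonneg _
  rcases hlev with h0 | h0
  · have : ((Sampler.after D Q B l).led.total : ℝ) = (l₂.countP fun a => a.2.1 = e.2.1 : ℕ) := by
      rw [htot, ← hsum, h0]; simp [crossings_one]
    rw [this, h0]
    simp
    positivity
  · refine hdev.trans (h0.trans ?_)
    push_cast
    nlinarith

end Sampling

/-! ## Counting -/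

namespace Sampling

theorem card_mul_le_sum {α : Type*} [Fintype α] (p : α → Prop) [DecidablePred p] (Z : α → ℝ)
    (c : ℝ) (hZ : ∀ a, 0 ≤ Z a) (h : ∀ a, p a → c ≤ Z a) :
    ((Finset.univ.filter p).card : ℝ) * c ≤ ∑ a, Z a := by
  calc ((Finset.univ.filter p).card : ℝ) * c = ∑ a ∈ Finset.univ.filter p, c := by simp
    _ ≤ ∑ a ∈ Finset.univ.filter p, Z a := Finset.sum_le_sum fun a ha => h a (by simpa using ha)
    _ ≤ ∑ a, Z a := Finset.sum_le_sum_of_subset_of_nonneg (Finset.filter_subset _ _)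
        fun a _ _ => hZ a

theorem sum_range_cast_le (v : ℕ) : ∑ x ∈ Finset.range v, (x : ℝ) ≤ (v : ℝ) ^ 2 / 2 := by
  induction v with
  | zero => simp
  | succ v ih => rw [Finset.sum_range_succ]; push_cast; nlinarith

/-- The exponential moment of the number of records in a sequence of random tags. -/
theorem sum_two_pow_records {D : ℕ} (hD : 0 < D) (t : ℕ) (v c : ℕ) (hv : v ≤ D) :
    ∑ u : Fin t → Fin D, (2 : ℝ) ^ ((List.ofFn fun i => (u i).val).foldl recordStep (v, c)).2 ≤
      2 ^ c * D ^ t * (1 + t * v / D) := by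
  have hD' : (0 : ℝ) < D := by exact_mod_cast hD
  induction t generalizing v c with
  | zero => simp
  | succ t ih =>
    rw [← Fintype.sum_equiv (Fin.consEquiv fun _ => Fin D) _ _ (fun _ => rfl),
      Fintype.sum_prod_type]
    have key : ∀ x : Fin D,
        ∑ u : Fin t → Fin D, (2 : ℝ) ^ ((List.ofFn fun i =>
          (Fin.consEquiv (fun _ => Fin D) (x, u) i).val).foldl recordStep (v, c)).2 ≤
        2 ^ c * D ^ t * (if x.val < v then 2 * (1 + (t : ℝ) * x.val / D) else 1 + t * v / D) := by
      intro x
      have e : ∀ u : Fin t → Fin D, (List.ofFn fun i =>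
          (Fin.consEquiv (fun _ => Fin D) (x, u) i).val) =
          x.val :: List.ofFn fun i => (u i).val := by
        intro u
        rw [List.ofFn_succ]; simp [Fin.consEquiv]
      simp only [e, List.foldl_cons, recordStep]
      split_ifs with h
      · refine (ih _ _ x.isLt.le).trans (le_of_eq ?_)
        rw [pow_succ]; ring
      · exact ih _ _ hv
    refine (Finset.sum_le_sum fun x _ => key x).trans ?_
    rw [← Finset.mul_sum, Fin.sum_univ_eq_sum_range
      (fun x => if x < v then 2 * (1 + (t : ℝ) * x / D) else 1 + t * v / D)]
    have hsum : ∑ x ∈ Finset.range D, (if x < v then 2 * (1 + (t : ℝ) * x / D)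
        else 1 + t * v / D) ≤ D + (t + 1) * v := by
      rw [← Finset.sum_range_add_sum_Ico _ hv]
      have h1 : ∑ x ∈ Finset.range v, (if x < v then 2 * (1 + (t : ℝ) * x / D)
          else 1 + t * v / D) = 2 * v + 2 * t / D * ∑ x ∈ Finset.range v, (x : ℝ) := by
        rw [Finset.mul_sum, Finset.sum_congr rfl fun x hx => if_pos (Finset.mem_range.1 hx)]
        simp only [mul_add, mul_one, Finset.sum_add_distrib, Finset.sum_const, Finset.card_range,
          nsmul_eq_mul]
        congr 1
        · ring
        · exact Finset.sum_congr rfl fun x _ => by ring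
      have h2 : ∑ x ∈ Finset.Ico v D, (if x < v then 2 * (1 + (t : ℝ) * x / D)
          else 1 + t * v / D) = (D - v) * (1 + t * v / D) := by
        rw [Finset.sum_congr rfl fun x hx => if_neg (not_lt.2 (Finset.mem_Ico.1 hx).1)]
        simp [Nat.cast_sub hv]
        ring
      rw [h1, h2]
      have h3 := mul_le_mul_of_nonneg_left (sum_range_cast_le v)
        (show (0 : ℝ) ≤ 2 * t / D by positivity)
      have h4 : 2 * (v : ℝ) + 2 * t / D * ((v : ℝ) ^ 2 / 2) + (D - v) * (1 + t * v / D) =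
          D + (t + 1) * v := by field_simp; ring
      linarith
    refine (mul_le_mul_of_nonneg_left hsum (by positivity)).trans (le_of_eq ?_)
    push_cast
    field_simp
    ring

theorem card_records_le {D : ℕ} (hD : 0 < D) (t Q : ℕ) :
    ((Finset.univ.filter fun u : Fin t → Fin D =>
      Q ≤ ((List.ofFn fun i => (u i).val).foldl recordStep (D, 0)).2).card : ℝ) * 2 ^ Q ≤
      (t + 1) * D ^ t := by
  have hD' : (0 : ℝ) < D := by exact_mod_cast hD
  refine (card_mul_le_sum _ (fun u : Fin t → Fin D =>
    (2 : ℝ) ^ ((List.ofFn fun i => (u i).val).foldl recordStep (D, 0)).2) _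
    (fun u => by positivity) fun u hu => pow_le_pow_right₀ (by norm_num) hu).trans ?_
  refine (sum_two_pow_records hD t D 0 le_rfl).trans (le_of_eq ?_)
  field_simp; ring

/-- The position `τ` is the first position with minimal tag. -/
def IsFirstMin {t D : ℕ} (u : Fin t → Fin D) (τ : Fin t) : Prop :=
  (∀ σ < τ, u τ < u σ) ∧ ∀ σ, τ < σ → u τ ≤ u σ

theorem exists_isFirstMin {t D : ℕ} (ht : 0 < t) (u : Fin t → Fin D) : ∃ τ, IsFirstMin u τ := by
  have : Nonempty (Fin t) := ⟨⟨0, ht⟩⟩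
  obtain ⟨τ, -, h⟩ := Finset.exists_min_image Finset.univ (fun τ => toLex (u τ, τ))
    Finset.univ_nonempty
  refine ⟨τ, fun σ hσ => ?_, fun σ _ => ?_⟩
  · have := h σ (Finset.mem_univ _)
    rw [Prod.Lex.toLex_le_toLex] at this
    rcases this with h1 | ⟨-, h2⟩
    · exact h1
    · exact absurd hσ (not_lt.2 h2)
  · have := h σ (Finset.mem_univ _)
    rw [Prod.Lex.toLex_le_toLex] at this
    rcases this with h1 | ⟨h1, -⟩
    · exact h1.le
    · exact h1.le

theorem IsFirstMin.unique {t D : ℕ} {u : Fin t → Fin D} {τ τ' : Fin t} (h : IsFirstMin u τ)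
    (h' : IsFirstMin u τ') : τ = τ' := by
  rcases lt_trichotomy τ τ' with c | c | c
  · exact absurd (h'.1 _ c) (not_lt.2 (h.2 _ c))
  · exact c
  · exact absurd (h.1 _ c) (not_lt.2 (h'.2 _ c))

theorem card_filter_forall_ne {t D : ℕ} (P : Fin D → Fin D → Prop) [DecidableRel P]
    (τ : Fin (t + 1)) [DecidablePred fun u : Fin (t + 1) → Fin D => ∀ σ, σ ≠ τ → P (u τ) (u σ)] :
    (Finset.univ.filter fun u : Fin (t + 1) → Fin D => ∀ σ, σ ≠ τ → P (u τ) (u σ)).card =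
      ∑ x : Fin D, (Finset.univ.filter (P x)).card ^ t := by
  classical
  have e : ∀ x : Fin D, (Finset.univ.filter (P x)).card ^ t =
      (Finset.univ.filter fun v : Fin t → Fin D => ∀ i, P x (v i)).card := by
    intro x
    have := Fintype.card_piFinset (fun _ : Fin t => Finset.univ.filter (P x))
    rw [Finset.prod_const, Finset.card_univ, Fintype.card_fin] at this
    rw [← this]
    congr 1
    ext v; simp [Fintype.mem_piFinset]
  simp only [e]
  rw [← Finset.card_sigma]
  refine Finset.card_bij' (fun u _ => ⟨u τ, fun i => u (τ.succAbove i)⟩)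
    (fun p _ => Fin.insertNth τ p.1 p.2) ?_ ?_ ?_ ?_
  · intro u hu
    simp only [Finset.mem_filter, Finset.mem_univ, true_and, Finset.mem_sigma] at hu ⊢
    exact fun i => hu _ (Fin.succAbove_ne τ i)
  · intro p hp
    simp only [Finset.mem_filter, Finset.mem_univ, true_and, Finset.mem_sigma] at hp ⊢
    intro σ hσ
    obtain ⟨i, rfl⟩ := Fin.exists_succAbove_eq hσ
    simpa using hp i
  · intro u _
    exact Fin.insertNth_self_removeNth τ u
  · intro p _
    simp

theorem card_fin_filter_le {D : ℕ} (x : Fin D) :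
    (Finset.univ.filter fun y : Fin D => x ≤ y).card = D - x.val := by
  rw [show (Finset.univ.filter fun y : Fin D => x ≤ y) = Finset.Ici x by ext; simp]
  simp

theorem card_fin_filter_lt {D : ℕ} (x : Fin D) :
    (Finset.univ.filter fun y : Fin D => x < y).card = D - 1 - x.val := by
  rw [show (Finset.univ.filter fun y : Fin D => x < y) = Finset.Ioi x by ext; simp]
  simp

theorem pow_succ_sub_bounds (t : ℕ) (y : ℝ) (hy : 0 ≤ y) :
    (t + 1) * y ^ t ≤ (y + 1) ^ (t + 1) - y ^ (t + 1) ∧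
      (y + 1) ^ (t + 1) - y ^ (t + 1) ≤ (t + 1) * (y + 1) ^ t := by
  induction t with
  | zero => norm_num
  | succ t ih =>
    obtain ⟨h1, h2⟩ := ih
    have h3 : y ^ t ≤ (y + 1) ^ t := pow_le_pow_left₀ hy (by linarith) t
    have h4 : 0 ≤ y ^ t := by positivity
    have h5 : y ^ (t + 1) ≤ (y + 1) ^ (t + 1) := pow_le_pow_left₀ hy (by linarith) _
    push_cast
    constructor
    · have : (t + 1) * y ^ t * y ≤ ((y + 1) ^ (t + 1) - y ^ (t + 1)) * y :=
        mul_le_mul_of_nonneg_right h1 hy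
      calc ((t : ℝ) + 1 + 1) * y ^ (t + 1) = (t + 1) * y ^ t * y + y ^ (t + 1) := by ring
        _ ≤ ((y + 1) ^ (t + 1) - y ^ (t + 1)) * y + (y + 1) ^ (t + 1) := by linarith
        _ = _ := by ring
    · have : ((y + 1) ^ (t + 1) - y ^ (t + 1)) * (y + 1) ≤ (t + 1) * (y + 1) ^ t * (y + 1) :=
        mul_le_mul_of_nonneg_right h2 (by linarith)
      calc (y + 1) ^ (t + 1 + 1) - y ^ (t + 1 + 1)
          = ((y + 1) ^ (t + 1) - y ^ (t + 1)) * (y + 1) + y ^ (t + 1) := by ring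
        _ ≤ (t + 1) * (y + 1) ^ t * (y + 1) + (y + 1) ^ (t + 1) := by linarith
        _ = _ := by ring

theorem sum_pow_bounds (t D : ℕ) :
    (t + 1) * ∑ y ∈ Finset.range D, (y : ℝ) ^ t ≤ (D : ℝ) ^ (t + 1) ∧
      (D : ℝ) ^ (t + 1) ≤ (t + 1) * ∑ y ∈ Finset.range D, ((y : ℝ) + 1) ^ t := by
  have tele : ∑ y ∈ Finset.range D, (((y : ℝ) + 1) ^ (t + 1) - (y : ℝ) ^ (t + 1)) =
      (D : ℝ) ^ (t + 1) := by
    have := Finset.sum_range_sub (fun y : ℕ => (y : ℝ) ^ (t + 1)) D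
    simpa using this
  rw [← tele, Finset.mul_sum, Finset.mul_sum]
  exact ⟨Finset.sum_le_sum fun y _ => (pow_succ_sub_bounds t y (Nat.cast_nonneg _)).1,
    Finset.sum_le_sum fun y _ => (pow_succ_sub_bounds t y (Nat.cast_nonneg _)).2⟩

open Classical in
/-- The position of the first minimal tag is almost uniform. -/
theorem card_isFirstMin_bounds {t D : ℕ} (hD : 0 < D) (τ : Fin t) :
    t * ((Finset.univ.filter fun u : Fin t → Fin D => IsFirstMin u τ).card : ℝ) ≤
      D ^ t * (1 + t / D) ∧
    (D : ℝ) ^ t * (1 - t / D) ≤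
      t * ((Finset.univ.filter fun u : Fin t → Fin D => IsFirstMin u τ).card : ℝ) := by
  have hD' : (0 : ℝ) < D := by exact_mod_cast hD
  obtain ⟨s, rfl⟩ : ∃ s, t = s + 1 := ⟨t - 1, by have := τ.isLt; omega⟩
  have up : ∑ x : Fin D, (D - x.val) ^ s = ∑ y ∈ Finset.range D, (y + 1) ^ s := by
    rw [Fin.sum_univ_eq_sum_range (fun x => (D - x) ^ s), ← Finset.sum_range_reflect]
    refine Finset.sum_congr rfl fun y hy => ?_
    rw [Finset.mem_range] at hy
    congr 1; omega
  have low : ∑ x : Fin D, (D - 1 - x.val) ^ s = ∑ y ∈ Finset.range D, y ^ s := by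
    rw [Fin.sum_univ_eq_sum_range (fun x => (D - 1 - x) ^ s), ← Finset.sum_range_reflect]
    refine Finset.sum_congr rfl fun y hy => ?_
    rw [Finset.mem_range] at hy
    congr 1; omega
  have diff : ∑ y ∈ Finset.range D, ((y : ℝ) + 1) ^ s ≤
      ∑ y ∈ Finset.range D, (y : ℝ) ^ s + (D : ℝ) ^ s := by
    have := Finset.sum_range_sub (fun y : ℕ => (y : ℝ) ^ s) D
    rw [Finset.sum_sub_distrib] at this
    push_cast at this
    have h0 : (0 : ℝ) ≤ 0 ^ s := by positivity
    linarith
  have h1 : (Finset.univ.filter fun u : Fin (s + 1) → Fin D => IsFirstMin u τ).card ≤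
      ∑ y ∈ Finset.range D, (y + 1) ^ s := by
    simp only [← up, ← card_fin_filter_le]
    rw [← card_filter_forall_ne (fun x y : Fin D => x ≤ y) τ]
    refine Finset.card_le_card fun u hu => ?_
    simp only [Finset.mem_filter, Finset.mem_univ, true_and] at hu ⊢
    intro σ hσ
    rcases lt_or_gt_of_ne hσ with c | c
    · exact (hu.1 _ c).le
    · exact hu.2 _ c
  have h2 : ∑ y ∈ Finset.range D, y ^ s ≤
      (Finset.univ.filter fun u : Fin (s + 1) → Fin D => IsFirstMin u τ).card := by
    simp only [← low, ← card_fin_filter_lt]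
    rw [← card_filter_forall_ne (fun x y : Fin D => x < y) τ]
    refine Finset.card_le_card fun u hu => ?_
    simp only [Finset.mem_filter, Finset.mem_univ, true_and] at hu ⊢
    exact ⟨fun σ hσ => hu σ hσ.ne, fun σ hσ => (hu σ hσ.ne').le⟩
  have h1' : ((Finset.univ.filter fun u : Fin (s + 1) → Fin D => IsFirstMin u τ).card : ℝ) ≤
      ∑ y ∈ Finset.range D, ((y : ℝ) + 1) ^ s := by exact_mod_cast h1
  have h2' : ∑ y ∈ Finset.range D, (y : ℝ) ^ s ≤
      ((Finset.univ.filter fun u : Fin (s + 1) → Fin D => IsFirstMin u τ).card : ℝ) := by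
    exact_mod_cast h2
  obtain ⟨b1, b2⟩ := sum_pow_bounds s D
  have e : (D : ℝ) ^ (s + 1) * (((s + 1 : ℕ) : ℝ) / D) = (s + 1) * (D : ℝ) ^ s := by
    rw [pow_succ]; push_cast; field_simp
  have hs : (0 : ℝ) ≤ (s : ℝ) + 1 := by positivity
  rw [mul_add, mul_sub, e]
  push_cast
  constructor
  · have := mul_le_mul_of_nonneg_left (h1'.trans diff) hs
    linarith
  · have := mul_le_mul_of_nonneg_left h2' hs
    have := mul_le_mul_of_nonneg_left diff hs
    linarith

theorem exp_le_quadratic {y : ℝ} (h : |y| ≤ 1) : Real.exp y ≤ 1 + y + y ^ 2 := by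
  have := (abs_le.1 (Real.abs_exp_sub_one_sub_id_le h)).2
  linarith

/-- A Hoeffding bound: at most `k` of the coordinates contribute. -/
theorem card_sum_gt_le {t D k : ℕ} (hk : 0 < k) (h : Fin t → Fin D → ℝ) (I : Finset (Fin t))
    (hI : I.card ≤ k) (T E : ℝ) (hT : 0 < T) (hE : 0 ≤ E) (hmean : ∀ τ ∈ I, ∑ x, h τ x = 0)
    (hbound : ∀ τ ∈ I, ∀ x, |h τ x| ≤ T)
    [DecidablePred fun v : Fin t → Fin D => E * T < ∑ τ ∈ I, h τ (v τ)] :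
    ((Finset.univ.filter fun v : Fin t → Fin D => E * T < ∑ τ ∈ I, h τ (v τ)).card : ℝ) ≤
      D ^ t * Real.exp (-(E ^ 2 / (4 * k))) := by
  have hk' : (0 : ℝ) < k := by exact_mod_cast hk
  by_cases hEk : (k : ℝ) ≤ E
  · have : (Finset.univ.filter fun v : Fin t → Fin D => E * T < ∑ τ ∈ I, h τ (v τ)) = ∅ := by
      rw [Finset.filter_eq_empty_iff]
      intro v _
      rw [not_lt]
      calc ∑ τ ∈ I, h τ (v τ) ≤ ∑ τ ∈ I, T :=
            Finset.sum_le_sum fun τ hτ => (abs_le.1 (hbound τ hτ _)).2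
        _ = I.card * T := by simp
        _ ≤ k * T := by gcongr
        _ ≤ E * T := by gcongr
    rw [this]
    simp only [Finset.card_empty, Nat.cast_zero]
    positivity
  push Not at hEk
  set s : ℝ := E / (2 * k * T) with hs
  have hsT : s * T = E / (2 * k) := by rw [hs]; field_simp
  have hs0 : 0 ≤ s := by positivity
  have hsT1 : s * T ≤ 1 := by
    rw [hsT, div_le_one (by positivity)]; linarith
  have mgf : ∀ τ, ∑ x : Fin D, Real.exp (if τ ∈ I then s * h τ x else 0) ≤
      D * (if τ ∈ I then Real.exp ((s * T) ^ 2) else 1) := by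
    intro τ
    by_cases hτ : τ ∈ I
    · simp only [hτ, if_true]
      have hb : ∀ x, |s * h τ x| ≤ s * T := fun x => by
        rw [abs_mul, abs_of_nonneg hs0]
        exact mul_le_mul_of_nonneg_left (hbound τ hτ x) hs0
      calc ∑ x, Real.exp (s * h τ x) ≤ ∑ x, (1 + s * h τ x + (s * T) ^ 2) := by
            refine Finset.sum_le_sum fun x _ => (exp_le_quadratic ((hb x).trans hsT1)).trans ?_
            have : (s * h τ x) ^ 2 ≤ (s * T) ^ 2 := sq_le_sq' (abs_le.1 (hb x)).1 (abs_le.1 (hb x)).2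
            linarith
        _ = D * (1 + (s * T) ^ 2) := by
            rw [Finset.sum_add_distrib, Finset.sum_add_distrib, ← Finset.mul_sum, hmean τ hτ]
            simp; ring
        _ ≤ D * Real.exp ((s * T) ^ 2) := by
            gcongr
            linarith [Real.add_one_le_exp ((s * T) ^ 2)]
    · simp [hτ]
  have hprod : ∑ v : Fin t → Fin D, Real.exp (s * ∑ τ ∈ I, h τ (v τ)) ≤
      D ^ t * Real.exp (k * (s * T) ^ 2) := by
    have e : ∀ v : Fin t → Fin D, Real.exp (s * ∑ τ ∈ I, h τ (v τ)) =
        ∏ τ, Real.exp (if τ ∈ I then s * h τ (v τ) else 0) := by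
      intro v
      rw [← Real.exp_sum, Finset.sum_ite_mem, Finset.univ_inter, Finset.mul_sum]
    simp only [e]
    have hpu := Finset.prod_univ_sum (fun _ : Fin t => (Finset.univ : Finset (Fin D)))
      (fun τ x => Real.exp (if τ ∈ I then s * h τ x else 0))
    rw [Fintype.piFinset_univ] at hpu
    rw [← hpu]
    calc _ ≤ ∏ τ : Fin t, ((D : ℝ) * (if τ ∈ I then Real.exp ((s * T) ^ 2) else 1)) :=
          Finset.prod_le_prod (fun τ _ => Finset.sum_nonneg fun x _ => (Real.exp_pos _).le)
            fun τ _ => mgf τ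
      _ = D ^ t * Real.exp ((s * T) ^ 2) ^ I.card := by
          rw [Finset.prod_mul_distrib, Finset.prod_ite_mem]; simp
      _ ≤ D ^ t * Real.exp ((s * T) ^ 2) ^ k := by
          gcongr
          exact Real.one_le_exp (by positivity)
      _ = _ := by rw [← Real.exp_nat_mul]
  have hm := card_mul_le_sum (fun v : Fin t → Fin D => E * T < ∑ τ ∈ I, h τ (v τ))
    (fun v => Real.exp (s * ∑ τ ∈ I, h τ (v τ))) (Real.exp (s * (E * T)))
    (fun _ => (Real.exp_pos _).le)
    (fun v hv => Real.exp_le_exp.2 (mul_le_mul_of_nonneg_left hv.le hs0))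
  have hfin := hm.trans hprod
  rw [← le_div_iff₀ (Real.exp_pos _), mul_div_assoc, ← Real.exp_sub] at hfin
  refine hfin.trans (le_of_eq ?_)
  congr 2
  rw [show s * (E * T) = (s * T) * E by ring, hsT]
  field_simp
  ring

/-- A multiplicative Chernoff bound for `S` independent uniform choices. -/
theorem card_chernoff {V : Type*} [Fintype V] [Nonempty V] (S : ℕ) (y : V → ℝ) (a p γ : ℝ) (ha : a = S * p)
    (h0 : ∀ c, 0 ≤ y c) (h1 : ∀ c, y c ≤ 1) (hp : ∑ c, y c = p * Fintype.card V)
    (hγ0 : 0 ≤ γ) (hγ1 : γ ≤ 1)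
    [DecidablePred fun v : Fin S → V => γ * a < |∑ j, y (v j) - a|] :
    ((Finset.univ.filter fun v : Fin S → V => γ * a < |∑ j, y (v j) - a|).card : ℝ) ≤
      (Fintype.card V : ℝ) ^ S * (2 * Real.exp (-(a * γ ^ 2 / 4))) := by
  classical
  have hV : (0 : ℝ) < Fintype.card V := by exact_mod_cast Fintype.card_pos
  have mgf : ∀ s : ℝ, |s| ≤ 1 →
      ∑ v : Fin S → V, Real.exp (s * (∑ j, y (v j) - a)) ≤
        (Fintype.card V : ℝ) ^ S * Real.exp (s ^ 2 * a) := by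
    intro s hs
    have hone : ∑ a, Real.exp (s * y a) ≤ Fintype.card V * Real.exp ((s + s ^ 2) * p) := by
      calc ∑ a, Real.exp (s * y a) ≤ ∑ a, (1 + (s + s ^ 2) * y a) := by
            refine Finset.sum_le_sum fun a _ => ?_
            have hle : |s * y a| ≤ 1 := by
              rw [abs_mul, abs_of_nonneg (h0 a)]
              exact mul_le_one₀ hs (h0 a) (h1 a)
            refine (exp_le_quadratic hle).trans ?_
            have : s ^ 2 * (y a) ^ 2 ≤ s ^ 2 * y a := by
              refine mul_le_mul_of_nonneg_left ?_ (sq_nonneg s)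
              have := h0 a; have := h1 a; nlinarith
            nlinarith
        _ = Fintype.card V * (1 + (s + s ^ 2) * p) := by
            rw [Finset.sum_add_distrib, ← Finset.mul_sum, hp]; simp; ring
        _ ≤ _ := by
            gcongr
            linarith [Real.add_one_le_exp ((s + s ^ 2) * p)]
    have e : ∀ v : Fin S → V, Real.exp (s * (∑ j, y (v j) - a)) =
        (∏ j, Real.exp (s * y (v j))) * Real.exp (-(s * a)) := by
      intro v
      rw [← Real.exp_sum, ← Real.exp_add, ← Finset.mul_sum]; congr 1; ring
    simp only [e]
    rw [← Finset.sum_mul, ← Fintype.sum_pow (fun a => Real.exp (s * y a)) S]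
    calc (∑ a, Real.exp (s * y a)) ^ S * Real.exp (-(s * a))
        ≤ (Fintype.card V * Real.exp ((s + s ^ 2) * p)) ^ S * Real.exp (-(s * a)) := by
          gcongr
      _ = _ := by
          rw [mul_pow, mul_assoc, ← Real.exp_nat_mul, ← Real.exp_add]
          congr 2; rw [ha]; ring
  have markov : ∀ s : ℝ, |s| ≤ 1 → s ^ 2 = γ ^ 2 / 4 →
      ((Finset.univ.filter fun v : Fin S → V =>
        |s| * (γ * a) < s * (∑ j, y (v j) - a)).card : ℝ) ≤
      (Fintype.card V : ℝ) ^ S * Real.exp (-(a * γ ^ 2 / 4)) := by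
    intro s hs hs2
    have hm := card_mul_le_sum (fun v : Fin S → V => |s| * (γ * a) < s * (∑ j, y (v j) - a))
      (fun v => Real.exp (s * (∑ j, y (v j) - a))) (Real.exp (|s| * (γ * a)))
      (fun _ => (Real.exp_pos _).le) (fun v hv => Real.exp_le_exp.2 hv.le)
    have hfin := hm.trans (mgf s hs)
    rw [← le_div_iff₀ (Real.exp_pos _), mul_div_assoc, ← Real.exp_sub] at hfin
    refine hfin.trans (le_of_eq ?_)
    congr 2
    have : |s| = γ / 2 := by
      have : s ^ 2 = (γ / 2) ^ 2 := by rw [hs2]; ring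
      rw [← abs_of_nonneg (show 0 ≤ γ / 2 by linarith)]
      exact (sq_eq_sq_iff_abs_eq_abs _ _).1 this
    rw [this, hs2]; ring
  by_cases hγ : γ = 0
  · subst hγ
    refine (Nat.cast_le.2 (Finset.card_le_univ _)).trans ?_
    simp
    have : (0 : ℝ) < (Fintype.card V : ℝ) ^ S := by positivity
    linarith
  have hγp : 0 < γ := lt_of_le_of_ne hγ0 (Ne.symm hγ)
  have hab : |γ / 2| = γ / 2 := abs_of_nonneg (by linarith)
  have m1 := markov (γ / 2) (by rw [hab]; linarith) (by ring)
  have m2 := markov (-(γ / 2)) (by rw [abs_neg, hab]; linarith) (by ring)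
  rw [abs_neg, hab] at m2
  rw [hab] at m1
  have hsub : (Finset.univ.filter fun v : Fin S → V => γ * a < |∑ j, y (v j) - a|) ⊆
      (Finset.univ.filter fun v : Fin S → V => γ / 2 * (γ * a) < γ / 2 * (∑ j, y (v j) - a)) ∪
      (Finset.univ.filter fun v : Fin S → V =>
        γ / 2 * (γ * a) < -(γ / 2) * (∑ j, y (v j) - a)) := by
    intro v hv
    simp only [Finset.mem_union, Finset.mem_filter, Finset.mem_univ, true_and] at hv ⊢
    rcases lt_abs.1 hv with h | h
    · left; exact mul_lt_mul_of_pos_left h (by linarith)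
    · right
      rw [neg_mul, ← mul_neg]
      exact mul_lt_mul_of_pos_left h (by linarith)
  have hc := (Finset.card_le_card hsub).trans (Finset.card_union_le _ _)
  have hc' : ((Finset.univ.filter fun v : Fin S → V => γ * a < |∑ j, y (v j) - a|).card : ℝ) ≤
      (Finset.univ.filter fun v : Fin S → V =>
        γ / 2 * (γ * a) < γ / 2 * (∑ j, y (v j) - a)).card +
      (Finset.univ.filter fun v : Fin S → V =>
        γ / 2 * (γ * a) < -(γ / 2) * (∑ j, y (v j) - a)).card := by exact_mod_cast hc
  linarith

end Sampling

/-! ## The law of the tags -/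

namespace Sampling

open Ram Monitor

theorem uniform_mod_le {w D : ℕ} (hD : 0 < D) (hdvd : D ∣ 2 ^ w) (r : ℕ) :
    ProbabilityTheory.uniformOn (Set.univ : Set (Word w)) {x | x.val % D = r} ≤
      (D : ENNReal)⁻¹ := by
  classical
  obtain ⟨M, hM⟩ := hdvd
  have hM0 : 0 < M := by
    rcases Nat.eq_zero_or_pos M with h | h
    · subst h; have : 0 < 2 ^ w := by positivity
      omega
    · exact h
  have hcard : (Finset.univ.filter fun x : Word w => x.val % D = r).card ≤ M := by
    rw [← Finset.card_range M]
    refine Finset.card_le_card_of_injOn (fun x => x.val / D) ?_ ?_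
    · intro x _
      simp only [Finset.coe_range, Set.mem_Iio]
      exact Nat.div_lt_of_lt_mul (hM ▸ x.isLt)
    · intro x hx y hy hxy
      simp only [Finset.coe_filter, Finset.mem_univ, true_and, Set.mem_ofPred_eq] at hx hy hxy
      apply Fin.ext
      rw [← Nat.div_add_mod x.val D, ← Nat.div_add_mod y.val D, hx, hy, hxy]
  have hset : {x : Word w | x.val % D = r} =
      ((Finset.univ.filter fun x : Word w => x.val % D = r : Finset (Word w)) : Set (Word w)) := by
    ext; simp
  rw [ProbabilityTheory.uniformOn_univ, hset, Measure.count_apply_finset, Fintype.card_fin]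
  have h2 : ((2 ^ w : ℕ) : ENNReal) = D * M := by rw [hM]; push_cast; rfl
  rw [h2]
  calc ((Finset.univ.filter fun x : Word w => x.val % D = r).card : ENNReal) / (D * M)
      ≤ (M : ENNReal) / (D * M) := by gcongr
    _ = (D : ENNReal)⁻¹ := by
      rw [mul_comm, ENNReal.div_eq_inv_mul, ENNReal.mul_inv (Or.inr (by simp)) (Or.inr (by simp; omega)),
        mul_right_comm, ENNReal.inv_mul_cancel (by simp; omega) (by simp), one_mul]

/-- Reduction of a word modulo `D`. -/
def tagOf {w : ℕ} (D : ℕ) (hD : 0 < D) (x : Word w) : Fin D := ⟨x.val % D, Nat.mod_lt _ hD⟩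

theorem coins_le {w D : ℕ} (hD : 0 < D) (hdvd : D ∣ 2 ^ w) {ι : Type*} [Fintype ι]
    [DecidableEq ι] (idx : ι → ℕ) (hidx : Function.Injective idx) (p : (ι → Fin D) → Prop)
    [DecidablePred p] :
    coins w {ω | p fun i => tagOf D hD (ω (idx i))} ≤
      ENNReal.ofReal ((Finset.univ.filter p).card / (D : ℝ) ^ Fintype.card ι) := by
  have single : ∀ v : ι → Fin D,
      coins w {ω | (fun i => tagOf D hD (ω (idx i))) = v} ≤ ((D : ENNReal)⁻¹) ^ Fintype.card ι := by
    intro v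
    have hprob : ∀ _ : ℕ, IsProbabilityMeasure
        (ProbabilityTheory.uniformOn (Set.univ : Set (Word w))) := fun _ =>
      ProbabilityTheory.isProbabilityMeasure_uniformOn Set.finite_univ Set.univ_nonempty
    set tgt : ℕ → Set (Word w) := fun q => {x | ∀ i, idx i = q → x.val % D = (v i).val} with htgt
    have hsub : {ω : ℕ → Word w | (fun i => tagOf D hD (ω (idx i))) = v} ⊆
        ((Finset.univ.image idx : Finset ℕ) : Set ℕ).pi tgt := by
      intro ω hω q _ i hi
      subst hi
      have := congrFun hω i
      exact congrArg Fin.val this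
    refine (measure_mono hsub).trans ?_
    rw [coins, Measure.infinitePi_pi _ fun _ _ => MeasurableSet.of_discrete,
      Finset.prod_image (fun a _ b _ h => hidx h)]
    refine (Finset.prod_le_prod' fun i _ => ?_).trans
      (le_of_eq (by rw [Finset.prod_const, Finset.card_univ]))
    refine (measure_mono fun x hx => ?_).trans (uniform_mod_le hD hdvd (v i).val)
    exact hx i rfl
  have hsub : {ω : ℕ → Word w | p fun i => tagOf D hD (ω (idx i))} ⊆
      ⋃ v ∈ Finset.univ.filter p, {ω | (fun i => tagOf D hD (ω (idx i))) = v} := by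
    intro ω hω
    simp only [Finset.mem_filter, Finset.mem_univ, true_and, Set.mem_iUnion, Set.mem_ofPred_eq,
      exists_prop]
    exact ⟨_, hω, rfl⟩
  refine (measure_mono hsub).trans ((measure_biUnion_finset_le _ _).trans ?_)
  refine (Finset.sum_le_sum fun v _ => single v).trans (le_of_eq ?_)
  rw [Finset.sum_const, nsmul_eq_mul, ENNReal.ofReal_div_of_pos (by positivity),
    ENNReal.ofReal_natCast, ENNReal.ofReal_pow (by positivity), ENNReal.ofReal_natCast,
    ENNReal.div_eq_inv_mul, ENNReal.inv_pow, mul_comm]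

/-! ## The offsets are good with high probability -/

/-- A stream with given tags. -/
def tagList {k n D : ℕ} (l : List (Fin k × Fin n)) (u : Fin l.length → Fin D) :
    List (Fin k × ℕ × ℕ) :=
  List.ofFn fun τ => ((l.get τ).1, (l.get τ).2.val, (u τ).val)

theorem tagged_eq_tagList {w k n D : ℕ} (hD : 0 < D) (S : ℕ) (ω : ℕ → Word w)
    (l : List (Fin k × Fin n)) (j : ℕ) :
    tagged D S ω l j = tagList l fun τ => tagOf D hD (ω (τ.val * S + j)) := by
  apply List.ext_getElem
  · simp [tagged, tagList]
  · intro i h1 h2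
    simp [tagged, tagList, tagOf]

theorem length_tagList {k n D : ℕ} (l : List (Fin k × Fin n)) (u : Fin l.length → Fin D) :
    (tagList l u).length = l.length := by simp [tagList]

theorem map_tagList {k n D : ℕ} (l : List (Fin k × Fin n)) (u : Fin l.length → Fin D) :
    (tagList l u).map (fun a => (a.1, a.2.1)) = l.map fun p => (p.1, p.2.val) := by
  apply List.ext_getElem
  · simp [tagList]
  · intro i h1 h2
    simp [tagList]

theorem map_tag_tagList {k n D : ℕ} (l : List (Fin k × Fin n)) (u : Fin l.length → Fin D) :
    (tagList l u).map (fun a => a.2.2) = List.ofFn fun τ => (u τ).val := by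
  simp [tagList, List.map_ofFn]; rfl

theorem tag_lt_of_mem_tagList {k n D : ℕ} (l : List (Fin k × Fin n)) (u : Fin l.length → Fin D) :
    ∀ e ∈ tagList l u, e.2.2 < D := by
  intro e he
  simp only [tagList, List.mem_ofFn] at he
  obtain ⟨τ, rfl⟩ := he
  exact (u τ).isLt

/-- The positions at which a site receives its first item. -/
def firstPositions {k n : ℕ} (l : List (Fin k × Fin n)) : Finset (Fin l.length) :=
  Finset.univ.filter fun σ => ∀ σ' < σ, (l.get σ').1 ≠ (l.get σ).1

theorem firstPositions_injOn {k n : ℕ} (l : List (Fin k × Fin n)) :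
    Set.InjOn (fun σ => (l.get σ).1) (firstPositions l : Set (Fin l.length)) := by
  intro a ha b hb hab
  simp only [firstPositions, Finset.coe_filter, Finset.mem_univ, true_and, Set.mem_ofPred_eq]
    at ha hb
  rcases lt_trichotomy a b with c | c | c
  · exact absurd hab (hb a c)
  · exact c
  · exact absurd hab.symm (ha b c)

theorem card_firstPositions_le {k n : ℕ} (l : List (Fin k × Fin n)) :
    (firstPositions l).card ≤ k := by
  rw [← Finset.card_image_of_injOn (firstPositions_injOn l)]
  exact (Finset.card_le_univ _).trans (by simp)

theorem exists_firstPosition {k n : ℕ} {l : List (Fin k × Fin n)} (σ : Fin l.length) :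
    ∃ σ' ∈ firstPositions l, (l.get σ').1 = (l.get σ).1 := by
  obtain ⟨σ', h1, h2⟩ := Finset.exists_min_image
    (Finset.univ.filter fun σ' : Fin l.length => (l.get σ').1 = (l.get σ).1) id
    ⟨σ, by simp⟩
  simp only [Finset.mem_filter, Finset.mem_univ, true_and, id] at h1 h2
  refine ⟨σ', ?_, h1⟩
  simp only [firstPositions, Finset.mem_filter, Finset.mem_univ, true_and]
  intro τ hτ he
  exact absurd hτ (not_lt.2 (h2 τ (he.trans h1)))

theorem firstTag_tagList {k n D : ℕ} (l : List (Fin k × Fin n)) (u : Fin l.length → Fin D)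
    {σ : Fin l.length} (hσ : σ ∈ firstPositions l) :
    firstTag D (tagList l u) (l.get σ).1 = (u σ).val := by
  have hlen : σ.val < (tagList l u).length := by rw [length_tagList]; exact σ.isLt
  have hdec : tagList l u = (tagList l u).take σ.val ++
      (((l.get σ).1, (l.get σ).2.val, (u σ).val) :: (tagList l u).drop (σ.val + 1)) := by
    conv_lhs => rw [← List.take_append_drop σ.val (tagList l u), List.drop_eq_getElem_cons hlen]
    simp [tagList]
  rw [hdec, firstTag_append, if_neg]
  · simp [firstTag]
  · rintro ⟨a, ha, hai⟩
    rw [List.mem_take_iff_getElem] at ha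
    obtain ⟨i, hi, rfl⟩ := ha
    simp only [firstPositions, Finset.mem_filter, Finset.mem_univ, true_and] at hσ
    have hi' : i < σ.val := by omega
    exact hσ ⟨i, by omega⟩ hi' (by simpa [tagList] using hai)

/-- The number of occurrences of the item at position `τ` at site `i` among the following `d`
items. -/
def occAfter {k n : ℕ} (l : List (Fin k × Fin n)) (τ : Fin l.length) (d : ℕ) (i : Fin k) : ℕ :=
  ((l.drop (τ.val + 1)).take d).countP fun p => p.1 = i ∧ p.2 = (l.get τ).2

theorem deviation_tagList {k n D : ℕ} (l : List (Fin k × Fin n)) (u : Fin l.length → Fin D) (T : ℕ)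
    (c : Fin k → ℕ) (hc : ∀ i, c i ≠ 0 → ∃ σ : Fin l.length, (l.get σ).1 = i) :
    ∑ i, ((T : ℝ) * crossings T (c i) (firstTag D (tagList l u) i) - c i) =
      ∑ σ ∈ firstPositions l, ((T : ℝ) * crossings T (c (l.get σ).1) (u σ).val - c (l.get σ).1) := by
  have e : ∀ σ ∈ firstPositions l,
      ((T : ℝ) * crossings T (c (l.get σ).1) (u σ).val - c (l.get σ).1) =
      (fun i => (T : ℝ) * crossings T (c i) (firstTag D (tagList l u) i) - c i) (l.get σ).1 := by
    intro σ hσ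
    simp only [firstTag_tagList l u hσ]
  rw [Finset.sum_congr rfl e, ← Finset.sum_image (f := fun i =>
    (T : ℝ) * crossings T (c i) (firstTag D (tagList l u) i) - c i) (firstPositions_injOn l)]
  symm
  refine Finset.sum_subset (Finset.subset_univ _) fun i _ hi => ?_
  have : c i = 0 := by
    by_contra h
    obtain ⟨σ, rfl⟩ := hc i h
    obtain ⟨σ', h1, h2⟩ := exists_firstPosition σ
    exact hi (Finset.mem_image.2 ⟨σ', h1, h2⟩)
  rw [this, crossings_zero]; simp

theorem mul_crossings (T c x : ℕ) :
    (T : ℝ) * crossings T c x - c = (x % T : ℕ) - ((c + x) % T : ℕ) := by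
  have h1 := Nat.div_add_mod x T
  have h2 := Nat.div_add_mod (c + x) T
  have h3 : x / T ≤ (c + x) / T := Nat.div_le_div_right (by omega)
  unfold crossings
  rw [Nat.cast_sub h3, mul_sub]
  have h1' : (T : ℝ) * (x / T : ℕ) + (x % T : ℕ) = x := by exact_mod_cast h1
  have h2' : (T : ℝ) * ((c + x) / T : ℕ) + ((c + x) % T : ℕ) = c + x := by exact_mod_cast h2
  linarith

theorem abs_mul_crossings_le {T : ℕ} (hT : 0 < T) (c x : ℕ) :
    |(T : ℝ) * crossings T c x - c| ≤ T := by
  rw [mul_crossings]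
  have h1 : ((x % T : ℕ) : ℝ) ≤ T := by exact_mod_cast (Nat.mod_lt _ hT).le
  have h2 : (((c + x) % T : ℕ) : ℝ) ≤ T := by exact_mod_cast (Nat.mod_lt _ hT).le
  have h3 : (0 : ℝ) ≤ (x % T : ℕ) := Nat.cast_nonneg _
  have h4 : (0 : ℝ) ≤ ((c + x) % T : ℕ) := Nat.cast_nonneg _
  rw [abs_le]; constructor <;> linarith

theorem sum_shift_mod {T D : ℕ} (h : T ∣ D) (c : ℕ) :
    ∑ x ∈ Finset.range D, (c + x) % T = ∑ x ∈ Finset.range D, x % T := by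
  induction c with
  | zero => simp
  | succ c ih =>
    rw [← ih]
    have h1 := Finset.sum_range_succ' (fun x => (c + x) % T) D
    have h2 := Finset.sum_range_succ (fun x => (c + x) % T) D
    have h3 : (c + D) % T = (c + 0) % T := by
      obtain ⟨q, rfl⟩ := h; simp
    have h4 : ∑ x ∈ Finset.range D, (c + 1 + x) % T = ∑ x ∈ Finset.range D, (c + (x + 1)) % T :=
      Finset.sum_congr rfl fun x _ => by congr 1; ring
    rw [h4]
    omega

theorem sum_mul_crossings {T D : ℕ} (h : T ∣ D) (c : ℕ) :
    ∑ x : Fin D, ((T : ℝ) * crossings T c x.val - c) = 0 := by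
  simp only [mul_crossings]
  rw [Finset.sum_sub_distrib, Fin.sum_univ_eq_sum_range (fun x => ((x % T : ℕ) : ℝ)),
    Fin.sum_univ_eq_sum_range (fun x => (((c + x) % T : ℕ) : ℝ)), ← Nat.cast_sum, ← Nat.cast_sum,
    sum_shift_mod h, sub_self]

theorem accurate_tagList {k n D b : ℕ} {E : ℝ} (l : List (Fin k × Fin n)) (u : Fin l.length → Fin D)
    (h : ∀ (τ : Fin l.length) (d : Fin (l.length + 1)) (v : Fin (b + 1)),
      |∑ σ ∈ firstPositions l, (((2 ^ v.val : ℕ) : ℝ) *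
        crossings (2 ^ v.val) (occAfter l τ d.val (l.get σ).1) (u σ).val -
          occAfter l τ d.val (l.get σ).1)| ≤ E * (2 ^ v.val : ℕ)) :
    Accurate D b E (tagList l u) := by
  intro l₁ e l₂ l₃ hl v hv
  have hlen := congrArg List.length hl
  rw [length_tagList] at hlen
  simp only [List.length_append, List.length_cons] at hlen
  set τ : Fin l.length := ⟨l₁.length, by omega⟩ with hτ
  have hocc : ∀ i, occ l₂ e.2.1 i = occAfter l τ l₂.length i := by
    intro i
    have hm := map_tagList l u
    have he : e.2.1 = (l.get τ).2.val := by
      have h1 : (tagList l u)[l₁.length]'(by rw [length_tagList]; omega) = e := by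
        simp [hl]
      rw [← h1]; simp [tagList, hτ]
    have hd : (l.map fun p => (p.1, p.2.val)).drop (τ.val + 1) =
        l₂.map (fun a => (a.1, a.2.1)) ++ l₃.map fun a => (a.1, a.2.1) := by
      rw [← hm, hl, List.map_append, List.map_cons, List.map_append, List.append_cons]
      exact List.drop_left' (by simp [hτ])
    have h2 : (((l.drop (τ.val + 1)).take l₂.length).map fun p => (p.1, p.2.val)) =
        l₂.map fun a => (a.1, a.2.1) := by
      rw [List.map_take, List.map_drop, hd]
      simp
    have h3 : occ l₂ e.2.1 i =
        (l₂.map fun a => (a.1, a.2.1)).countP fun q => q.1 = i ∧ q.2 = e.2.1 := by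
      rw [List.countP_map]; rfl
    rw [h3, ← h2, List.countP_map, occAfter, he]
    congr 1
    funext p
    simp [Fin.ext_iff]
  have := h τ ⟨l₂.length, by omega⟩ ⟨v, by omega⟩
  simp only [deviation, hocc]
  rw [deviation_tagList]
  · exact this
  · intro i hi
    have := List.countP_pos_iff.1 (Nat.pos_of_ne_zero hi)
    obtain ⟨p, hp, hpi⟩ := this
    have hp' := List.mem_of_mem_drop (List.mem_of_mem_take hp)
    obtain ⟨σ, hσ⟩ := List.mem_iff_get.1 hp'
    refine ⟨σ, ?_⟩
    simp at hpi
    rw [hσ, hpi.1]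

open Classical in
theorem card_not_accurate_le {k n b : ℕ} (hk : 0 < k) {E : ℝ} (hE : 0 ≤ E)
    (l : List (Fin k × Fin n)) :
    ((Finset.univ.filter fun u : Fin l.length → Fin (2 ^ b) =>
      ¬ Accurate (2 ^ b) b E (tagList l u)).card : ℝ) ≤
    (l.length * (l.length + 1) * (b + 1) : ℕ) *
      (((2 ^ b : ℕ) : ℝ) ^ l.length * (2 * Real.exp (-(E ^ 2 / (4 * k))))) := by
  set h : Fin l.length × Fin (l.length + 1) × Fin (b + 1) → Fin l.length → Fin (2 ^ b) → ℝ :=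
    fun z σ x => ((2 ^ z.2.2.val : ℕ) : ℝ) *
      crossings (2 ^ z.2.2.val) (occAfter l z.1 z.2.1.val (l.get σ).1) x.val -
        occAfter l z.1 z.2.1.val (l.get σ).1 with hh
  set bad : Fin l.length × Fin (l.length + 1) × Fin (b + 1) → Finset (Fin l.length → Fin (2 ^ b)) :=
    fun z => (Finset.univ.filter fun u : Fin l.length → Fin (2 ^ b) =>
        E * (2 ^ z.2.2.val : ℕ) < ∑ σ ∈ firstPositions l, h z σ (u σ)) ∪
      (Finset.univ.filter fun u : Fin l.length → Fin (2 ^ b) =>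
        E * (2 ^ z.2.2.val : ℕ) < ∑ σ ∈ firstPositions l, (fun σ x => -h z σ x) σ (u σ)) with hbad
  have hsub : (Finset.univ.filter fun u : Fin l.length → Fin (2 ^ b) =>
      ¬ Accurate (2 ^ b) b E (tagList l u)) ⊆ Finset.univ.biUnion bad := by
    intro u hu
    simp only [Finset.mem_filter, Finset.mem_univ, true_and] at hu
    by_contra hnot
    apply hu
    apply accurate_tagList
    intro τ d v
    simp only [Finset.mem_biUnion, Finset.mem_univ, true_and, not_exists, hbad, Finset.mem_union,
      Finset.mem_filter, not_or, not_lt] at hnot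
    obtain ⟨h1, h2⟩ := hnot (τ, d, v)
    rw [Finset.sum_neg_distrib] at h2
    exact abs_le.2 ⟨by linarith, h1⟩
  have hone : ∀ z, ((bad z).card : ℝ) ≤
      ((2 ^ b : ℕ) : ℝ) ^ l.length * (2 * Real.exp (-(E ^ 2 / (4 * k)))) := by
    intro z
    have hT : 0 < 2 ^ z.2.2.val := by positivity
    have hdvd : 2 ^ z.2.2.val ∣ 2 ^ b := pow_dvd_pow _ (by have := z.2.2.isLt; omega)
    have hT' : (0 : ℝ) < (2 ^ z.2.2.val : ℕ) := by exact_mod_cast hT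
    have b1 := card_sum_gt_le hk (h z) (firstPositions l) (card_firstPositions_le l) _ E hT' hE
      (fun σ _ => sum_mul_crossings hdvd _) (fun σ _ x => abs_mul_crossings_le hT _ _)
    have b2 := card_sum_gt_le hk (fun σ x => -h z σ x) (firstPositions l) (card_firstPositions_le l)
      _ E hT' hE (fun σ _ => by rw [Finset.sum_neg_distrib, sum_mul_crossings hdvd, neg_zero])
      (fun σ _ x => by rw [abs_neg]; exact abs_mul_crossings_le hT _ _)
    have hu : ((bad z).card : ℝ) ≤ _ := Nat.cast_le.2 (Finset.card_union_le _ _)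
    push_cast at hu b1 b2 ⊢
    linarith
  have hc := (Finset.card_le_card hsub).trans Finset.card_biUnion_le
  have hc' : ((Finset.univ.filter fun u : Fin l.length → Fin (2 ^ b) =>
      ¬ Accurate (2 ^ b) b E (tagList l u)).card : ℝ) ≤ ∑ z, ((bad z).card : ℝ) := by
    exact_mod_cast hc
  refine hc'.trans ((Finset.sum_le_sum fun z _ => hone z).trans (le_of_eq ?_))
  rw [Finset.sum_const, Finset.card_univ, Fintype.card_prod, Fintype.card_prod, Fintype.card_fin,
    Fintype.card_fin, Fintype.card_fin, nsmul_eq_mul, mul_assoc l.length]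

end Sampling

/-! ## The quantities `λ`, `π` and `κ` -/

namespace AMS

variable {n : ℕ} {f : ℕ → ℝ}

theorem sum_incr_tailFreq (hf : f 0 = 0) (A : List (Fin n)) :
    ∑ j : Fin A.length, incr f (tailFreq A j) = ∑ i, f (A.count i) := by
  induction A with
  | nil => simp [hf]
  | cons a A ih =>
    have h1 : ∑ j : Fin (a :: A).length, incr f (tailFreq (a :: A) j) =
        incr f (A.count a + 1) + ∑ j : Fin A.length, incr f (tailFreq A j) := by
      change ∑ j : Fin (A.length + 1), incr f (tailFreq (a :: A) j) = _
      rw [Fin.sum_univ_succ]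
      congr 2
      simp [tailFreq]
    have h2 : ∀ i, f ((a :: A).count i) =
        f (A.count i) + if i = a then incr f (A.count a + 1) else 0 := by
      intro i
      by_cases h : i = a
      · subst h; simp [incr]
      · have : a ≠ i := fun e => h e.symm
        simp [h, this]
    rw [h1, ih, Finset.sum_congr rfl fun i _ => h2 i, Finset.sum_add_distrib]
    simp; ring

theorem meanX_eq_fbar (hf : f 0 = 0) (A : List (Fin n)) : meanX f A = fbar f A := by
  rw [meanX, fbar, sum_incr_tailFreq hf]

theorem one_le_tailFreq (A : List (Fin n)) (j : Fin A.length) : 1 ≤ tailFreq A j := by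
  rw [tailFreq, List.drop_eq_getElem_cons j.isLt, List.get_eq_getElem, List.count_cons_self]
  omega

theorem length_pos_of_fbar_pos {A : List (Fin n)} (h : 0 < fbar f A) : 0 < A.length := by
  rcases Nat.eq_zero_or_pos A.length with h0 | h0
  · rw [fbar, h0] at h; simp at h
  · exact h0

variable {𝒜 : Set (List (Fin n))}

theorem incr_nonneg (hl : (lambdaSet f 𝒜).Nonempty) {A : List (Fin n)} (hA : A ∈ 𝒜)
    (j : Fin A.length) : 0 ≤ incr f (tailFreq A j) := by
  obtain ⟨l, h1, h2⟩ := hl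
  have := h2 A hA (1 / 4) (by norm_num) le_rfl j (tailFreq A j) (one_le_tailFreq A j)
    (by simp)
  rw [sub_self, abs_zero] at this
  by_contra hneg
  push Not at hneg
  nlinarith

theorem one_le_lam (hl : (lambdaSet f 𝒜).Nonempty) : 1 ≤ lam f 𝒜 :=
  le_csInf hl fun _ h => h.1

/-- The infimum in the definition of `λ` is attained. -/
theorem lam_spec (hl : (lambdaSet f 𝒜).Nonempty) {A : List (Fin n)} (hA : A ∈ 𝒜) {ε : ℝ}
    (hε : 0 < ε) (hε' : ε ≤ 1 / 4) (j : Fin A.length) {R : ℕ} (hR : 1 ≤ R)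
    (h : |(R : ℝ) - tailFreq A j| ≤ ε * tailFreq A j) :
    |incr f (tailFreq A j) - incr f R| ≤ lam f 𝒜 * ε * incr f (tailFreq A j) := by
  have hX := incr_nonneg hl hA j
  have key : ∀ l ∈ lambdaSet f 𝒜,
      |incr f (tailFreq A j) - incr f R| ≤ l * (ε * incr f (tailFreq A j)) := fun l h' => by
    rw [← mul_assoc]; exact h'.2 A hA ε hε hε' j R hR h
  rw [mul_assoc]
  rcases hX.eq_or_lt with h0 | h0
  · obtain ⟨l, h'⟩ := hl
    have := key l h'
    rw [← h0] at this ⊢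
    simpa using this
  · have hpos : 0 < ε * incr f (tailFreq A j) := mul_pos hε h0
    rw [← div_le_iff₀ hpos]
    exact le_csInf hl fun l h' => (div_le_iff₀ hpos).2 (key l h')

theorem le_piVal (hl : (lambdaSet f 𝒜).Nonempty) (hf : f 0 = 0) {A : List (Fin n)} (hA : A ∈ 𝒜)
    (hpos : 0 < fbar f A) (j : Fin A.length) :
    3 * incr f (tailFreq A j) / fbar f A ≤ piVal f A := by
  have hA0 := length_pos_of_fbar_pos hpos
  unfold piVal
  rw [meanX_eq_fbar hf]
  refine le_csInf ?_ ?_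
  · obtain ⟨b, hb⟩ := (Set.finite_range fun j : Fin A.length => incr f (tailFreq A j)).bddAbove
    refine ⟨_, 0, max b 1, le_rfl, by positivity, fun j => ⟨?_, ?_⟩, rfl⟩
    · rw [neg_zero]; exact incr_nonneg hl hA j
    · exact (hb ⟨j, rfl⟩).trans (le_max_left _ _)
  · rintro v ⟨a, b, ha, hb, hab, rfl⟩
    generalize fbar f A = e at *
    have h1 := (hab j).2
    have e1 : 3 * (1 + a / e) ^ 2 * (a + b) / (a + e) = 3 * ((1 + a / e) * (a + b)) / e := by
      field_simp
      ring
    rw [e1]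
    gcongr
    have : 0 ≤ a / e := by positivity
    nlinarith

theorem piVal_le (hl : (lambdaSet f 𝒜).Nonempty) (hf : f 0 = 0) {A : List (Fin n)} (hA : A ∈ 𝒜)
    (hpos : 0 < fbar f A) : piVal f A ≤ 3 * A.length := by
  have hA0 : (0 : ℝ) < A.length := by exact_mod_cast length_pos_of_fbar_pos hpos
  have hm := meanX_eq_fbar hf A
  refine csInf_le ⟨0, ?_⟩ ⟨0, fbar f A * A.length, le_rfl, by positivity, fun j => ⟨?_, ?_⟩, ?_⟩
  · rintro v ⟨a, b, ha, hb, hab, rfl⟩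
    rw [hm]; positivity
  · rw [neg_zero]; exact incr_nonneg hl hA j
  · rw [← hm, meanX, div_mul_cancel₀ _ hA0.ne']
    exact Finset.single_le_sum (f := fun j => incr f (tailFreq A j))
      (fun j _ => incr_nonneg hl hA j) (Finset.mem_univ j)
  · rw [hm]; field_simp; ring

theorem piVal_le_of_mem {m : ℕ} (hl : (lambdaSet f 𝒜).Nonempty) (hf : f 0 = 0)
    (hpos : ∀ A ∈ 𝒜, 0 < fbar f A) (hm : ∀ A ∈ 𝒜, A.length ≤ m)
    {A : List (Fin n)} (hA : A ∈ 𝒜) : piVal f A ≤ 3 * m :=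
  (piVal_le hl hf hA (hpos A hA)).trans (by have := hm A hA; gcongr)

theorem piVal_le_supPi {m : ℕ} (hl : (lambdaSet f 𝒜).Nonempty) (hf : f 0 = 0)
    (hpos : ∀ A ∈ 𝒜, 0 < fbar f A) (hm : ∀ A ∈ 𝒜, A.length ≤ m)
    {A : List (Fin n)} (hA : A ∈ 𝒜) : piVal f A ≤ supPi f 𝒜 :=
  le_csSup ⟨3 * m, by rintro _ ⟨A, hA, rfl⟩; exact piVal_le_of_mem hl hf hpos hm hA⟩ ⟨A, hA, rfl⟩

theorem supPi_le {m : ℕ} (hl : (lambdaSet f 𝒜).Nonempty) (hf : f 0 = 0)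
    (hpos : ∀ A ∈ 𝒜, 0 < fbar f A) (hm : ∀ A ∈ 𝒜, A.length ≤ m)
    (hne : 𝒜.Nonempty) : supPi f 𝒜 ≤ 3 * m :=
  csSup_le (hne.image _) (by rintro _ ⟨A, hA, rfl⟩; exact piVal_le_of_mem hl hf hpos hm hA)

theorem incr_le {m : ℕ} (hl : (lambdaSet f 𝒜).Nonempty) (hf : f 0 = 0)
    (hpos : ∀ A ∈ 𝒜, 0 < fbar f A) (hm : ∀ A ∈ 𝒜, A.length ≤ m)
    {A : List (Fin n)} (hA : A ∈ 𝒜) (j : Fin A.length) :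
    incr f (tailFreq A j) ≤ supPi f 𝒜 / 3 * fbar f A := by
  have h1 := (le_piVal hl hf hA (hpos A hA) j).trans (piVal_le_supPi hl hf hpos hm hA)
  rw [div_le_iff₀ (hpos A hA)] at h1
  linarith

theorem three_le_supPi {m : ℕ} (hl : (lambdaSet f 𝒜).Nonempty) (hf : f 0 = 0)
    (hpos : ∀ A ∈ 𝒜, 0 < fbar f A) (hm : ∀ A ∈ 𝒜, A.length ≤ m)
    (hne : 𝒜.Nonempty) : 3 ≤ supPi f 𝒜 := by
  obtain ⟨A, hA⟩ := hne
  have hp := hpos A hA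
  have hA0 : (0 : ℝ) < A.length := by exact_mod_cast length_pos_of_fbar_pos hp
  have h1 : fbar f A * A.length ≤ supPi f 𝒜 / 3 * fbar f A * A.length := by
    calc fbar f A * A.length = ∑ j : Fin A.length, incr f (tailFreq A j) := by
          rw [← meanX_eq_fbar hf, meanX, div_mul_cancel₀ _ hA0.ne']
      _ ≤ ∑ j : Fin A.length, supPi f 𝒜 / 3 * fbar f A :=
          Finset.sum_le_sum fun j _ => incr_le hl hf hpos hm hA j
      _ = _ := by simp; ring
  have h2 := le_of_mul_le_mul_right h1 hA0
  have h3 : 1 * fbar f A ≤ supPi f 𝒜 / 3 * fbar f A := by linarith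
  have := le_of_mul_le_mul_right h3 hp
  linarith

end AMS

/-! ## Accuracy -/

namespace Sampling

open Ram Monitor

theorem IsSample.exists_position {k n D : ℕ} {l : List (Fin k × Fin n)} {u : Fin l.length → Fin D}
    {l₁ l₂ : List (Fin k × ℕ × ℕ)} {e : Fin k × ℕ × ℕ} (h : IsSample (tagList l u) l₁ e l₂) :
    ∃ τ : Fin l.length, IsFirstMin u τ ∧
      1 + l₂.countP (fun a => a.2.1 = e.2.1) =
        AMS.tailFreq (l.map Prod.snd) (Fin.cast (by simp) τ) := by
  have hlen := congrArg List.length h.eq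
  rw [length_tagList] at hlen
  simp only [List.length_append, List.length_cons] at hlen
  have hget : ∀ σ : Fin l.length, (tagList l u)[σ.val]'(by rw [length_tagList]; exact σ.isLt) =
      ((l.get σ).1, (l.get σ).2.val, (u σ).val) := by
    intro σ; simp [tagList]
  have hτ : l₁.length < l.length := by omega
  set τ : Fin l.length := ⟨l₁.length, hτ⟩ with hτdef
  have he : e = ((l.get τ).1, (l.get τ).2.val, (u τ).val) := by
    rw [← hget τ]; simp [h.eq, hτdef]
  refine ⟨τ, ⟨fun σ hσ => ?_, fun σ hσ => ?_⟩, ?_⟩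
  · have hσ' : σ.val < l₁.length := hσ
    have h1 := h.before _ (List.getElem_mem hσ')
    have h2 : l₁[σ.val] = ((l.get σ).1, (l.get σ).2.val, (u σ).val) := by
      rw [← hget σ]; simp [h.eq, hσ']
    rw [h2, he] at h1
    exact h1
  · have hσ' : l₁.length < σ.val := hσ
    have hi : σ.val - (l₁.length + 1) < l₂.length := by have := σ.isLt; omega
    have h1 := h.after _ (List.getElem_mem hi)
    have h2 : l₂[σ.val - (l₁.length + 1)] = ((l.get σ).1, (l.get σ).2.val, (u σ).val) := by
      rw [← hget σ]
      have : (tagList l u) = (l₁ ++ [e]) ++ l₂ := by rw [h.eq]; simp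
      simp only [this]
      rw [List.getElem_append_right (by rw [List.length_append, List.length_singleton]; omega)]
      congr 1
      rw [List.length_append, List.length_singleton]
    rw [h2, he] at h1
    exact h1
  · have hm := map_tagList l u
    have hd : (l.drop (τ.val + 1)).map (fun p => (p.1, p.2.val)) =
        l₂.map fun a => (a.1, a.2.1) := by
      rw [List.map_drop, ← hm, h.eq, List.map_append, List.map_cons, List.append_cons]
      exact List.drop_left' (by simp [hτdef])
    have h3 : l₂.countP (fun a => a.2.1 = e.2.1) =
        (l₂.map fun a => (a.1, a.2.1)).countP fun q => q.2 = e.2.1 := by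
      rw [List.countP_map]; rfl
    rw [h3, ← hd, List.countP_map, AMS.tailFreq, List.drop_eq_getElem_cons (Fin.isLt _),
      List.get_eq_getElem, List.count_cons_self, ← List.map_drop, List.count, List.countP_map,
      add_comm]
    congr 2
    funext p
    simp only [he, Function.comp_apply, List.get_eq_getElem, List.getElem_map, Fin.val_cast,
      Fin.val_inj, beq_eq_decide]

open Classical in
/-- The average over the tags of the value at the position of the first minimal tag. -/
theorem sum_firstMin_bounds {t D : ℕ} (ht : 0 < t) (hD : 0 < D) (X : Fin t → ℝ) (hX : ∀ τ, 0 ≤ X τ)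
    (J : (Fin t → Fin D) → Fin t) (hJ : ∀ u, IsFirstMin u (J u)) :
    |∑ u, X (J u) - (D : ℝ) ^ t * ((∑ τ, X τ) / t)| ≤ t / D * ((D : ℝ) ^ t * ((∑ τ, X τ) / t)) := by
  have ht' : (0 : ℝ) < t := by exact_mod_cast ht
  have hfib : ∑ u, X (J u) =
      ∑ τ, ((Finset.univ.filter fun u : Fin t → Fin D => IsFirstMin u τ).card : ℝ) * X τ := by
    rw [← Finset.sum_fiberwise_of_maps_to (s := Finset.univ) (t := Finset.univ) (g := J)
      (fun _ _ => Finset.mem_univ _)]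
    refine Finset.sum_congr rfl fun τ _ => ?_
    have : (Finset.univ.filter fun u : Fin t → Fin D => J u = τ) =
        Finset.univ.filter fun u : Fin t → Fin D => IsFirstMin u τ := by
      ext u
      simp only [Finset.mem_filter, Finset.mem_univ, true_and]
      exact ⟨fun h => h ▸ hJ u, fun h => (hJ u).unique h⟩
    rw [← this, ← nsmul_eq_mul, ← Finset.sum_const]
    exact Finset.sum_congr rfl fun u hu => by simp at hu; rw [hu]
  have hb := fun τ : Fin t => card_isFirstMin_bounds hD τ
  have h1 : (t : ℝ) * ∑ u, X (J u) ≤ (D : ℝ) ^ t * (1 + t / D) * ∑ τ, X τ := by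
    rw [hfib, Finset.mul_sum, Finset.mul_sum]
    refine Finset.sum_le_sum fun τ _ => ?_
    rw [← mul_assoc]
    exact mul_le_mul_of_nonneg_right (hb τ).1 (hX τ)
  have h2 : (D : ℝ) ^ t * (1 - t / D) * ∑ τ, X τ ≤ (t : ℝ) * ∑ u, X (J u) := by
    rw [hfib, Finset.mul_sum, Finset.mul_sum]
    refine Finset.sum_le_sum fun τ _ => ?_
    rw [← mul_assoc]
    exact mul_le_mul_of_nonneg_right (hb τ).2 (hX τ)
  generalize ∑ τ, X τ = s at *
  generalize ∑ u, X (J u) = z at *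
  rw [abs_le]
  constructor
  · rw [← mul_le_mul_iff_right₀ ht']
    have : (t : ℝ) * -(t / D * ((D : ℝ) ^ t * (s / t))) =
      (D : ℝ) ^ t * (1 - t / D) * s - t * ((D : ℝ) ^ t * (s / t)) := by field_simp; ring
    rw [this, mul_sub]
    linarith
  · rw [← mul_le_mul_iff_right₀ ht']
    have : (t : ℝ) * (t / D * ((D : ℝ) ^ t * (s / t))) =
      (D : ℝ) ^ t * (1 + t / D) * s - t * ((D : ℝ) ^ t * (s / t)) := by field_simp; ring
    rw [this, mul_sub]
    linarith

theorem coins_family_le {w D S t : ℕ} (hD : 0 < D) (hdvd : D ∣ 2 ^ w)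
    (p : (Fin S → Fin t → Fin D) → Prop) [DecidablePred p] (q : ℝ)
    (hq : ((Finset.univ.filter p).card : ℝ) ≤ ((D : ℝ) ^ t) ^ S * q) :
    coins w {ω | p fun j τ => tagOf D hD (ω (τ.val * S + j.val))} ≤ ENNReal.ofReal q := by
  have hD' : (0 : ℝ) < D := by exact_mod_cast hD
  have hinj : Function.Injective fun z : Fin S × Fin t => z.2.val * S + z.1.val := by
    rintro ⟨j, τ⟩ ⟨j', τ'⟩ h
    simp only at h
    have hS : 0 < S := by have := j.isLt; omega
    have h1 : (τ.val * S + j.val) % S = (τ'.val * S + j'.val) % S := by rw [h]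
    have h2 : (τ.val * S + j.val) / S = (τ'.val * S + j'.val) / S := by rw [h]
    rw [mul_comm, Nat.mul_add_mod, Nat.mod_eq_of_lt j.isLt, mul_comm, Nat.mul_add_mod,
      Nat.mod_eq_of_lt j'.isLt] at h1
    rw [mul_comm, Nat.mul_add_div hS, Nat.div_eq_of_lt j.isLt, mul_comm, Nat.mul_add_div hS,
      Nat.div_eq_of_lt j'.isLt] at h2
    simp only [Prod.mk.injEq, Fin.ext_iff]
    omega
  have := coins_le hD hdvd (fun z : Fin S × Fin t => z.2.val * S + z.1.val) hinj
    (fun v => p fun j τ => v (j, τ))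
  refine this.trans (ENNReal.ofReal_le_ofReal ?_)
  rw [div_le_iff₀ (by positivity)]
  have hc : (Finset.univ.filter fun v : Fin S × Fin t → Fin D => p fun j τ => v (j, τ)).card =
      (Finset.univ.filter p).card := by
    refine Finset.card_bij (fun v _ => fun j τ => v (j, τ)) ?_ ?_ ?_
    · intro v hv; simpa using hv
    · intro v _ v' _ h
      funext z
      exact congrFun (congrFun h z.1) z.2
    · intro v hv
      exact ⟨fun z => v z.1 z.2, by simpa using hv, rfl⟩
  rw [hc, Fintype.card_prod, Fintype.card_fin, Fintype.card_fin, mul_comm S t, pow_mul, mul_comm q]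
  exact hq

theorem coins_single_le {w D S t : ℕ} (hD : 0 < D) (hdvd : D ∣ 2 ^ w) (j : ℕ) (hS : 0 < S)
    (p : (Fin t → Fin D) → Prop) [DecidablePred p] (q : ℝ)
    (hq : ((Finset.univ.filter p).card : ℝ) ≤ (D : ℝ) ^ t * q) :
    coins w {ω | p fun τ => tagOf D hD (ω (τ.val * S + j))} ≤ ENNReal.ofReal q := by
  have hD' : (0 : ℝ) < D := by exact_mod_cast hD
  have hinj : Function.Injective fun τ : Fin t => τ.val * S + j := by
    intro τ τ' h
    simp only [Nat.add_right_cancel_iff] at h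
    exact Fin.ext (Nat.eq_of_mul_eq_mul_right hS h)
  refine (coins_le hD hdvd _ hinj p).trans (ENNReal.ofReal_le_ofReal ?_)
  rw [div_le_iff₀ (by positivity), Fintype.card_fin, mul_comm q]
  exact hq

/-- Combination of the three sources of error. -/
theorem combine_errors {ε S F μ M O : ℝ} (hε : 0 < ε) (hε1 : ε ≤ 1) (hS : 0 < S) (hF : 0 < F)
    (h1 : |μ - F| ≤ ε / 16 * F) (h2 : |M - S * μ| ≤ ε / 4 * (S * μ)) (h3 : |O - M| ≤ ε / 4 * M) :
    |O / S - F| ≤ ε * F := by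
  have hSF : 0 < S * F := mul_pos hS hF
  have a1 : |S * μ - S * F| ≤ ε / 16 * (S * F) := by
    rw [← mul_sub, abs_mul, abs_of_pos hS]
    calc S * |μ - F| ≤ S * (ε / 16 * F) := by gcongr
      _ = _ := by ring
  have b1 := abs_le.1 a1
  have e1 : ε / 16 * (S * F) ≤ 1 / 16 * (S * F) := by gcongr
  have a2 : |M - S * μ| ≤ ε / 4 * (17 / 16 * (S * F)) := h2.trans
    (mul_le_mul_of_nonneg_left (by linarith [b1.2]) (by positivity))
  have b2 := abs_le.1 a2
  have e2 : ε / 4 * (17 / 16 * (S * F)) ≤ 1 / 4 * (17 / 16 * (S * F)) := by gcongr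
  have a3 : |O - M| ≤ ε / 4 * (85 / 64 * (S * F)) := h3.trans
    (mul_le_mul_of_nonneg_left (by linarith [b1.2, b2.2]) (by positivity))
  have b3 := abs_le.1 a3
  have hk : |O - S * F| ≤ ε * (S * F) := by
    have : 0 ≤ ε * (S * F) := by positivity
    rw [abs_le]; constructor <;> linarith [b1.1, b1.2, b2.1, b2.2, b3.1, b3.2]
  have e3 : O / S - F = (O - S * F) / S := by field_simp
  rw [e3, abs_div, abs_of_pos hS, div_le_iff₀ hS]
  linarith

/-- Accuracy of the reported value, for all choices of the parameters of the algorithm for which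
the error probabilities are small. -/
theorem coins_error_le {w k n m D Q B b S : ℕ} {f : ℕ → ℝ} {𝒜 : Set (List (Fin n))} {ε δ E : ℝ}
    (hk : 1 ≤ k) (hε : 0 < ε) (hε1 : ε ≤ 1) (hδ : 0 < δ) (hf : f 0 = 0)
    (hm : ∀ A ∈ 𝒜, A.length ≤ m) (hpos : ∀ A ∈ 𝒜, 0 < AMS.fbar f A)
    (hl : (AMS.lambdaSet f 𝒜).Nonempty)
    (hw : 1 ≤ w) (hD : D = 2 ^ b) (hW : 2 ^ w = D ^ 4) (hSD : 4 + 5 * S + 5 ≤ D) (hn : n ≤ D)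
    (hmD : 2 * m + 2 ≤ D) (hmε : (m : ℝ) / D ≤ ε / 16) (hQ : 1 ≤ Q) (hB : k + 1 ≤ B) (hE : 0 ≤ E)
    (hBE : E * (1 + 2 / (ε / (4 * AMS.lam f 𝒜))) ≤ B) (hS : 0 < S)
    (hrec : S * ((m + 1) / 2 ^ Q) ≤ δ / 4)
    (hacc : S * ((m * (m + 1) * (b + 1) : ℕ) * (2 * Real.exp (-(E ^ 2 / (4 * k))))) ≤ δ / 4)
    (hche : 2 * Real.exp (-(S * (45 / (16 * AMS.supPi f 𝒜)) * (ε / 4) ^ 2 / 4)) ≤ δ / 4)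
    (l : List (Fin k × Fin n)) (hA : l.map Prod.snd ∈ 𝒜) :
    coins w {ω | ε * AMS.fbar f (l.map Prod.snd) <
      |(coordinator w k D Q B S f).out
          (run code (coordinator w k D Q B S f) (initMem w (4 + 5 * S) D S) ω l).coord -
        AMS.fbar f (l.map Prod.snd)|} ≤ ENNReal.ofReal δ := by
  classical
  set A := l.map Prod.snd with hAdef
  set F := AMS.fbar f A with hFdef
  have hF : 0 < F := hpos A hA
  have hAl : A.length = l.length := by simp [hAdef]
  have hlen : l.length ≤ m := by rw [← hAl]; exact hm A hA
  have ht : 0 < l.length := by rw [← hAl]; exact AMS.length_pos_of_fbar_pos hF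
  have hne : l ≠ [] := List.length_pos_iff.1 ht
  have hD0 : 0 < D := by omega
  have hD' : (0 : ℝ) < D := by exact_mod_cast hD0
  have hdvd : D ∣ 2 ^ w := by rw [hW]; exact dvd_pow_self D (by norm_num)
  have hlam := AMS.one_le_lam hl
  have hP3 := AMS.three_le_supPi hl hf hpos hm ⟨A, hA⟩
  set Λ := AMS.lam f 𝒜 with hΛ
  set Pi0 := AMS.supPi f 𝒜 with hPi0
  have hε' : 0 < ε / (4 * Λ) := by positivity
  have hε'4 : ε / (4 * Λ) ≤ 1 / 4 := by
    rw [div_le_iff₀ (by positivity)]; linarith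
  -- values at the positions of the stream
  set R : Fin l.length → ℕ := fun τ => AMS.tailFreq A (Fin.cast hAl.symm τ) with hR
  set X : Fin l.length → ℝ := fun τ => AMS.incr f (R τ) with hX
  have hX0 : ∀ τ, 0 ≤ X τ := fun τ => AMS.incr_nonneg hl hA _
  have hXle : ∀ τ, X τ ≤ Pi0 / 3 * F := fun τ => AMS.incr_le hl hf hpos hm hA _
  have hXsum : (∑ τ, X τ) / l.length = F := by
    rw [hFdef, ← AMS.meanX_eq_fbar hf, AMS.meanX]
    rw [show (l.length : ℝ) = (A.length : ℝ) by rw [hAl]]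
    congr 1
    exact Fintype.sum_equiv (finCongr hAl.symm) _ _ fun τ => rfl
  choose J hJ using fun u : Fin l.length → Fin D => exists_isFirstMin ht u
  let V := Fin l.length → Fin D
  have hcardV : (Fintype.card V : ℝ) = (D : ℝ) ^ l.length := by simp [V]
  have hcardV0 : (0 : ℝ) < (D : ℝ) ^ l.length := by positivity
  -- the mean over the tags
  set μ : ℝ := (∑ u : V, X (J u)) / (D : ℝ) ^ l.length with hμ
  have hμF : |μ - F| ≤ ε / 16 * F := by
    have h1 := sum_firstMin_bounds ht hD0 X hX0 J hJ
    rw [hXsum] at h1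
    have e : μ - F = (∑ u : V, X (J u) - (D : ℝ) ^ l.length * F) / (D : ℝ) ^ l.length := by
      rw [hμ]; field_simp
    rw [e, abs_div, abs_of_pos hcardV0, div_le_iff₀ hcardV0]
    refine h1.trans ?_
    have h2 : (l.length : ℝ) / D ≤ ε / 16 := le_trans (by gcongr) hmε
    calc (l.length : ℝ) / D * ((D : ℝ) ^ l.length * F)
        ≤ ε / 16 * ((D : ℝ) ^ l.length * F) := by gcongr
      _ = _ := by ring
  -- the tags of sampler `j`
  set tags : (ℕ → Word w) → ℕ → V := fun ω j τ => tagOf D hD0 (ω (τ.val * S + j)) with htags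
  set bad1 : ℕ → Set (ℕ → Word w) := fun j =>
    {ω | Q ≤ ((List.ofFn fun i => (tags ω j i).val).foldl recordStep (D, 0)).2} with hbad1
  set bad2 : ℕ → Set (ℕ → Word w) := fun j =>
    {ω | ¬ Accurate D b E (tagList l (tags ω j))} with hbad2
  set c : ℝ := Pi0 / 3 * F with hc
  have hc0 : 0 < c := by positivity
  set bad3 : Set (ℕ → Word w) :=
    {ω | ε / 4 * (S * (μ / c)) < |∑ j : Fin S, X (J (tags ω j)) / c - S * (μ / c)|} with hbad3
  have hp1 : ∀ j, coins w (bad1 j) ≤ ENNReal.ofReal ((m + 1) / 2 ^ Q) := by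
    intro j
    refine coins_single_le hD0 hdvd j hS
      (fun u => Q ≤ ((List.ofFn fun i => (u i).val).foldl recordStep (D, 0)).2) _ ?_
    have := card_records_le hD0 l.length Q
    rw [← le_div_iff₀ (by positivity)] at this
    refine this.trans ?_
    rw [mul_comm, mul_div_assoc]
    gcongr
  have hp2 : ∀ j, coins w (bad2 j) ≤ ENNReal.ofReal
      ((m * (m + 1) * (b + 1) : ℕ) * (2 * Real.exp (-(E ^ 2 / (4 * k))))) := by
    intro j
    refine coins_single_le hD0 hdvd j hS (fun u => ¬ Accurate D b E (tagList l u)) _ ?_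
    have := card_not_accurate_le (b := b) (by omega : 0 < k) hE l
    rw [← hD] at this
    refine this.trans ?_
    rw [mul_left_comm]
    gcongr
  have hp3 : coins w bad3 ≤ ENNReal.ofReal (δ / 4) := by
    refine coins_family_le hD0 hdvd
      (fun v => ε / 4 * (S * (μ / c)) < |∑ j : Fin S, X (J (v j)) / c - S * (μ / c)|) _ ?_
    have : Nonempty V := ⟨fun _ => ⟨0, hD0⟩⟩
    have hch := card_chernoff (V := V) S (fun u => X (J u) / c) (S * (μ / c)) (μ / c) (ε / 4) rfl
      (fun u => div_nonneg (hX0 _) hc0.le) (fun u => (div_le_one hc0).2 (hXle _))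
      (by rw [hcardV, ← Finset.sum_div, hμ]; field_simp) (by linarith) (by linarith)
    rw [hcardV] at hch
    refine hch.trans ?_
    gcongr
    refine le_trans ?_ hche
    have hμ1 : 15 / 16 * F ≤ μ := by
      have h := (abs_le.1 hμF).1
      have : ε / 16 * F ≤ 1 / 16 * F := by gcongr
      linarith
    have hge : 45 / (16 * Pi0) ≤ μ / c := by
      rw [hc, div_le_div_iff₀ (by positivity) (by positivity)]
      calc 45 * (Pi0 / 3 * F) = 15 / 16 * F * (16 * Pi0) := by ring
        _ ≤ μ * (16 * Pi0) := by gcongr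
    gcongr
  -- deterministic part
  have hdet : {ω | ε * F < |(coordinator w k D Q B S f).out
      (run code (coordinator w k D Q B S f) (initMem w (4 + 5 * S) D S) ω l).coord - F|} ⊆
      (⋃ j ∈ Finset.range S, (bad1 j ∪ bad2 j)) ∪ bad3 := by
    intro ω hω
    by_contra hgood
    simp only [Set.mem_union, Set.mem_iUnion, Finset.mem_range, not_or, not_exists] at hgood
    obtain ⟨hg12, hg3⟩ := hgood
    have hsim := simulates_run (f := f) (Q := Q) (B := B) hw hW hSD hn
      (fun l hl hr => Sampler.inRange_after (b := b) hQ hD hmD hB l hl hr) ω l hlen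
    have hsamp : ∀ j < S, |AMS.incr f (Sampler.after D Q B (tagged D S ω l j)).led.estimate -
        X (J (tags ω j))| ≤ ε / 4 * X (J (tags ω j)) := by
      intro j hj
      obtain ⟨hg1, hg2⟩ := hg12 j hj
      have hg1' : ((List.ofFn fun i => (tags ω j i).val).foldl recordStep (D, 0)).2 < Q :=
        not_le.1 hg1
      have hg2' : Accurate D b E (tagList l (tags ω j)) := not_not.1 hg2
      rw [tagged_eq_tagList hD0]
      obtain ⟨l₁, e, l₂, h1, h2⟩ := Sampler.exists_sample (m := m) hQ (by omega) hB hε' hBE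
        (tagList l (tags ω j)) (by rw [length_tagList]; exact hlen)
        (tag_lt_of_mem_tagList l _) hg2' (by rw [map_tag_tagList]; exact hg1')
        (by rw [← List.length_pos_iff, length_tagList]; exact ht)
      obtain ⟨τ, hτ, hcount⟩ := h1.exists_position
      rw [hcount] at h2
      have hJτ : J (tags ω j) = τ := (hJ _).unique hτ
      rw [hJτ]
      have hlamspec := AMS.lam_spec hl hA hε' hε'4 (Fin.cast hAl.symm τ)
        (R := (Sampler.after D Q B (tagList l (tags ω j))).led.estimate)
        (by simp [Ledger.estimate]) h2
      rw [abs_sub_comm] at hlamspec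
      refine hlamspec.trans (le_of_eq ?_)
      change Λ * (ε / (4 * Λ)) * X τ = _
      field_simp
    have hout : (coordinator w k D Q B S f).out
        (run code (coordinator w k D Q B S f) (initMem w (4 + 5 * S) D S) ω l).coord =
        (∑ j : Fin S, AMS.incr f (Sampler.after D Q B (tagged D S ω l j)).led.estimate) / S := by
      change (∑ j ∈ Finset.range S, AMS.incr f _) / (S : ℝ) = _
      rw [Finset.sum_range]
      congr 1
      refine Finset.sum_congr rfl fun j _ => ?_
      rw [← hsim.coord j.val j.isLt]
    have hS' : (0 : ℝ) < S := by exact_mod_cast hS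
    have hfin := combine_errors (O := ∑ j : Fin S,
        AMS.incr f (Sampler.after D Q B (tagged D S ω l j)).led.estimate)
      (M := ∑ j : Fin S, X (J (tags ω j))) hε hε1 hS' hF hμF ?_ ?_
    · rw [← hout] at hfin
      exact absurd hω (not_lt.2 hfin)
    · have h3 : |∑ j : Fin S, X (J (tags ω j)) / c - S * (μ / c)| ≤ ε / 4 * (S * (μ / c)) :=
        not_lt.1 hg3
      rw [← Finset.sum_div] at h3
      have e1 : (∑ j : Fin S, X (J (tags ω j))) / c - S * (μ / c) =
          (∑ j : Fin S, X (J (tags ω j)) - S * μ) / c := by field_simp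
      rw [e1, abs_div, abs_of_pos hc0, div_le_iff₀ hc0] at h3
      refine h3.trans (le_of_eq ?_)
      field_simp
    · rw [← Finset.sum_sub_distrib, Finset.mul_sum]
      exact (Finset.abs_sum_le_sum_abs _ _).trans (Finset.sum_le_sum fun j _ => hsamp j j.isLt)
  -- union bound
  refine (measure_mono hdet).trans ((measure_union_le _ _).trans ?_)
  have hsum : coins w (⋃ j ∈ Finset.range S, (bad1 j ∪ bad2 j)) ≤ ENNReal.ofReal (δ / 2) := by
    refine (measure_biUnion_finset_le _ _).trans ?_
    calc ∑ j ∈ Finset.range S, coins w (bad1 j ∪ bad2 j)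
        ≤ ∑ j ∈ Finset.range S, ENNReal.ofReal ((m + 1) / 2 ^ Q +
          (m * (m + 1) * (b + 1) : ℕ) * (2 * Real.exp (-(E ^ 2 / (4 * k))))) := by
          refine Finset.sum_le_sum fun j _ => (measure_union_le _ _).trans ?_
          rw [ENNReal.ofReal_add (by positivity) (by positivity)]
          exact add_le_add (hp1 j) (hp2 j)
      _ = ENNReal.ofReal (S * ((m + 1) / 2 ^ Q +
          (m * (m + 1) * (b + 1) : ℕ) * (2 * Real.exp (-(E ^ 2 / (4 * k)))))) := by
          rw [Finset.sum_const, Finset.card_range, nsmul_eq_mul,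
            ENNReal.ofReal_mul (Nat.cast_nonneg _), ENNReal.ofReal_natCast]
      _ ≤ ENNReal.ofReal (δ / 2) := by
          apply ENNReal.ofReal_le_ofReal
          rw [mul_add]
          linarith
  calc _ ≤ ENNReal.ofReal (δ / 2) + ENNReal.ofReal (δ / 4) := add_le_add hsum hp3
    _ = ENNReal.ofReal (δ / 2 + δ / 4) :=
      (ENNReal.ofReal_add (by positivity) (by positivity)).symm
    _ ≤ ENNReal.ofReal δ := ENNReal.ofReal_le_ofReal (by linarith)

end Sampling

/-! ## Choice of the parameters -/

namespace Sampling

open Ram Monitor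

theorem logParam_bounds {n m k : ℕ} {ε δ : ℝ} (hn : 1 ≤ n) (hm : 1 ≤ m) (hk : 1 ≤ k) (hε : 0 < ε)
    (hδ : 0 < δ) (hδ1 : δ < 1) :
    8 ≤ 2 ^ AMS.logParam n m k ε δ ∧ n ≤ 2 ^ AMS.logParam n m k ε δ ∧
      m + 1 ≤ 2 ^ AMS.logParam n m k ε δ ∧ ε⁻¹ ≤ (2 : ℝ) ^ AMS.logParam n m k ε δ ∧
      δ⁻¹ ≤ (2 : ℝ) ^ AMS.logParam n m k ε δ := by
  have h : 2 + n + m + k + ⌈ε⁻¹⌉₊ + ⌈δ⁻¹⌉₊ ≤ 2 ^ AMS.logParam n m k ε δ :=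
    Nat.le_pow_clog one_lt_two _
  have h1 : 0 < ⌈ε⁻¹⌉₊ := Nat.ceil_pos.2 (by positivity)
  have h2 : 1 < ⌈δ⁻¹⌉₊ := Nat.lt_ceil.2 (by simpa using (one_lt_inv₀ hδ).2 hδ1)
  refine ⟨by omega, by omega, by omega, ?_, ?_⟩
  · exact (Nat.le_ceil _).trans (by exact_mod_cast (by omega : ⌈ε⁻¹⌉₊ ≤ _))
  · exact (Nat.le_ceil _).trans (by exact_mod_cast (by omega : ⌈δ⁻¹⌉₊ ≤ _))

theorem one_le_log_four_div {δ : ℝ} (hδ : 0 < δ) (hδ1 : δ < 1) :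
    1 ≤ Real.log (2 * (δ / 2)⁻¹) := by
  rw [Real.le_log_iff_exp_le (by positivity)]
  have h1 := Real.exp_one_lt_three
  have h2 : 1 < δ⁻¹ := (one_lt_inv₀ hδ).2 hδ1
  have h3 : 2 * (δ / 2)⁻¹ = 4 * δ⁻¹ := by rw [inv_div]; field_simp; norm_num
  rw [h3]
  linarith

theorem log_four_div_le {δ : ℝ} {L : ℕ} (hL : 3 ≤ L) (hδ : 0 < δ) (hG : δ⁻¹ ≤ (2 : ℝ) ^ L) :
    Real.log (2 * (δ / 2)⁻¹) ≤ 2 * L := by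
  have h3 : 2 * (δ / 2)⁻¹ = 2 ^ 2 * δ⁻¹ := by rw [inv_div]; field_simp
  have h4 : 2 * (δ / 2)⁻¹ ≤ (2 : ℝ) ^ (2 + L) := by rw [h3, pow_add]; gcongr
  have h5 := Real.log_le_log (by positivity) h4
  rw [Real.log_pow] at h5
  have h6 := Real.log_two_lt_d9
  have h7 : (3 : ℝ) ≤ L := by exact_mod_cast hL
  refine h5.trans ?_
  push_cast
  nlinarith

theorem kappa_half {n : ℕ} (ε δ : ℝ) (f : ℕ → ℝ) (𝒜 : Set (List (Fin n))) :
    AMS.kappa (ε / 2) δ f 𝒜 = 4 * (ε⁻¹) ^ 2 * Real.log (2 * δ⁻¹) * AMS.supPi f 𝒜 := by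
  rw [AMS.kappa, ← inv_pow, inv_div, div_pow, inv_pow]
  ring

theorem exp_neg_le_of_four_div {δ z : ℝ} (hδ : 0 < δ) (hδ1 : δ < 1)
    (hz : 2 * Real.log (2 * (δ / 2)⁻¹) ≤ z) : 2 * Real.exp (-z) ≤ δ / 4 := by
  have h3 : 2 * (δ / 2)⁻¹ = (δ / 4)⁻¹ := by rw [inv_div, inv_div]; ring
  rw [h3, Real.log_inv] at hz
  have h : Real.exp (-z) ≤ (δ / 4) ^ 2 := by
    rw [← Real.exp_log (show 0 < (δ / 4) ^ 2 by positivity), Real.exp_le_exp, Real.log_pow]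
    push_cast
    linarith
  nlinarith

theorem exp_neg_natCast_le (x : ℕ) : Real.exp (-(x : ℝ)) ≤ ((2 : ℝ) ^ x)⁻¹ := by
  rw [Real.exp_neg]
  have h : (2 : ℝ) ^ x ≤ Real.exp x := by
    rw [← Real.exp_one_pow]
    exact pow_le_pow_left₀ (by norm_num) (by linarith [Real.add_one_le_exp (1 : ℝ)]) _
  exact inv_anti₀ (by positivity) h

theorem sampler_count_le {G S κ ε δ p : ℝ} (hε : 0 < ε) (hδ : 0 < δ) (hδ1 : δ < 1)
    (hp : 0 ≤ p)    (hpG : p ≤ 3 * G) (hεG : ε⁻¹ ≤ G) (hδG : δ⁻¹ ≤ G)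
    (hκ : κ = 4 * (ε⁻¹) ^ 2 * Real.log (2 * (δ / 2)⁻¹) * p) (hS : S ≤ 13 * κ) :
    S ≤ 624 * G ^ 4 := by
  have hG : 0 < G := lt_of_lt_of_le (by positivity) hεG
  have h3 : 2 * (δ / 2)⁻¹ = 4 * δ⁻¹ := by rw [inv_div]; field_simp; norm_num
  have h4 : Real.log (2 * (δ / 2)⁻¹) ≤ 4 * G := by
    refine (Real.log_le_self (by positivity)).trans ?_
    rw [h3]
    linarith
  have h5 := one_le_log_four_div hδ hδ1
  calc S ≤ 13 * (4 * (ε⁻¹) ^ 2 * Real.log (2 * (δ / 2)⁻¹) * p) := by rw [← hκ]; exact hS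
    _ ≤ 13 * (4 * G ^ 2 * (4 * G) * (3 * G)) := by gcongr
    _ = 624 * G ^ 4 := by ring

/-- The threshold for the records is large enough. -/
theorem records_term_le {G S δ m : ℝ} (hG : 8 ≤ G) (hδ : 0 < δ) (hδG : δ⁻¹ ≤ G) (hm : 0 ≤ m)
    (hmG : m + 1 ≤ G) (hS : S ≤ 624 * G ^ 4) : S * ((m + 1) / G ^ 10) ≤ δ / 4 := by
  have hδ1 : 1 ≤ δ * G := by rwa [inv_le_iff_one_le_mul₀' hδ] at hδG
  rw [← mul_div_assoc, div_le_div_iff₀ (by positivity) (by norm_num)]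
  have h8 : (8 : ℝ) ^ 4 ≤ G ^ 4 := by gcongr
  calc S * (m + 1) * 4 ≤ 624 * G ^ 4 * G * 4 := by gcongr
    _ = 2496 * G ^ 5 := by ring
    _ ≤ G ^ 4 * G ^ 5 * 1 := by
        rw [mul_one]; gcongr; linarith
    _ ≤ G ^ 4 * G ^ 5 * (δ * G) := by gcongr
    _ = δ * G ^ 10 := by ring

theorem accurate_term_le {G S δ m x e : ℝ} (hG : 8 ≤ G) (hδ : 0 < δ) (hδG : δ⁻¹ ≤ G) (hm : 0 ≤ m)
    (hmG : m + 1 ≤ G) (hS : S ≤ 624 * G ^ 4) (hx0 : 0 ≤ x) (hx : x ≤ 11 * G) (he0 : 0 ≤ e)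
    (he : e ≤ (G ^ 14)⁻¹) : S * ((m * (m + 1) * x) * (2 * e)) ≤ δ / 4 := by
  have hδ1 : 1 ≤ δ * G := by rwa [inv_le_iff_one_le_mul₀' hδ] at hδG
  have h8 : (8 : ℝ) ^ 6 ≤ G ^ 6 := by gcongr
  have hG0 : 0 < G := by linarith
  calc S * ((m * (m + 1) * x) * (2 * e))
      ≤ 624 * G ^ 4 * ((G * G * (11 * G)) * (2 * (G ^ 14)⁻¹)) := by gcongr; linarith
    _ = 13728 * G ^ 7 / G ^ 14 := by field_simp; norm_num
    _ ≤ δ / 4 := by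
      rw [div_le_div_iff₀ (by positivity) (by norm_num)]
      calc 13728 * G ^ 7 * 4 = 54912 * G ^ 7 := by ring
        _ ≤ G ^ 6 * G ^ 7 * 1 := by rw [mul_one]; gcongr; linarith
        _ ≤ G ^ 6 * G ^ 7 * (δ * G) := by gcongr
        _ = δ * G ^ 14 := by ring

theorem chernoff_term_le {S κ ε δ p : ℝ} (hε : 0 < ε) (hδ : 0 < δ) (hδ1 : δ < 1) (hp : 0 < p)
    (hκ : κ = 4 * (ε⁻¹) ^ 2 * Real.log (2 * (δ / 2)⁻¹) * p) (hS : 12 * κ ≤ S) :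
    2 * Real.exp (-(S * (45 / (16 * p)) * (ε / 4) ^ 2 / 4)) ≤ δ / 4 := by
  apply exp_neg_le_of_four_div hδ hδ1
  have h1 := one_le_log_four_div hδ hδ1
  calc 2 * Real.log (2 * (δ / 2)⁻¹) ≤ 2160 / 1024 * Real.log (2 * (δ / 2)⁻¹) := by
        gcongr; norm_num
    _ = 12 * κ * (45 / (16 * p)) * (ε / 4) ^ 2 / 4 := by
        rw [hκ]; field_simp; ring
    _ ≤ _ := by gcongr

/-- Bound on the number of messages of one sampler. -/
theorem messages_le {L k Λ ε B : ℝ} (hL : 1 ≤ L) (hk : 1 ≤ k) (hΛ : 1 ≤ Λ) (hε : 0 < ε)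
    (hε1 : ε ≤ 1) (hB0 : 0 ≤ B)
    (hB : B ≤ k + 2 + 2 * Real.sqrt (14 * L * k) * (1 + 2 / (ε / (4 * Λ)))) :
    (10 * L + 1) * (1 + k + 10 * L * (B + 1 + k) + B) ≤
      8712 * L ^ 3 * ((k + Real.sqrt k * ε⁻¹) * Λ) := by
  have hs : Real.sqrt (14 * L * k) ≤ 4 * L * Real.sqrt k := by
    rw [Real.sqrt_mul (by positivity)]
    gcongr
    rw [Real.sqrt_le_left (by positivity)]
    nlinarith
  have h1 : 1 + 2 / (ε / (4 * Λ)) ≤ 9 * (Λ * ε⁻¹) := by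
    have : 1 ≤ Λ * ε⁻¹ := by
      have := (one_le_inv₀ hε).2 hε1
      nlinarith
    have e : 2 / (ε / (4 * Λ)) = 8 * (Λ * ε⁻¹) := by field_simp; norm_num
    linarith
  set y := Real.sqrt k * (Λ * ε⁻¹) with hy
  have hy0 : 0 ≤ y := by positivity
  have hB' : B ≤ 3 * k + 72 * L * y := by
    have : 2 * Real.sqrt (14 * L * k) * (1 + 2 / (ε / (4 * Λ))) ≤
        2 * (4 * L * Real.sqrt k) * (9 * (Λ * ε⁻¹)) := by gcongr
    rw [hy]
    linarith
  have hLk : k ≤ L * k := le_mul_of_one_le_left (by linarith) hL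
  have hLy : 0 ≤ L * y := by positivity
  calc (10 * L + 1) * (1 + k + 10 * L * (B + 1 + k) + B)
      ≤ (10 * L + L) * (L * (k + k) + 10 * L * (B + k + k) + L * (3 * k + 72 * L * y)) := by
        have e1 : 1 + k ≤ L * (k + k) := by nlinarith
        have e2 : B ≤ L * (3 * k + 72 * L * y) :=
          hB'.trans (le_mul_of_one_le_left (by positivity) hL)
        have e3 : 10 * L * (B + 1 + k) ≤ 10 * L * (B + k + k) := by gcongr
        have e4 : 0 ≤ L * (k + k) + 10 * L * (B + k + k) + L * (3 * k + 72 * L * y) := by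
          positivity
        calc _ ≤ (10 * L + 1) * (L * (k + k) + 10 * L * (B + k + k) + L * (3 * k + 72 * L * y)) := by
              gcongr
          _ ≤ _ := by gcongr
    _ ≤ (10 * L + L) * (L * (k + k) + 10 * L * ((3 * k + 72 * L * y) + k + k) +
          L * (3 * k + 72 * L * y)) := by gcongr
    _ = 605 * (L ^ 2 * k * 1 * 1) + 8712 * L ^ 3 * y := by ring
    _ ≤ 8712 * (L ^ 2 * k * L * Λ) + 8712 * L ^ 3 * y := by gcongr; norm_num
    _ = _ := by rw [hy]; ring

end Sampling

namespace Sampling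

open Ram Monitor

/-- The total communication, in words. -/
theorem delivered_le {w k n m D Q B b S : ℕ} {f : ℕ → ℝ} (hw : 1 ≤ w) (hW : 2 ^ w = D ^ 4)
    (hSD : 4 + 5 * S + 5 ≤ D) (hn : n ≤ D) (hQ : 1 ≤ Q) (hD : D = 2 ^ b) (hm : 2 * m + 2 ≤ D)
    (hB : k + 1 ≤ B) (ω : ℕ → Word w) (l : List (Fin k × Fin n)) (hl : l.length ≤ m) :
    (run code (coordinator w k D Q B S f) (initMem w (4 + 5 * S) D S) ω l).delivered ≤
      S * ((Q + 1) * epochCost k B b) := by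
  have hsim := simulates_run (f := f) (Q := Q) (B := B) hw hW hSD hn
    (fun l hl hr => Sampler.inRange_after (b := b) hQ hD hm hB l hl hr) ω l hl
  have hD0 : 0 < D := by omega
  rw [hsim.delivered]
  refine (Finset.sum_le_card_nsmul _ _ ((Q + 1) * epochCost k B b) fun j _ => ?_).trans (by simp)
  rw [tagged_eq_tagList hD0]
  exact Sampler.cost_after_le (m := m) hQ (by omega) hB _ (by rw [length_tagList]; exact hl)
    (tag_lt_of_mem_tagList l _)

end Sampling

open Sampling in
theorem mainTheorem4 :
    ∃ (C : ℕ) (P : Monitor.SiteCode),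
      ∀ (n m k : ℕ) (ε δ : ℝ) (f : ℕ → ℝ) (𝒜 : Set (List (Fin n))),
        1 ≤ k → 0 < ε → ε ≤ 1 → 0 < δ → δ < 1 →
        (∀ x, 0 ≤ f x) → f 0 = 0 →
        𝒜.Nonempty → (∀ A ∈ 𝒜, A.length ≤ m) →
        (∀ A ∈ 𝒜, 0 < AMS.fbar f A) → (AMS.lambdaSet f 𝒜).Nonempty →
        ∃ (w cells : ℕ) (mem₀ : Fin cells → Ram.Word w) (co : Monitor.Coordinator w k),
          -- words have logarithmic length
          1 ≤ w ∧ w ≤ C * AMS.logParam n m k ε δ ∧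
          -- accuracy at every time step at which the stream received so far belongs to the class
          (∀ (stream : List (Fin k × Fin n)) (t : ℕ),
            (stream.take t).map Prod.snd ∈ 𝒜 →
            Monitor.coins w {ω |
              ε * AMS.fbar f ((stream.take t).map Prod.snd) <
                |co.out (Monitor.run P co mem₀ ω (stream.take t)).coord -
                  AMS.fbar f ((stream.take t).map Prod.snd)|} ≤ ENNReal.ofReal δ) ∧
          -- space per site, in bits
          ((cells * w : ℕ) : ℝ) ≤
            C * (AMS.logParam n m k ε δ : ℝ) ^ C * AMS.kappa (ε / 2) (δ / 2) f 𝒜 ∧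
          ∀ (stream : List (Fin k × Fin n)) (ω : ℕ → Ram.Word w), stream.length ≤ m →
            (Monitor.run P co mem₀ ω stream).pending = [] ∧
            -- total communication, in bits
            (((Monitor.run P co mem₀ ω stream).delivered * w : ℕ) : ℝ) ≤
              C * (AMS.logParam n m k ε δ : ℝ) ^ C *
                ((k / ε ^ 2 + Real.sqrt k / ε ^ 3) * AMS.lam f 𝒜 * AMS.supPi f 𝒜) ∧
            -- amortized time per item, and time per received message, at every site
            ∀ i : Fin k,
              ((Monitor.run P co mem₀ ω stream).itemSteps i : ℝ) ≤
                C * AMS.kappa (ε / 2) (δ / 2) f 𝒜 * (Monitor.run P co mem₀ ω stream).items i ∧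
              (Monitor.run P co mem₀ ω stream).msgSteps i ≤
                C * (Monitor.run P co mem₀ ω stream).msgs i := by
  refine ⟨40000000 + 14 * unitCost, code, ?_⟩
  intro n m k ε δ f 𝒜 hk hε hε1 hδ hδ1 _ hf hne hm hpos hl
  obtain ⟨A₀, hA₀⟩ := hne
  have hA₀len : 0 < A₀.length := AMS.length_pos_of_fbar_pos (hpos A₀ hA₀)
  have hm1 : 1 ≤ m := hA₀len.trans_le (hm A₀ hA₀)
  have hn1 : 1 ≤ n := Fin.pos (A₀.get ⟨0, hA₀len⟩)
  obtain ⟨hG8, hnG, hmG, hεG, hδG⟩ := logParam_bounds hn1 hm1 hk hε hδ hδ1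
  have hlam := AMS.one_le_lam hl
  have hp3 := AMS.three_le_supPi hl hf hpos hm ⟨A₀, hA₀⟩
  have hpm := AMS.supPi_le hl hf hpos hm ⟨A₀, hA₀⟩
  set L := AMS.logParam n m k ε δ with hLdef
  have hκ := kappa_half ε (δ / 2) f 𝒜
  set κ := AMS.kappa (ε / 2) (δ / 2) f 𝒜 with hκdef
  set Λ := AMS.lam f 𝒜
  set p := AMS.supPi f 𝒜
  have hL : 3 ≤ L := (Nat.pow_le_pow_iff_right one_lt_two).1 (by simpa using hG8)
  have hL' : (3 : ℝ) ≤ L := by exact_mod_cast hL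
  set G : ℝ := (2 : ℝ) ^ L with hG
  have hG8' : 8 ≤ G := by rw [hG]; exact_mod_cast hG8
  have hmG' : (m : ℝ) + 1 ≤ G := by rw [hG]; exact_mod_cast hmG
  have hLG : (L : ℝ) ≤ G := by rw [hG]; exact_mod_cast Nat.lt_two_pow_self.le
  have hlog1 := one_le_log_four_div hδ hδ1
  have hlogL := log_four_div_le hL hδ hδG
  have hκ1 : 1 ≤ κ := by
    have h1 : 1 ≤ (ε⁻¹) ^ 2 := one_le_pow₀ ((one_le_inv₀ hε).2 hε1)
    rw [hκ]
    calc (1 : ℝ) ≤ 4 * 1 * 1 * 3 := by norm_num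
      _ ≤ _ := by gcongr
  -- the parameters of the algorithm
  set b := 10 * L with hb
  set D := 2 ^ b with hD
  have hDG : (D : ℝ) = G ^ 10 := by rw [hD, hb, hG, ← pow_mul, mul_comm 10]; push_cast; rfl
  set S := ⌈12 * κ⌉₊ with hS
  have hSge : 12 * κ ≤ S := Nat.le_ceil _
  have hSle : (S : ℝ) ≤ 13 * κ := by
    have := Nat.ceil_lt_add_one (show 0 ≤ 12 * κ by linarith)
    linarith
  have hSG : (S : ℝ) ≤ 624 * G ^ 4 :=
    sampler_count_le hε hδ hδ1 (by linarith) (by linarith) hεG hδG hκ hSle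
  set E := 2 * Real.sqrt (14 * L * k) with hE
  have hE0 : 0 ≤ E := by positivity
  set B := k + 1 + ⌈E * (1 + 2 / (ε / (4 * Λ)))⌉₊ with hB
  have hz : 0 ≤ E * (1 + 2 / (ε / (4 * Λ))) := by positivity
  have hBge : E * (1 + 2 / (ε / (4 * Λ))) ≤ B := by
    have := Nat.le_ceil (E * (1 + 2 / (ε / (4 * Λ))))
    rw [hB]; push_cast; linarith [(Nat.cast_nonneg k : (0 : ℝ) ≤ k)]
  have hBle : (B : ℝ) ≤ k + 2 + E * (1 + 2 / (ε / (4 * Λ))) := by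
    have := Nat.ceil_lt_add_one hz
    rw [hB]; push_cast; linarith
  have hW : 2 ^ (4 * b) = D ^ 4 := by rw [hD, ← pow_mul, mul_comm]
  have hG4 : (8 : ℝ) ^ 6 ≤ G ^ 6 := by gcongr
  have hG1 : 1 ≤ G ^ 4 := one_le_pow₀ (by linarith)
  have hG10 : G ^ 10 = G ^ 6 * G ^ 4 := by ring
  have hSD : 4 + 5 * S + 5 ≤ D := by
    have : (4 + 5 * S + 5 : ℝ) ≤ D := by
      rw [hDG, hG10]
      nlinarith
    exact_mod_cast this
  have hGD : 2 ^ L ≤ D := Nat.pow_le_pow_right (by norm_num) (by omega)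
  have hnD : n ≤ D := hnG.trans hGD
  have hmD : 2 * m + 2 ≤ D := by
    have h1 : 2 ^ (L + 1) ≤ D := Nat.pow_le_pow_right (by norm_num) (by omega)
    rw [pow_succ] at h1
    omega
  have hQ : 1 ≤ b := by omega
  have hBk : k + 1 ≤ B := by omega
  have hw : 1 ≤ 4 * b := by omega
  have hS0 : 0 < S := Nat.ceil_pos.2 (by linarith)
  have hCR : ((40000000 + 14 * unitCost : ℕ) : ℝ) = 40000000 + 14 * (unitCost : ℝ) := by push_cast; rfl
  have hu0 : (0 : ℝ) ≤ unitCost := Nat.cast_nonneg _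
  have hpow : ∀ j ≤ 5, (L : ℝ) ^ j ≤ (L : ℝ) ^ (40000000 + 14 * unitCost) := fun j hj =>
    pow_le_pow_right₀ (by linarith) (by omega)
  refine ⟨4 * b, 4 + 5 * S, initMem (4 * b) (4 + 5 * S) D S, coordinator (4 * b) k D b B S f, hw,
    ?_, ?_, ?_, ?_⟩
  · rw [hb, ← mul_assoc]
    exact Nat.mul_le_mul_right _ (by omega)
  · intro stream t hA
    refine coins_error_le (m := m) hk hε hε1 hδ hf hm hpos hl hw hD hW hSD hnD hmD ?_ hQ hBk hE0
      hBge hS0 ?_ ?_ (chernoff_term_le hε hδ hδ1 (by linarith) hκ hSge) _ hA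
    · have hε2 : 1 ≤ ε * G := by rwa [inv_le_iff_one_le_mul₀' hε] at hεG
      have h8 : (8 : ℝ) ^ 8 ≤ G ^ 8 := by gcongr
      rw [hDG, div_le_div_iff₀ (by positivity) (by norm_num)]
      calc (m : ℝ) * 16 ≤ G * G ^ 8 := by gcongr <;> linarith
        _ = G ^ 9 * 1 := by ring
        _ ≤ G ^ 9 * (ε * G) := by gcongr
        _ = ε * G ^ 10 := by ring
    · have := records_term_le hG8' hδ hδG (Nat.cast_nonneg m) hmG' hSG
      rwa [← hDG, hD, Nat.cast_pow, Nat.cast_ofNat] at this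
    · have hexp : E ^ 2 / (4 * k) = ((14 * L : ℕ) : ℝ) := by
        have : (k : ℝ) ≠ 0 := by positivity
        rw [hE, mul_pow, Real.sq_sqrt (by positivity)]
        push_cast
        field_simp
        norm_num
      rw [hexp]
      have he := exp_neg_natCast_le (14 * L)
      rw [mul_comm 14, pow_mul, ← hG] at he
      push_cast
      refine accurate_term_le hG8' hδ hδG (Nat.cast_nonneg m) hmG' hSG (by positivity) ?_
        (Real.exp_pos _).le (by rw [mul_comm (14 : ℝ)]; push_cast at he; exact he)
      rw [hb]; push_cast; linarith
  · rw [hCR]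
    calc (((4 + 5 * S) * (4 * b) : ℕ) : ℝ) = (4 + 5 * S) * (40 * L) := by
          rw [hb]; push_cast; ring
      _ ≤ (4 * κ + 5 * (13 * κ)) * (40 * L) := by gcongr; linarith
      _ = 2760 * (L : ℝ) ^ 1 * κ := by ring
      _ ≤ _ := by
          gcongr ?_ * ?_ * _
          · linarith
          · exact hpow 1 (by norm_num)
  · intro stream ω hlen
    have hsim := simulates_run (f := f) (Q := b) (B := B) hw hW hSD hnD
      (fun l hl hr => Sampler.inRange_after (b := b) hQ hD hmD hBk l hl hr) ω stream hlen
    refine ⟨hsim.pending, ?_, fun i => ⟨?_, ?_⟩⟩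
    · have hdel := delivered_le (f := f) hw hW hSD hnD hQ hD hmD hBk ω stream hlen
      have hmsg := messages_le (by linarith) (by exact_mod_cast hk) hlam hε hε1
        (Nat.cast_nonneg B) hBle
      have hdel' : ((Monitor.run code (coordinator (4 * b) k D b B S f)
          (initMem (4 * b) (4 + 5 * S) D S) ω stream).delivered : ℝ) ≤
          S * ((10 * L + 1) * (1 + k + 10 * L * (B + 1 + k) + B)) := by
        have h : ((S * ((b + 1) * epochCost k B b) : ℕ) : ℝ) =
            S * ((10 * L + 1) * (1 + k + 10 * L * (B + 1 + k) + B)) := by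
          rw [epochCost, hb]; push_cast; ring
        rw [← h]
        exact_mod_cast hdel
      rw [hCR, Nat.cast_mul]
      calc _ ≤ 13 * (4 * (ε⁻¹) ^ 2 * (2 * L) * p) *
            (8712 * (L : ℝ) ^ 3 * ((k + Real.sqrt k * ε⁻¹) * Λ)) * ((4 * b : ℕ) : ℝ) := by
            gcongr
            refine hdel'.trans ?_
            gcongr
            refine hSle.trans ?_
            rw [hκ]
            gcongr
        _ = 36241920 * (L : ℝ) ^ 5 * ((k / ε ^ 2 + Real.sqrt k / ε ^ 3) * Λ * p) := by
            rw [hb]; push_cast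
            field_simp
            ring
        _ ≤ _ := by
            gcongr ?_ * ?_ * _
            · linarith
            · exact hpow 5 le_rfl
    · have h := hsim.itemSteps i
      generalize (Monitor.run code _ _ ω stream).itemSteps i = T at h ⊢
      generalize (Monitor.run code _ _ ω stream).items i = I at h ⊢
      calc (T : ℝ) ≤ ((unitCost * (S + 1) * I : ℕ) : ℝ) := by exact_mod_cast h
        _ = unitCost * (S + 1) * I := by push_cast; rfl
        _ ≤ unitCost * (13 * κ + κ) * I := by gcongr
        _ = 14 * unitCost * κ * I := by ring
        _ ≤ _ := by rw [hCR]; gcongr; linarith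
    · exact (hsim.msgSteps i).trans (Nat.mul_le_mul_right _ (by omega))
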